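/- Let $r\ge 2$ be an integer, let $\alpha,\beta>0$, $w(x)=x^{\alpha}(1-x)^{\beta}$, $\varphi(x)=\sqrt{x(1-x)}$ and $\delta_n(x)=\varphi(x)+n^{-1/2}$. Let $C_w$ be the set of continuous functions $f$ on $(0,1)$ with $\lim_{x\to0+}w(x)f(x)=\lim_{x\to1-}w(x)f(x)=0$. Let $\phi$ be an admissible step-weight with exponents $\beta(0),\beta(1)\ge 0$: for every $[a,b]\subset(0,1)$ there is $M>0$ with $M^{-1}\le\phi\le M$ on $[a,b]$, and $\phi(x)\sim x^{\beta(0)}$ as $x\to0+$, $\phi(x)\sim(1-x)^{\beta(1)}$ as $x\to1-$ (two-sided bounds up to positive constants). Assume $\min\{\beta(0),\beta(1)\}\ge\frac12$. *Operators.* Let $B_n(g,x)=\sum_{k=0}^n g(\tfrac kn)\binom nk x^k(1-x)^{n-k}$. For every $n\ge1$ let integers $n=n_0<n_1<\dots<n_{r-2}\le Kn$ and real numbers $C_0(n),\dots,C_{r-2}(n)$ be given with $\sum_i|C_i(n)|\le K$, $\sum_iC_i(n)=1$ and $\sum_iC_i(n)n_i^{-k}=0$ for $k=1,\dots,r-2$,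 where $K$ does not depend on $n$. Put $B_{n,r-1}(g,x)=\sum_{i=0}^{r-2}C_i(n)B_{n_i}(g,x)$. Let $\psi:\mathbb R\to[0,1]$ be continuous and nondecreasing with $\psi=0$ on $(-\infty,0]$ and $\psi=1$ on $[1,\infty)$. For $f\in C_w$ and $n>\max\{r,4\}$ let $L_r$ and $R_r$ be the polynomials of degree at most $r-1$ which interpolate $f$ at $\frac1n,\dots,\frac rn$ and at $1-\frac1n,\dots,1-\frac rn$, respectively, and let $$F_n(x)=\begin{cases}L_r(x),&0\le x\le\frac1n,\\(1-\psi(nx-1))L_r(x)+\psi(nx-1)f(x),&\frac1n\le x\le\frac2n,\\f(x),&\frac2n\le x\le1-\frac2n,\\(1-\psi(n(1-x)-1))R_r(x)+\psi(n(1-x)-1)f(x),&1-\frac2n\le x\le1-\frac1n,\\R_r(x),&1-\frac1n\le x\le1,\end{cases}\qquad B^*_{n,r-1}(f,x)=B_{n,r-1}(F_n,x).$$ *Modulus.* Let $\Delta^r_sf(x)=\sum_{k=0}^r(-1)^k\binom rkf(x+(\tfrac r2-k)s)$, $\overrightarrow\Delta{}^r_hf(x)=\sum_{k=0}^r(-1)^k\binom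 rkf(x+(r-k)h)$, $\overleftarrow\Delta{}^r_hf(x)=\sum_{k=0}^r(-1)^k\binom rkf(x-kh)$. Let $A$ be any constant with $\phi(x)\le Ax^{\beta(0)}$ and $\phi(x)\le A(1-x)^{\beta(1)}$ on $(0,1)$. For $j=0,1$ put $t^*_j=(Art)^{1/(1-\beta(j))}$ if $\beta(j)<1$ and $t^*_j=0$ if $\beta(j)\ge1$. The weighted Ditzian–Totik modulus of smoothness is $$\omega^r_\phi(f,t)_w=\sup_{0<h\le t}\|w\Delta^r_{h\phi}f\|_{[t^*_0,1-t^*_1]}+\sup_{0<h\le t^*_0}\|w\overrightarrow\Delta{}^r_hf\|_{[0,12t^*_0]}+\sup_{0<h\le t^*_1}\|w\overleftarrow\Delta{}^r_hf\|_{[1-12t^*_1,1]},$$ where $\|\cdot\|_S$ is the supremum of the absolute value over $S\cap(0,1)$, and suprema over the empty set are $0$. For small $t$ all arguments of $f$ lie in $(0,1)$. *Theorem.* For $f\in C_w$ and $0<\alpha_0<r$ the following are equivalent: 1. there are $C$ and $N$ such that $w(x)\,|f(x)-B^*_{n,r-1}(f,x)|\le C\bigl(n^{-1/2}\phi(x)^{-1}\delta_n(x)\bigr)^{\alpha_0}$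 for all $n\ge N$ and $x\in(0,1)$; 2. $\omega^r_\phi(f,t)_w=O(t^{\alpha_0})$ as $t\to0+$. -/

import Mathlib

open Set Filter Topology
open scoped ENNReal

namespace BernsteinComb

/-- The weight `w(x) = x^α (1-x)^β`. -/
noncomputable def weight (α β x : ℝ) : ℝ := x ^ α * (1 - x) ^ β

/-- The class `C_w`: functions continuous on the open interval `(0,1)` with `w f → 0` at both
endpoints. Values of `f` outside `(0,1)` are irrelevant. -/
structure MemCw (α β : ℝ) (f : ℝ → ℝ) : Prop where
  continuousOn : ContinuousOn f (Ioo 0 1)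
  tendsto_zero : Tendsto (fun x => weight α β x * f x) (𝓝[>] 0) (𝓝 0)
  tendsto_one : Tendsto (fun x => weight α β x * f x) (𝓝[<] 1) (𝓝 0)

/-- `φ(x) = √(x(1-x))`. -/
noncomputable def varphi (x : ℝ) : ℝ := √(x * (1 - x))

/-- `δ_n(x) = √(x(1-x)) + 1/√n`. -/
noncomputable def delta (n : ℕ) (x : ℝ) : ℝ := varphi x + 1 / √(n : ℝ)

/-- Admissible step-weight functions on `(0,1)` with endpoint exponents `b₀`, `b₁`. -/
structure IsAdmissibleStepWeight (ϕ : ℝ → ℝ) (b₀ b₁ : ℝ) : Prop where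
  exponent_zero : 0 ≤ b₀
  exponent_one : 0 ≤ b₁
  /-- bounded above and below on compact subintervals of `(0,1)` -/
  compact_bound : ∀ a b : ℝ, 0 < a → a ≤ b → b < 1 →
    ∃ M : ℝ, 0 < M ∧ ∀ x ∈ Icc a b, M⁻¹ ≤ ϕ x ∧ ϕ x ≤ M
  /-- `ϕ(x) ∼ x^{b₀}` as `x → 0+` -/
  near_zero : ∃ M : ℝ, 0 < M ∧
    ∀ᶠ x in 𝓝[>] (0 : ℝ), M⁻¹ * x ^ b₀ ≤ ϕ x ∧ ϕ x ≤ M * x ^ b₀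
  /-- `ϕ(x) ∼ (1-x)^{b₁}` as `x → 1-` -/
  near_one : ∃ M : ℝ, 0 < M ∧
    ∀ᶠ x in 𝓝[<] (1 : ℝ), M⁻¹ * (1 - x) ^ b₁ ≤ ϕ x ∧ ϕ x ≤ M * (1 - x) ^ b₁

/-- The Bernstein operator `B_n(g,x) = ∑_{k=0}^n g(k/n) p_{n,k}(x)`. -/
noncomputable def bernsteinOp (n : ℕ) (g : ℝ → ℝ) (x : ℝ) : ℝ :=
  ∑ k ∈ Finset.range (n + 1),
    g ((k : ℝ) / n) * ((n.choose k : ℝ) * x ^ k * (1 - x) ^ (n - k))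

/-- The nodes `n_i = nd n i` and coefficients `C_i(n) = c n i` (`0 ≤ i < m`) of the Ditzian–Totik
combinations with `m` terms. -/
structure IsCombination (m : ℕ) (nd : ℕ → ℕ → ℕ) (c : ℕ → ℕ → ℝ) : Prop where
  node_zero : ∀ n : ℕ, 1 ≤ n → nd n 0 = n
  node_lt : ∀ n : ℕ, 1 ≤ n → ∀ i j : ℕ, i < j → j < m → nd n i < nd n j
  node_le : ∃ K : ℝ, ∀ n : ℕ, 1 ≤ n → ∀ i : ℕ, i < m → (nd n i : ℝ) ≤ K * n
  coeff_bound : ∃ K : ℝ, ∀ n : ℕ, 1 ≤ n → ∑ i ∈ Finset.range m, |c n i| ≤ K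
  coeff_sum : ∀ n : ℕ, 1 ≤ n → ∑ i ∈ Finset.range m, c n i = 1
  coeff_moment : ∀ n : ℕ, 1 ≤ n → ∀ k : ℕ, 1 ≤ k → k < m →
    ∑ i ∈ Finset.range m, c n i * ((nd n i : ℝ) ^ k)⁻¹ = 0

/-- The combination `B_{n,m}(g,x) = ∑_{i=0}^{m-1} C_i(n) B_{n_i}(g,x)`. -/
noncomputable def bernsteinComb (m : ℕ) (nd : ℕ → ℕ → ℕ) (c : ℕ → ℕ → ℝ)
    (n : ℕ) (g : ℝ → ℝ) (x : ℝ) : ℝ :=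
  ∑ i ∈ Finset.range m, c n i * bernsteinOp (nd n i) g x

/-- `L_r(f,·)`: the Lagrange interpolation polynomial of `f` at `i/n`, `i = 1, …, r`. -/
noncomputable def leftInterp (r n : ℕ) (f : ℝ → ℝ) (x : ℝ) : ℝ :=
  (Lagrange.interpolate (Finset.Icc 1 r) (fun i : ℕ => (i : ℝ) / n)
    (fun i : ℕ => f ((i : ℝ) / n))).eval x

/-- `R_r(f,·)`: the Lagrange interpolation polynomial of `f` at `1 - i/n`, `i = 1, …, r`. -/
noncomputable def rightInterp (r n : ℕ) (f : ℝ → ℝ) (x : ℝ) : ℝ :=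
  (Lagrange.interpolate (Finset.Icc 1 r) (fun i : ℕ => 1 - (i : ℝ) / n)
    (fun i : ℕ => f (1 - (i : ℝ) / n))).eval x

/-- Cutoff functions: `0` on `(-∞,0]`, `1` on `[1,∞)`, continuous and nondecreasing. -/
structure IsCutoff (ψ : ℝ → ℝ) : Prop where
  continuous : Continuous ψ
  monotone : Monotone ψ
  eq_zero : ∀ x, x ≤ 0 → ψ x = 0
  eq_one : ∀ x, 1 ≤ x → ψ x = 1

/-- The modified function `F_n`: `f` replaced near the endpoints by `L_r` and `R_r`. -/
noncomputable def modFun (ψ : ℝ → ℝ) (r n : ℕ) (f : ℝ → ℝ) (x : ℝ) : ℝ :=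
  if x ≤ 1 / (n : ℝ) then leftInterp r n f x
  else if x ≤ 2 / (n : ℝ) then
    (1 - ψ (n * x - 1)) * leftInterp r n f x + ψ (n * x - 1) * f x
  else if x < 1 - 2 / (n : ℝ) then f x
  else if x < 1 - 1 / (n : ℝ) then
    (1 - ψ (n * (1 - x) - 1)) * rightInterp r n f x + ψ (n * (1 - x) - 1) * f x
  else rightInterp r n f x

/-- The modified combination `B*_{n,r-1}(f,x) = B_{n,r-1}(F_n,x)`. -/
noncomputable def bernsteinStar (ψ : ℝ → ℝ) (r : ℕ) (nd : ℕ → ℕ → ℕ) (c : ℕ → ℕ → ℝ)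
    (n : ℕ) (f : ℝ → ℝ) (x : ℝ) : ℝ :=
  bernsteinComb (r - 1) nd c n (modFun ψ r n f) x

/-- Symmetric difference `∑ (-1)^k C(r,k) f(x + (r/2 - k) s)`. -/
noncomputable def symmDifference (r : ℕ) (s : ℝ) (f : ℝ → ℝ) (x : ℝ) : ℝ :=
  ∑ k ∈ Finset.range (r + 1), (-1) ^ k * (r.choose k : ℝ) * f (x + ((r : ℝ) / 2 - k) * s)

/-- Forward difference `∑ (-1)^k C(r,k) f(x + (r-k) h)`. -/
noncomputable def fwdDifference (r : ℕ) (h : ℝ) (f : ℝ → ℝ) (x : ℝ) : ℝ :=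
  ∑ k ∈ Finset.range (r + 1), (-1) ^ k * (r.choose k : ℝ) * f (x + ((r : ℝ) - k) * h)

/-- Backward difference `∑ (-1)^k C(r,k) f(x - k h)`. -/
noncomputable def bwdDifference (r : ℕ) (h : ℝ) (f : ℝ → ℝ) (x : ℝ) : ℝ :=
  ∑ k ∈ Finset.range (r + 1), (-1) ^ k * (r.choose k : ℝ) * f (x - (k : ℝ) * h)

/-- The endpoint scale `t* = (A r t)^{1/(1-b)}` for `b < 1`, and `t* = 0` for `b ≥ 1`. -/
noncomputable def tStar (A : ℝ) (r : ℕ) (b t : ℝ) : ℝ :=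
  if b < 1 then (A * r * t) ^ (1 / (1 - b)) else 0

/-- The weighted supremum `sup_{x ∈ S ∩ (0,1)} |w(x) g(x)|`, as an extended nonnegative number. -/
noncomputable def weightedSup (α β : ℝ) (g : ℝ → ℝ) (S : Set ℝ) : ℝ≥0∞ :=
  ⨆ x ∈ S ∩ Ioo 0 1, ENNReal.ofReal |weight α β x * g x|

/-- The weighted Ditzian–Totik modulus of smoothness `ω_ϕ^r(f,t)_w`, for a step-weight with
endpoint exponents `b₀`, `b₁` and `ϕ(x) ≤ A x^{b₀}`, `ϕ(x) ≤ A (1-x)^{b₁}` on `(0,1)`.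
For small `t` all arguments of `f` below lie in `(0,1)`. -/
noncomputable def dtModulus (A : ℝ) (r : ℕ) (α β b₀ b₁ : ℝ) (ϕ f : ℝ → ℝ) (t : ℝ) : ℝ≥0∞ :=
  (⨆ h ∈ Ioc 0 t, weightedSup α β (fun x => symmDifference r (h * ϕ x) f x)
      (Icc (tStar A r b₀ t) (1 - tStar A r b₁ t))) +
  (⨆ h ∈ Ioc 0 (tStar A r b₀ t), weightedSup α β (fun x => fwdDifference r h f x)
      (Icc 0 (12 * tStar A r b₀ t))) +
  (⨆ h ∈ Ioc 0 (tStar A r b₁ t), weightedSup α β (fun x => bwdDifference r h f x)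
      (Icc (1 - 12 * tStar A r b₁ t) 1))

end BernsteinComb

/-! Both conditions are equivalent to a third one, `LocallyApproximable`, imposed at each endpoint:
on [x-σ, x+σ] with σ ≤ x/2, f lies within M x^{-α} (σ x^{-b})^a of a polynomial of degree less than
r. The substitution u ↦ 1-u exchanges the endpoints, so the analysis takes place on (0,1/2]. By
`rpow_mul_delta_eq` the error estimate is a power of s/ϕ(x), where s = √(x(1-x)/n) + 1/n is the
spread of the Bernstein kernel at x.

Two facts about the operator carry the proof. First, B* fixes polynomials of degree less than r: the
moment conditions cancel every lower order term (`bernsteinComb_pow`), and interpolation is exact in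
this degree. Second, the kernel stays absolutely summable, uniformly in n, on the complex disc |z-x|
≤ s, because n(|z|+|1-z|-1) is bounded there (`mul_norm_excess_le`). Hence if f-Q grows polynomially
in units of s, then B*f-Q extends to an entire function bounded on that disc
(`exists_norm_bernsteinComb_modFun_le`). Such a Q comes from local approximability by comparing the
polynomials of neighbouring scales; far from x the size bound |f| ≤ M₀/w takes over
(`exists_polynomial_localGrowth`).

Direct estimate: evaluate at the centre of the disc. Inverse estimate: for a radius σ choose n with
s comparable to Bσ. The hypothesis controls f-B*f, while B*f-Q is holomorphic at scale s, so its
Taylor polynomial on radius σ gains B^{-r}; working at the larger scale s costs only B^a. Since a <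
r, a large B turns the constant M into D+θM with θ small (`exists_improvement`), and iteration from
the trivial bound removes M. The condition b ≥ 1/2, beyond b ≥ 0, enters only there, through
`localScale_mul_rpow_le`.

Modulus: small symmetric differences yield polynomials by a Whitney inequality
(`exists_whitney_bound`). Conversely, r-th differences annihilate polynomials of degree less than r,
and the one-sided endpoint parts follow from descending through dyadic scales
(`exists_abs_sub_le_of_scales`). -/

namespace BernsteinComb

/-! ### Interpolation and extrapolation bounds for polynomials. -/

open Polynomial in
-- Each Lagrange basis polynomial is a product of factors |x - v j| / |v i - v j| ≤ R/δ. The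
-- condition δ ≤ R lets the product over the other nodes be padded to a full power.
theorem abs_interpolate_le {s : Finset ℕ} {v y : ℕ → ℝ} {x δ R K : ℝ} (hδ : 0 < δ) (hR : δ ≤ R)
    (hv : ∀ i ∈ s, ∀ j ∈ s, i ≠ j → δ ≤ |v i - v j|) (hx : ∀ j ∈ s, |x - v j| ≤ R)
    (hy : ∀ i ∈ s, |y i| ≤ K) :
    |(Lagrange.interpolate s v y).eval x| ≤ s.card * (R / δ) ^ s.card * K := by
  have h1 : 1 ≤ R / δ := by rwa [le_div_iff₀ hδ, one_mul]
  rw [Lagrange.interpolate_apply, eval_finsetSum]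
  refine (Finset.abs_sum_le_sum_abs _ _).trans ?_
  have : ∀ i ∈ s, |eval x (C (y i) * Lagrange.basis s v i)| ≤ (R / δ) ^ s.card * K := by
    intro i hi
    rw [eval_mul, eval_C, abs_mul, mul_comm]
    have hK : 0 ≤ K := (abs_nonneg _).trans (hy i hi)
    refine mul_le_mul ?_ (hy i hi) (abs_nonneg _) (by positivity)
    rw [Lagrange.basis, eval_prod, Finset.abs_prod]
    calc ∏ j ∈ s.erase i, |eval x (Lagrange.basisDivisor (v i) (v j))|
        ≤ ∏ j ∈ s.erase i, (R / δ) := by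
          refine Finset.prod_le_prod (fun _ _ => abs_nonneg _) fun j hj => ?_
          rw [Finset.mem_erase] at hj
          simp only [Lagrange.basisDivisor, eval_mul, eval_C, eval_sub, eval_X, abs_mul, abs_inv]
          rw [mul_comm, ← div_eq_mul_inv]
          exact div_le_div₀ (hδ.le.trans hR) (hx j hj.2) hδ (hv i hi j hj.2 hj.1.symm)
      _ = (R / δ) ^ (s.erase i).card := by rw [Finset.prod_const]
      _ ≤ (R / δ) ^ s.card := pow_le_pow_right₀ h1 (Finset.card_le_card (Finset.erase_subset _ _))
  calc _ ≤ ∑ i ∈ s, (R / δ) ^ s.card * K := Finset.sum_le_sum this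
    _ = _ := by rw [Finset.sum_const, nsmul_eq_mul]; ring

/-- Extrapolation of bounds for polynomials of degree less than `r`. -/
theorem exists_extrapolation_bound (r : ℕ) (hr : 1 ≤ r) :
    ∃ C : ℝ, 1 ≤ C ∧ ∀ (p : Polynomial ℝ) (a l K : ℝ), p.degree < r → 0 < l →
      (∀ u ∈ Icc a (a + l), |p.eval u| ≤ K) →
      ∀ v, |p.eval v| ≤ C * K * (1 + |v - a| / l) ^ r := by
  have hr' : (1 : ℝ) ≤ r := by exact_mod_cast hr
  -- The constant comes from interpolating at r equally spaced nodes with gap δ = l/r and R = l +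
  -- |v-a|, for which R/δ = r(1 + |v-a|/l).
  refine ⟨r * r ^ r, ?_, ?_⟩
  · exact one_le_mul_of_one_le_of_one_le hr' (one_le_pow₀ hr')
  intro p a l K hp hl hK v
  set nd : ℕ → ℝ := fun i => a + l * i / r with hnd
  have hr0 : (0 : ℝ) < r := by linarith
  have hinj : Set.InjOn nd (Finset.Icc 1 r : Finset ℕ) := by
    intro i _ j _ hij
    simp only [hnd] at hij
    field_simp at hij
    exact_mod_cast (mul_left_cancel₀ hl.ne' (by linarith) : (i : ℝ) = j)
  have hpi : p = Lagrange.interpolate (Finset.Icc 1 r) nd fun i => p.eval (nd i) :=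
    Lagrange.eq_interpolate hinj (by simpa using hp)
  rw [hpi]
  have hmem : ∀ j ∈ Finset.Icc 1 r, 0 ≤ l * j / r ∧ l * j / r ≤ l := by
    intro j hj
    rw [Finset.mem_Icc] at hj
    refine ⟨by positivity, ?_⟩
    rw [div_le_iff₀ hr0]
    exact mul_le_mul_of_nonneg_left (by exact_mod_cast hj.2) hl.le
  have := abs_interpolate_le (s := Finset.Icc 1 r) (v := nd) (y := fun i => p.eval (nd i))
    (x := v) (δ := l / r) (R := l + |v - a|) (K := K) (by positivity) ?_ ?_ ?_ ?_
  · refine this.trans (le_of_eq ?_)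
    simp only [Nat.card_Icc, Nat.add_sub_cancel]
    have : (l + |v - a|) / (l / r) = r * (1 + |v - a| / l) := by field_simp
    rw [this, mul_pow]; ring
  · have : l / r ≤ l := div_le_self hl.le hr'
    linarith [abs_nonneg (v - a)]
  · intro i _ j _ hij
    have h1 : nd i - nd j = l / r * ((i : ℝ) - j) := by simp only [hnd]; ring
    have h2 : (1 : ℝ) ≤ |(i : ℝ) - j| := by
      have : (1 : ℤ) ≤ |(i : ℤ) - j| := Int.one_le_abs (sub_ne_zero.2 (by exact_mod_cast hij))
      exact_mod_cast this
    rw [h1, abs_mul, abs_of_pos (by positivity : 0 < l / r)]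
    exact le_mul_of_one_le_right (by positivity) h2
  · intro j hj
    obtain ⟨h1, h2⟩ := hmem j hj
    have : v - nd j = (v - a) - l * j / r := by simp only [hnd]; ring
    rw [this, abs_le]
    constructor <;> linarith [neg_abs_le (v - a), le_abs_self (v - a)]
  · intro j hj
    obtain ⟨h1, h2⟩ := hmem j hj
    exact hK _ ⟨by simp only [hnd]; linarith, by simp only [hnd]; linarith⟩

/-! ### Moments of Bernstein operators and reproduction of polynomials. -/

/-- The logarithmic derivative of x^k (1-x)^(n-k) is (k-nx)/(x(1-x)); clearing the denominator makes
the identity valid at the endpoints too. -/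
theorem hasDerivAt_bernstein_term (n k : ℕ) (hk : k ≤ n) (x : ℝ) :
    ∃ d, HasDerivAt (fun x : ℝ => (n.choose k : ℝ) * x ^ k * (1 - x) ^ (n - k)) d x ∧
      x * (1 - x) * d = (k - n * x) * ((n.choose k : ℝ) * x ^ k * (1 - x) ^ (n - k)) := by
  have h1 := ((hasDerivAt_pow k x).const_mul (n.choose k : ℝ)).mul
    (((hasDerivAt_id x).const_sub 1).pow (n - k))
  refine ⟨_, h1, ?_⟩
  have e1 : (k : ℝ) * (x ^ (k - 1) * x) = k * x ^ k := by
    rcases k with _ | k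
    · simp
    · simp [pow_succ]
  have e2 : ((n - k : ℕ) : ℝ) * ((1 - x) ^ (n - k - 1) * (1 - x)) =
      (n - k : ℕ) * (1 - x) ^ (n - k) := by
    rcases n - k with _ | k
    · simp
    · simp [pow_succ]
  have e3 : ((n - k : ℕ) : ℝ) = n - k := by push_cast [hk]; ring
  simp only [id, Pi.pow_apply]
  rw [e3] at e2 ⊢
  linear_combination (n.choose k : ℝ) * (1 - x) ^ (n - k) * (1 - x) * e1 -
    (n.choose k : ℝ) * x ^ k * x * e2

/-- Write k/n = x + (k-nx)/n; the factor k-nx acts on the kernel as x(1-x) d/dx. This gives a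
recursion for the moments. -/
theorem bernsteinOp_pow_succ (n j : ℕ) (hn : 1 ≤ n) (x d : ℝ)
    (hd : HasDerivAt (bernsteinOp n fun u => u ^ j) d x) :
    bernsteinOp n (fun u => u ^ (j + 1)) x =
      x * bernsteinOp n (fun u => u ^ j) x + x * (1 - x) * d * (n : ℝ)⁻¹ := by
  have hn' : (n : ℝ) ≠ 0 := by positivity
  choose! D hD1 hD2 using hasDerivAt_bernstein_term n
  have h := HasDerivAt.fun_sum (u := Finset.range (n + 1)) (x := x)
    (A := fun k x => ((k : ℝ) / n) ^ j * ((n.choose k : ℝ) * x ^ k * (1 - x) ^ (n - k)))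
    (A' := fun k => ((k : ℝ) / n) ^ j * D k x) fun k hk =>
      (hD1 k (Nat.lt_succ_iff.1 (Finset.mem_range.1 hk)) x).const_mul _
  have hdd : d = _ := hd.unique h
  rw [hdd]
  simp only [bernsteinOp]
  rw [Finset.mul_sum, Finset.mul_sum, Finset.sum_mul, ← Finset.sum_add_distrib]
  refine Finset.sum_congr rfl fun k hk => ?_
  have := hD2 k (Nat.lt_succ_iff.1 (Finset.mem_range.1 hk)) x
  have e : x * (1 - x) * (((k : ℝ) / n) ^ j * D k x) * (n : ℝ)⁻¹ =
      ((k : ℝ) / n) ^ j * (x * (1 - x) * D k x) * (n : ℝ)⁻¹ := by ring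
  rw [e, this, pow_succ]
  field_simp
  ring

theorem bernsteinOp_pow_zero (n : ℕ) (x : ℝ) : bernsteinOp n (fun u => u ^ 0) x = 1 := by
  have := add_pow x (1 - x) n
  simp only [bernsteinOp, pow_zero, one_mul]
  rw [show x + (1 - x) = 1 by ring, one_pow] at this
  refine Eq.trans ?_ this.symm
  exact Finset.sum_congr rfl fun k _ => by ring

open Polynomial in
/-- The moments of the Bernstein operators expand in powers of `1/n`. -/
theorem exists_bernsteinOp_pow_expansion (j : ℕ) (hj : 1 ≤ j) :
    ∃ a : ℕ → ℝ[X], a 0 = X ^ j ∧ (∀ k, j ≤ k → a k = 0) ∧ ∀ n : ℕ, 1 ≤ n → ∀ x : ℝ,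
      bernsteinOp n (fun u => u ^ j) x =
        ∑ k ∈ Finset.range j, (a k).eval x * ((n : ℝ) ^ k)⁻¹ := by
  induction j, hj using Nat.le_induction with
  | base =>
    refine ⟨fun k => if k = 0 then X else 0, by simp, fun k hk => by simp; omega, ?_⟩
    intro n hn x
    have h0 : bernsteinOp n (fun u => u ^ 0) = fun _ => 1 := funext (bernsteinOp_pow_zero n)
    have := bernsteinOp_pow_succ n 0 hn x 0 (by rw [h0]; exact hasDerivAt_const x 1)
    rw [h0] at this
    simpa using this
  | succ j hj ih =>
    obtain ⟨a, ha0, ha, hS⟩ := ih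
    -- The coefficient recursion read off from `bernsteinOp_pow_succ`: differentiation shifts the
    -- power of 1/n by one. The `if` discards the truncated index 0 - 1.
    refine ⟨fun k => X * a k + if k = 0 then 0 else X * (1 - X) * derivative (a (k - 1)), ?_, ?_, ?_⟩
    · simp [ha0, pow_succ']
    · intro k hk
      have h1 : k ≠ 0 := by omega
      simp [ha k (by omega), ha (k - 1) (by omega), h1]
    · intro n hn x
      have hfun : bernsteinOp n (fun u => u ^ j) =
          fun x => ∑ k ∈ Finset.range j, (a k).eval x * ((n : ℝ) ^ k)⁻¹ := funext (hS n hn)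
      have hd : HasDerivAt (bernsteinOp n fun u => u ^ j)
          (∑ k ∈ Finset.range j, (derivative (a k)).eval x * ((n : ℝ) ^ k)⁻¹) x := by
        rw [hfun]
        exact HasDerivAt.fun_sum fun k _ => ((a k).hasDerivAt x).mul_const _
      rw [bernsteinOp_pow_succ n j hn x _ hd, hS n hn x, Finset.sum_range_succ']
      have e1 : ∑ k ∈ Finset.range j, (a k).eval x * ((n : ℝ) ^ k)⁻¹ =
          ∑ k ∈ Finset.range j, (a (k + 1)).eval x * ((n : ℝ) ^ (k + 1))⁻¹ +
            (a 0).eval x * ((n : ℝ) ^ 0)⁻¹ := by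
        rw [← Finset.sum_range_succ' (fun k => (a k).eval x * ((n : ℝ) ^ k)⁻¹),
          Finset.sum_range_succ, ha j le_rfl]
        simp
      rw [e1]
      simp only [eval_add, eval_mul, eval_X, add_eq_zero, one_ne_zero, and_false, if_false,
        Nat.add_sub_cancel, if_true, eval_sub, eval_one, add_mul, add_zero,
        Finset.sum_add_distrib]
      have e2 : ∑ k ∈ Finset.range j, x * (1 - x) * (derivative (a k)).eval x *
          ((n : ℝ) ^ (k + 1))⁻¹ = x * (1 - x) * (∑ k ∈ Finset.range j,
            (derivative (a k)).eval x * ((n : ℝ) ^ k)⁻¹) * (n : ℝ)⁻¹ := by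
        rw [Finset.mul_sum, Finset.sum_mul]
        refine Finset.sum_congr rfl fun k _ => ?_
        rw [pow_succ, mul_inv]; ring
      have e3 : ∑ k ∈ Finset.range j, x * (a (k + 1)).eval x * ((n : ℝ) ^ (k + 1))⁻¹ =
          x * ∑ k ∈ Finset.range j, (a (k + 1)).eval x * ((n : ℝ) ^ (k + 1))⁻¹ := by
        rw [Finset.mul_sum]
        exact Finset.sum_congr rfl fun k _ => by ring
      rw [e2, e3]; ring

/-- Beyond the leading term, the j-th moment involves only n^{-k} with 1 ≤ k < j. For j ≤ m these
are among the powers that the coefficients annihilate; so degree m is reached with just m-1 moment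
conditions. -/
theorem bernsteinComb_pow {m : ℕ} {nd : ℕ → ℕ → ℕ} {c : ℕ → ℕ → ℝ} (hc : IsCombination m nd c)
    {n : ℕ} (hn : 1 ≤ n) (j : ℕ) (hj : j ≤ m) (x : ℝ) :
    bernsteinComb m nd c n (fun u => u ^ j) x = x ^ j := by
  have hnd : ∀ i ∈ Finset.range m, 1 ≤ nd n i := by
    intro i hi
    rw [Finset.mem_range] at hi
    rcases Nat.eq_zero_or_pos i with h | h
    · rw [h, hc.node_zero n hn]; exact hn
    · exact Nat.one_le_of_lt (hc.node_lt n hn 0 i h hi)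
  rcases Nat.eq_zero_or_pos j with h | h
  · subst h
    simp only [bernsteinComb, bernsteinOp_pow_zero, mul_one]
    rw [hc.coeff_sum n hn, pow_zero]
  obtain ⟨a, ha0, -, hS⟩ := exists_bernsteinOp_pow_expansion j h
  have h1 : bernsteinComb m nd c n (fun u => u ^ j) x =
      ∑ k ∈ Finset.range j, (a k).eval x *
        ∑ i ∈ Finset.range m, c n i * ((nd n i : ℝ) ^ k)⁻¹ := by
    simp only [bernsteinComb]
    rw [Finset.sum_congr rfl fun i hi => by rw [hS _ (hnd i hi) x, Finset.mul_sum],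
      Finset.sum_comm]
    refine Finset.sum_congr rfl fun k _ => ?_
    rw [Finset.mul_sum]
    exact Finset.sum_congr rfl fun i _ => by ring
  rw [h1, Finset.sum_eq_single_of_mem 0 (Finset.mem_range.2 h)]
  · simp [ha0, hc.coeff_sum n hn]
  · intro k hk hk0
    rw [hc.coeff_moment n hn k (Nat.pos_of_ne_zero hk0)
      ((Finset.mem_range.1 hk).trans_le hj), mul_zero]

theorem bernsteinOp_sub (n : ℕ) (g h : ℝ → ℝ) (x : ℝ) :
    bernsteinOp n (fun u => g u - h u) x = bernsteinOp n g x - bernsteinOp n h x := by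
  simp only [bernsteinOp, sub_mul, Finset.sum_sub_distrib]

theorem bernsteinComb_sub (m : ℕ) (nd : ℕ → ℕ → ℕ) (c : ℕ → ℕ → ℝ) (n : ℕ) (g h : ℝ → ℝ) (x : ℝ) :
    bernsteinComb m nd c n (fun u => g u - h u) x =
      bernsteinComb m nd c n g x - bernsteinComb m nd c n h x := by
  simp only [bernsteinComb, bernsteinOp_sub, mul_sub, Finset.sum_sub_distrib]

theorem bernsteinComb_sum (m : ℕ) (nd : ℕ → ℕ → ℕ) (c : ℕ → ℕ → ℝ) (n : ℕ) (s : Finset ℕ)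
    (b : ℕ → ℝ) (g : ℕ → ℝ → ℝ) (x : ℝ) :
    bernsteinComb m nd c n (fun u => ∑ j ∈ s, b j * g j u) x =
      ∑ j ∈ s, b j * bernsteinComb m nd c n (g j) x := by
  simp only [bernsteinComb, bernsteinOp, Finset.sum_mul, Finset.mul_sum]
  rw [Finset.sum_comm (s := s)]
  refine Finset.sum_congr rfl fun i _ => ?_
  rw [Finset.sum_comm]
  exact Finset.sum_congr rfl fun j _ => Finset.sum_congr rfl fun k _ => by ring

/-- The combinations reproduce polynomials of degree at most `m`. -/
theorem bernsteinComb_eval {m : ℕ} {nd : ℕ → ℕ → ℕ} {c : ℕ → ℕ → ℝ} (hc : IsCombination m nd c)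
    {n : ℕ} (hn : 1 ≤ n) (q : Polynomial ℝ) (hq : q.degree < (m + 1 : ℕ)) (x : ℝ) :
    bernsteinComb m nd c n (fun u => q.eval u) x = q.eval x := by
  have hq' : q.natDegree < m + 1 := by
    rcases eq_or_ne q 0 with h | h
    · simp [h]
    · exact (Polynomial.natDegree_lt_iff_degree_lt h).2 hq
  simp only [Polynomial.eval_eq_sum_range' hq']
  rw [bernsteinComb_sum]
  exact Finset.sum_congr rfl fun j hj => by
    rw [bernsteinComb_pow hc hn j (Nat.lt_succ_iff.1 (Finset.mem_range.1 hj))]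

/-! ### Taylor polynomials of bounded holomorphic functions. -/

/-- Taylor approximation on the real axis of a bounded holomorphic function. -/
theorem exists_polynomial_approx_of_norm_le (r : ℕ) {x s : ℝ} (hs : 0 < s) :
    ∀ (g : ℂ → ℂ) (S : ℝ), Differentiable ℂ g → (∀ z ∈ Metric.ball (x : ℂ) s, ‖g z‖ ≤ S) →
      ∃ T : Polynomial ℝ, T.degree < r ∧
        ∀ v : ℝ, |v - x| < s → |(g v).re - T.eval v| ≤ S * (2 * |v - x| / s) ^ r := by
  induction r with
  | zero =>
    intro g S _ hS
    refine ⟨0, by simp, fun v hv => ?_⟩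
    have := hS (v : ℂ) (by
      rw [Metric.mem_ball, dist_eq_norm, ← Complex.ofReal_sub, Complex.norm_real]; exact hv)
    simpa using (Complex.abs_re_le_norm _).trans this
  | succ r ih =>
    intro g S hg hS
    have hd : Differentiable ℂ (dslope g x) := by
      intro z
      rw [← differentiableWithinAt_univ]
      exact ((Complex.differentiableOn_dslope Filter.univ_mem).2
        (hg.differentiableOn)) z (mem_univ z)
    -- Schwarz lemma: g - g(x) is at most 2S on the disc, so its quotient by z - x is at most 2S/s.
    -- Each degree therefore contributes one factor 2|v-x|/s.
    have hS' : ∀ z ∈ Metric.ball (x : ℂ) s, ‖dslope g x z‖ ≤ 2 * S / s := fun z hz =>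
      Complex.norm_dslope_le_div_of_mapsTo_ball (R₂ := 2 * S) hg.differentiableOn (by
        intro w hw
        rw [Metric.mem_closedBall, dist_eq_norm]
        refine (norm_sub_le _ _).trans ?_
        linarith [hS w hw, hS x (Metric.mem_ball_self hs)]) hz
    obtain ⟨T, hT, hTv⟩ := ih _ _ hd hS'
    refine ⟨Polynomial.C (g x).re + (Polynomial.X - Polynomial.C x) * T, ?_, ?_⟩
    · refine (Polynomial.degree_add_le _ _).trans_lt (max_lt ?_ ?_)
      · refine Polynomial.degree_C_le.trans_lt ?_
        exact_mod_cast Nat.succ_pos r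
      · rw [Polynomial.degree_mul, Polynomial.degree_X_sub_C]
        rcases eq_or_ne T 0 with h | h
        · simp [h]
        · rw [Polynomial.degree_eq_natDegree h] at hT ⊢
          have : T.natDegree < r := by exact_mod_cast hT
          exact_mod_cast (by omega : 1 + T.natDegree < r + 1)
    · intro v hv
      have h1 : g v = g x + (v - x) * dslope g x v := by
        have := sub_smul_dslope g (x : ℂ) (v : ℂ)
        rw [smul_eq_mul] at this
        rw [this]; ring
      have h2 : (g v).re = (g x).re + (v - x) * (dslope g x v).re := by
        rw [h1, ← Complex.ofReal_sub, Complex.add_re, Complex.re_ofReal_mul]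
      have h3 := hTv v hv
      have e : (g v).re - (Polynomial.C (g x).re +
          (Polynomial.X - Polynomial.C x) * T).eval v =
          (v - x) * ((dslope g x v).re - T.eval v) := by
        rw [h2]; simp; ring
      rw [e, abs_mul, pow_succ]
      refine (mul_le_mul_of_nonneg_left h3 (abs_nonneg _)).trans (le_of_eq ?_)
      ring

/-! ### The Bernstein kernel on complex discs of radius the kernel spread. -/

/-- The spread `√(x(1-x)/n) + 1/n` of the Bernstein kernel of order `n` at `x`. -/
noncomputable def localScale (n : ℕ) (x : ℝ) : ℝ := √(x * (1 - x) / n) + 1 / n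

/-- The distance from `x` to `u` in units of the kernel spread, increased by one. -/
noncomputable def localGrowth (n : ℕ) (x u : ℝ) : ℝ := 1 + |u - x| / localScale n x

theorem one_div_le_localScale (n : ℕ) (x : ℝ) : 1 / (n : ℝ) ≤ localScale n x := by
  unfold localScale; linarith [Real.sqrt_nonneg (x * (1 - x) / n)]

theorem localScale_pos {n : ℕ} (hn : 1 ≤ n) (x : ℝ) : 0 < localScale n x :=
  lt_of_lt_of_le (by positivity) (one_div_le_localScale n x)

theorem one_le_localGrowth {n : ℕ} (hn : 1 ≤ n) (x u : ℝ) : 1 ≤ localGrowth n x u := by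
  have := localScale_pos hn x
  unfold localGrowth
  have : 0 ≤ |u - x| / localScale n x := by positivity
  linarith

theorem one_le_mul_localScale {n : ℕ} (hn : 1 ≤ n) (x : ℝ) : 1 ≤ n * localScale n x := by
  have h := one_div_le_localScale n x
  rwa [div_le_iff₀' (by positivity)] at h

theorem sq_localScale_sub {n : ℕ} {x : ℝ} (h0 : 0 ≤ x) (h1 : x ≤ 1) :
    (localScale n x - 1 / n) ^ 2 = x * (1 - x) / n := by
  have : 0 ≤ x * (1 - x) / n := by
    have : 0 ≤ 1 - x := by linarith
    positivity
  unfold localScale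
  rw [add_sub_cancel_right, Real.sq_sqrt this]

/-- With `mul_localScale_sq_le` and `one_div_le_localScale` this says that n s² is comparable to x +
1/n on the left half. -/
theorem le_two_mul_localScale_sq {n : ℕ} (hn : 1 ≤ n) {x : ℝ} (h0 : 0 ≤ x) (h1 : x ≤ 1 / 2) :
    x ≤ 2 * (n * localScale n x ^ 2) := by
  have h := sq_localScale_sub (n := n) h0 (by linarith : x ≤ 1)
  have h2 := one_div_le_localScale n x
  have hn' : (0 : ℝ) < n := by positivity
  have h3 : (localScale n x - 1 / n) ^ 2 ≤ localScale n x ^ 2 :=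
    pow_le_pow_left₀ (by linarith) (by linarith [one_div_pos.2 hn']) 2
  rw [h, div_le_iff₀' hn'] at h3
  nlinarith

theorem mul_localScale_sq_le {n : ℕ} (hn : 1 ≤ n) {x : ℝ} (h0 : 0 ≤ x) (h1 : x ≤ 1) :
    n * localScale n x ^ 2 ≤ 2 * x + 2 / n := by
  have h := sq_localScale_sub (n := n) h0 h1
  have hn' : (0 : ℝ) < n := by positivity
  set a := localScale n x - 1 / n with ha
  have e : localScale n x = a + 1 / n := by rw [ha]; ring
  have h3 : localScale n x ^ 2 ≤ 2 * (x * (1 - x) / n) + 2 * (1 / n) ^ 2 := by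
    rw [e, ← h]; nlinarith [sq_nonneg (a - 1 / n)]
  calc n * localScale n x ^ 2 ≤ n * (2 * (x * (1 - x) / n) + 2 * (1 / n) ^ 2) := by gcongr
    _ = 2 * (x * (1 - x)) + 2 / n := by field_simp
    _ ≤ _ := by nlinarith

theorem localScale_le_quarter {n : ℕ} (hn : 16 ≤ n) (x : ℝ) : localScale n x ≤ 1 / 4 := by
  have hn' : (16 : ℝ) ≤ n := by exact_mod_cast hn
  have h1 : 1 / (n : ℝ) ≤ 1 / 16 := one_div_le_one_div_of_le (by norm_num) hn'
  have h2 : x * (1 - x) / n ≤ (1 / 8) ^ 2 := by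
    rw [div_le_iff₀ (by positivity)]
    nlinarith [sq_nonneg (x - 1 / 2)]
  have h3 := Real.sqrt_le_sqrt h2
  rw [Real.sqrt_sq (by norm_num)] at h3
  unfold localScale; linarith

theorem norm_le_add_sq_div {z : ℂ} (h : 0 < z.re) : ‖z‖ ≤ z.re + z.im ^ 2 / (2 * z.re) := by
  refine abs_le_of_sq_le_sq' ?_ (by positivity) |>.2
  rw [Complex.sq_norm, Complex.normSq_apply]
  have e : (z.re + z.im ^ 2 / (2 * z.re)) ^ 2 =
      z.re * z.re + z.im * z.im + (z.im ^ 2 / (2 * z.re)) ^ 2 := by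
    field_simp; ring
  rw [e]
  nlinarith [sq_nonneg (z.im ^ 2 / (2 * z.re))]

/-- If x ≥ 2s, the real parts cancel and only (Im z)²/(2 Re z) + (Im z)²/(2 Re(1-z)) ≤ s²/x + 2s²
remains, which n s² ≤ 2x + 2/n controls. If x < 2s, the definition of s forces ns ≤ 4, and the
triangle inequality bounds the excess by 2s. -/
theorem mul_norm_excess_le {n : ℕ} (hn : 16 ≤ n) {x : ℝ} (h0 : 0 < x) (h1 : x ≤ 1 / 2) {z : ℂ}
    (hz : ‖z - x‖ ≤ localScale n x) : n * (‖z‖ + ‖1 - z‖ - 1) ≤ 8 := by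
  have hn1 : 1 ≤ n := by omega
  have hn' : (0 : ℝ) < n := by positivity
  set s := localScale n x with hs
  have hs4 : s ≤ 1 / 4 := localScale_le_quarter hn x
  have hspos : 0 < s := localScale_pos hn1 x
  have hns : 1 ≤ n * s := one_le_mul_localScale hn1 x
  rcases le_or_gt (2 * s) x with h | h
  · have hre : |z.re - x| ≤ s := by
      have := (Complex.abs_re_le_norm (z - x)).trans hz
      simpa using this
    have him : z.im ^ 2 ≤ s ^ 2 := by
      have := (Complex.abs_im_le_norm (z - x)).trans hz
      rw [← sq_abs]
      exact pow_le_pow_left₀ (abs_nonneg _) (by simpa using this) 2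
    rw [abs_le] at hre
    have hz1 := norm_le_add_sq_div (z := z) (by linarith)
    have hz2 := norm_le_add_sq_div (z := 1 - z) (by simp; linarith)
    simp only [Complex.sub_re, Complex.one_re, Complex.sub_im, Complex.one_im, zero_sub,
      neg_sq] at hz2
    have b1 : z.im ^ 2 / (2 * z.re) ≤ s ^ 2 / x := by
      apply div_le_div₀ (by positivity) him h0; linarith
    have b2 : z.im ^ 2 / (2 * (1 - z.re)) ≤ s ^ 2 / (1 / 2) := by
      apply div_le_div₀ (by positivity) him (by norm_num); linarith
    have h3 := mul_localScale_sq_le hn1 h0.le (by linarith : x ≤ 1)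
    rw [← hs] at h3
    have h4 : 2 / (n : ℝ) ≤ x := by
      rw [div_le_iff₀' hn']; nlinarith
    have h5 : n * (s ^ 2 / x) ≤ 3 := by
      rw [← mul_div_assoc, div_le_iff₀ h0]; linarith
    have h6 : n * (s ^ 2 / (1 / 2)) ≤ 3 := by
      have : n * (s ^ 2 / (1 / 2)) = 2 * (n * s ^ 2) := by ring
      rw [this]; linarith
    have : n * (‖z‖ + ‖1 - z‖ - 1) ≤ n * (s ^ 2 / x + s ^ 2 / (1 / 2)) := by
      apply mul_le_mul_of_nonneg_left _ hn'.le
      linarith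
    linarith
  · have hz1 : ‖z‖ ≤ x + s := by
      have := norm_add_le (z - x) (x : ℂ)
      rw [sub_add_cancel, Complex.norm_real, Real.norm_of_nonneg h0.le] at this
      linarith
    have hz2 : ‖1 - z‖ ≤ 1 - x + s := by
      have := norm_sub_le ((1 - x : ℝ) : ℂ) (z - x)
      rw [Complex.norm_real, Real.norm_of_nonneg (by linarith)] at this
      have e : ((1 - x : ℝ) : ℂ) - (z - x) = 1 - z := by push_cast; ring
      rw [e] at this
      linarith
    have h3 := sq_localScale_sub (n := n) h0.le (by linarith : x ≤ 1)
    rw [← hs] at h3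
    have h4 : (n * s - 1) ^ 2 ≤ 2 * (n * s) := by
      have e : (n * s - 1) ^ 2 = n ^ 2 * (s - 1 / n) ^ 2 := by field_simp
      rw [e, h3]
      have e2 : (n : ℝ) ^ 2 * (x * (1 - x) / n) = n * (x * (1 - x)) := by field_simp
      rw [e2]
      have : x * (1 - x) ≤ 2 * s := by nlinarith
      nlinarith
    have h5 : n * s ≤ 4 := by nlinarith
    nlinarith

/-- The sum equals (|z|e^θ + |1-z|)^{n'} e^{-θn'x}. After 1+v ≤ e^v and e^θ ≤ 1+θ+θ², the exponent
splits into n'(|z|+|1-z|-1) ≤ 8K, n'θ(|z|-x) ≤ 1 and n'|z|θ² ≤ 3. -/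
theorem sum_bernstein_exp_le {n n' : ℕ} {K : ℝ} (hn : 16 ≤ n) (hn' : n ≤ n') (hK : (n' : ℝ) ≤ K * n)
    {x : ℝ} (h0 : 0 < x) (h1 : x ≤ 1 / 2) {z : ℂ} (hz : ‖z - x‖ ≤ localScale n x) {θ : ℝ}
    (hθ : |θ| = 1 / (n' * localScale n x)) :
    ∑ k ∈ Finset.range (n' + 1), (n'.choose k : ℝ) * ‖z‖ ^ k * ‖1 - z‖ ^ (n' - k) *
      Real.exp (θ * (k - n' * x)) ≤ Real.exp (4 + 8 * K) := by
  have hn1 : 1 ≤ n := by omega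
  have hnR : (0 : ℝ) < n := by positivity
  have hn'R : (0 : ℝ) < n' := by exact_mod_cast (by omega : 0 < n')
  have hnn : (n : ℝ) ≤ n' := by exact_mod_cast hn'
  set s := localScale n x with hs
  have hspos : 0 < s := localScale_pos hn1 x
  have hns : 1 ≤ n * s := one_le_mul_localScale hn1 x
  have hn's : 1 ≤ n' * s := hns.trans (by gcongr)
  have hsum : ∑ k ∈ Finset.range (n' + 1), (n'.choose k : ℝ) * ‖z‖ ^ k * ‖1 - z‖ ^ (n' - k) *
      Real.exp (θ * (k - n' * x)) =
      (‖z‖ * Real.exp θ + ‖1 - z‖) ^ n' * Real.exp (-(θ * (n' * x))) := by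
    rw [add_pow, Finset.sum_mul]
    refine Finset.sum_congr rfl fun k _ => ?_
    rw [show θ * (k - n' * x) = k * θ + -(θ * (n' * x)) by ring, Real.exp_add, Real.exp_nat_mul,
      mul_pow]
    ring
  rw [hsum]
  have hbase : (‖z‖ * Real.exp θ + ‖1 - z‖) ^ n' ≤
      Real.exp (n' * (‖z‖ * Real.exp θ + ‖1 - z‖ - 1)) := by
    rw [Real.exp_nat_mul]
    refine pow_le_pow_left₀ (by positivity) ?_ _
    linarith [Real.add_one_le_exp (‖z‖ * Real.exp θ + ‖1 - z‖ - 1)]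
  refine (mul_le_mul_of_nonneg_right hbase (Real.exp_pos _).le).trans ?_
  rw [← Real.exp_add, Real.exp_le_exp]
  have hθ1 : |θ| ≤ 1 := by
    rw [hθ, div_le_iff₀ (by positivity)]; linarith
  have hexp : Real.exp θ ≤ 1 + θ + θ ^ 2 := by
    have := Real.abs_exp_sub_one_sub_id_le hθ1
    linarith [(abs_le.1 this).2]
  have hz1 : |‖z‖ - x| ≤ s := by
    have := abs_norm_sub_norm_le z (x : ℂ)
    rw [Complex.norm_real, Real.norm_of_nonneg h0.le] at this
    exact this.trans hz
  have hex := mul_norm_excess_le hn h0 h1 hz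
  have hex0 : 0 ≤ ‖z‖ + ‖1 - z‖ - 1 := by
    have := norm_add_le z (1 - z)
    rw [add_sub_cancel, norm_one] at this
    linarith
  have t3 : n' * (‖z‖ + ‖1 - z‖ - 1) ≤ 8 * K := by
    have hK0 : 0 ≤ K := by
      by_contra! h
      nlinarith
    calc n' * (‖z‖ + ‖1 - z‖ - 1) ≤ K * n * (‖z‖ + ‖1 - z‖ - 1) := by gcongr
      _ = K * (n * (‖z‖ + ‖1 - z‖ - 1)) := by ring
      _ ≤ K * 8 := by gcongr
      _ = 8 * K := by ring
  have t2 : n' * θ * (‖z‖ - x) ≤ 1 := by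
    refine (le_abs_self _).trans ?_
    rw [abs_mul, abs_mul, hθ, abs_of_pos hn'R]
    calc n' * (1 / (n' * s)) * |‖z‖ - x| ≤ n' * (1 / (n' * s)) * s := by gcongr
      _ = 1 := by field_simp
  have t1 : n' * ‖z‖ * θ ^ 2 ≤ 3 := by
    rw [← sq_abs, hθ]
    have e : n' * ‖z‖ * (1 / (n' * s)) ^ 2 = ‖z‖ / (n' * s ^ 2) := by field_simp
    rw [e, div_le_iff₀ (by positivity)]
    have h2 := le_two_mul_localScale_sq hn1 h0.le h1
    rw [← hs] at h2
    have h3 : n * s ^ 2 ≤ n' * s ^ 2 := by gcongr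
    have h4 : s ≤ n * s ^ 2 := by nlinarith
    linarith [(abs_le.1 hz1).2]
  have h5 : n' * (‖z‖ * Real.exp θ) ≤ n' * (‖z‖ * (1 + θ + θ ^ 2)) := by gcongr
  nlinarith

/-- Add the estimates for both signs of θ and use e^{|v|} ≤ e^v + e^{-v}; the size of θ makes
θ(k-n'x) the distance from k/n' to x in units of the spread. -/
theorem sum_bernstein_exp_abs_le {n n' : ℕ} {K : ℝ} (hn : 16 ≤ n) (hn' : n ≤ n')
    (hK : (n' : ℝ) ≤ K * n) {x : ℝ} (h0 : 0 < x) (h1 : x ≤ 1 / 2) {z : ℂ}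
    (hz : ‖z - x‖ ≤ localScale n x) :
    ∑ k ∈ Finset.range (n' + 1), (n'.choose k : ℝ) * ‖z‖ ^ k * ‖1 - z‖ ^ (n' - k) *
      Real.exp (|(k : ℝ) / n' - x| / localScale n x) ≤ 2 * Real.exp (4 + 8 * K) := by
  have hn'R : (0 : ℝ) < n' := by exact_mod_cast (by omega : 0 < n')
  have hspos : 0 < localScale n x := localScale_pos (by omega) x
  have hp : 0 < 1 / (n' * localScale n x) := by positivity
  have a := sum_bernstein_exp_le hn hn' hK h0 h1 hz (abs_of_pos hp)
  have b := sum_bernstein_exp_le hn hn' hK h0 h1 hz (θ := -(1 / (n' * localScale n x)))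
    (by rw [abs_neg, abs_of_pos hp])
  rw [two_mul]
  refine le_trans ?_ (add_le_add a b)
  rw [← Finset.sum_add_distrib]
  refine Finset.sum_le_sum fun k _ => ?_
  rw [← mul_add]
  refine mul_le_mul_of_nonneg_left ?_ (by positivity)
  have e : 1 / (n' * localScale n x) * (k - n' * x) = (k / n' - x) / localScale n x := by
    field_simp
  rw [neg_mul, e, ← abs_of_pos hspos, ← abs_div, abs_of_pos hspos]
  rcases abs_cases ((k / n' - x) / localScale n x) with h | h <;> rw [h.1]
  · linarith [Real.exp_pos (-((k / n' - x) / localScale n x))]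
  · linarith [Real.exp_pos ((k / n' - x) / localScale n x)]

theorem one_add_pow_le_exp (m : ℕ) {v : ℝ} (hv : 0 ≤ v) :
    (1 + v) ^ m ≤ m.factorial * Real.exp 1 * Real.exp v := by
  have := Real.pow_div_factorial_le_exp (1 + v) (by linarith) m
  rw [div_le_iff₀ (by positivity), Real.exp_add] at this
  linarith

/-- The combination of Bernstein operators, evaluated at complex points. -/
noncomputable def bernsteinCombComplex (m : ℕ) (nd : ℕ → ℕ → ℕ) (c : ℕ → ℕ → ℝ)
    (n : ℕ) (g : ℝ → ℝ) (z : ℂ) : ℂ :=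
  ∑ i ∈ Finset.range m, (c n i : ℂ) * ∑ k ∈ Finset.range (nd n i + 1),
    (g ((k : ℝ) / nd n i) : ℂ) * (((nd n i).choose k : ℂ) * z ^ k * (1 - z) ^ (nd n i - k))

theorem bernsteinCombComplex_ofReal (m : ℕ) (nd : ℕ → ℕ → ℕ) (c : ℕ → ℕ → ℝ)
    (n : ℕ) (g : ℝ → ℝ) (x : ℝ) :
    bernsteinCombComplex m nd c n g x = (bernsteinComb m nd c n g x : ℂ) := by
  simp only [bernsteinCombComplex, bernsteinComb, bernsteinOp]
  push_cast
  rfl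

theorem differentiable_bernsteinCombComplex (m : ℕ) (nd : ℕ → ℕ → ℕ) (c : ℕ → ℕ → ℝ)
    (n : ℕ) (g : ℝ → ℝ) : Differentiable ℂ (bernsteinCombComplex m nd c n g) := by
  unfold bernsteinCombComplex
  fun_prop

theorem IsCombination.le_node {m : ℕ} {nd : ℕ → ℕ → ℕ} {c : ℕ → ℕ → ℝ}
    (hc : IsCombination m nd c) {n : ℕ} (hn : 1 ≤ n) {i : ℕ} (hi : i < m) : n ≤ nd n i := by
  rcases Nat.eq_zero_or_pos i with h | h
  · rw [h, hc.node_zero n hn]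
  · exact (hc.node_zero n hn).symm.le.trans (hc.node_lt n hn 0 i h hi).le

/-- The exponential moment of the kernel absorbs growth of any fixed polynomial order d. The bounds
on the nodes and on the sum of |C_i(n)| make the constant independent of n. -/
theorem exists_norm_bernsteinCombComplex_le {m : ℕ} {nd : ℕ → ℕ → ℕ} {c : ℕ → ℕ → ℝ}
    (hc : IsCombination m nd c) (d : ℕ) :
    ∃ C : ℝ, 0 < C ∧ ∀ n : ℕ, 16 ≤ n → ∀ x : ℝ, 0 < x → x ≤ 1 / 2 → ∀ (g : ℝ → ℝ) (E : ℝ),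
      (∀ v ∈ Icc (0 : ℝ) 1, |g v| ≤ E * localGrowth n x v ^ d) →
      ∀ z : ℂ, ‖z - x‖ ≤ localScale n x → ‖bernsteinCombComplex m nd c n g z‖ ≤ C * E := by
  obtain ⟨K, hK⟩ := hc.node_le
  obtain ⟨K', hK'⟩ := hc.coeff_bound
  have hK'0 : 0 ≤ K' := (Finset.sum_nonneg fun _ _ => abs_nonneg _).trans (hK' 1 le_rfl)
  set A := (d.factorial : ℝ) * Real.exp 1 * (2 * Real.exp (4 + 8 * K)) with hA
  have hApos : 0 < A := by positivity
  refine ⟨(K' + 1) * A, by positivity, ?_⟩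
  intro n hn x h0 h1 g E hg z hz
  have hn1 : 1 ≤ n := by omega
  have hE : 0 ≤ E := by
    have := (abs_nonneg _).trans (hg 0 (by simp))
    have h2 : 0 < localGrowth n x 0 ^ d :=
      pow_pos (by linarith [one_le_localGrowth hn1 x 0]) d
    exact nonneg_of_mul_nonneg_left this h2
  have hin : ∀ i ∈ Finset.range m, ‖∑ k ∈ Finset.range (nd n i + 1),
      (g ((k : ℝ) / nd n i) : ℂ) * (((nd n i).choose k : ℂ) * z ^ k * (1 - z) ^ (nd n i - k))‖ ≤
      A * E := by
    intro i hi
    rw [Finset.mem_range] at hi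
    have hni := hc.le_node hn1 hi
    have hmain := sum_bernstein_exp_abs_le hn hni (hK n hn1 i hi) h0 h1 hz
    have : A * E = (d.factorial : ℝ) * Real.exp 1 * E * (2 * Real.exp (4 + 8 * K)) := by
      rw [hA]; ring
    rw [this]
    refine le_trans ?_ (mul_le_mul_of_nonneg_left hmain (by positivity))
    rw [Finset.mul_sum]
    refine (norm_sum_le _ _).trans (Finset.sum_le_sum fun k hk => ?_)
    have hkle : k ≤ nd n i := Nat.lt_succ_iff.1 (Finset.mem_range.1 hk)
    have hmem : (k : ℝ) / nd n i ∈ Icc (0 : ℝ) 1 :=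
      ⟨by positivity, div_le_one_of_le₀ (by exact_mod_cast hkle) (by positivity)⟩
    have h2 := hg _ hmem
    have h3 : localGrowth n x ((k : ℝ) / nd n i) ^ d ≤ _ :=
      one_add_pow_le_exp d (div_nonneg (abs_nonneg _) (localScale_pos hn1 x).le)
    rw [norm_mul, norm_mul, norm_mul, norm_pow, norm_pow, Complex.norm_real, Real.norm_eq_abs,
      Complex.norm_natCast]
    calc |g ((k : ℝ) / nd n i)| * (((nd n i).choose k : ℝ) * ‖z‖ ^ k * ‖1 - z‖ ^ (nd n i - k))
        ≤ (E * (d.factorial * Real.exp 1 *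
            Real.exp (|(k : ℝ) / nd n i - x| / localScale n x))) *
          (((nd n i).choose k : ℝ) * ‖z‖ ^ k * ‖1 - z‖ ^ (nd n i - k)) := by
          refine mul_le_mul_of_nonneg_right (h2.trans ?_) (by positivity)
          exact mul_le_mul_of_nonneg_left h3 hE
      _ = _ := by ring
  calc ‖bernsteinCombComplex m nd c n g z‖
      ≤ ∑ i ∈ Finset.range m, |c n i| * (A * E) := by
        refine (norm_sum_le _ _).trans (Finset.sum_le_sum fun i hi => ?_)
        rw [norm_mul, Complex.norm_real, Real.norm_eq_abs]
        exact mul_le_mul_of_nonneg_left (hin i hi) (abs_nonneg _)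
    _ = (∑ i ∈ Finset.range m, |c n i|) * (A * E) := by rw [Finset.sum_mul]
    _ ≤ (K' + 1) * (A * E) := by
        refine mul_le_mul_of_nonneg_right ?_ (by positivity)
        linarith [hK' n hn1]
    _ = _ := by ring

/-! ### The endpoint modification: linearity, polynomial exactness, growth and reflection. -/

theorem leftInterp_sub (r n : ℕ) (f g : ℝ → ℝ) (x : ℝ) :
    leftInterp r n (fun u => f u - g u) x = leftInterp r n f x - leftInterp r n g x := by
  simp only [leftInterp]
  rw [← Polynomial.eval_sub, ← map_sub]
  rfl

theorem rightInterp_sub (r n : ℕ) (f g : ℝ → ℝ) (x : ℝ) :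
    rightInterp r n (fun u => f u - g u) x = rightInterp r n f x - rightInterp r n g x := by
  simp only [rightInterp]
  rw [← Polynomial.eval_sub, ← map_sub]
  rfl

theorem modFun_sub (ψ : ℝ → ℝ) (r n : ℕ) (f g : ℝ → ℝ) (x : ℝ) :
    modFun ψ r n (fun u => f u - g u) x = modFun ψ r n f x - modFun ψ r n g x := by
  simp only [modFun, leftInterp_sub, rightInterp_sub]
  split_ifs <;> ring

theorem left_nodes_sep {n : ℕ} (hn : 1 ≤ n) (i j : ℕ) (hij : i ≠ j) :
    1 / (n : ℝ) ≤ |(i : ℝ) / n - j / n| := by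
  have hn' : (0 : ℝ) < n := by positivity
  have h2 : (1 : ℝ) ≤ |(i : ℝ) - j| := by
    have : (1 : ℤ) ≤ |(i : ℤ) - j| := Int.one_le_abs (sub_ne_zero.2 (by exact_mod_cast hij))
    exact_mod_cast this
  rw [← sub_div, abs_div, abs_of_pos hn']
  gcongr

theorem leftInterp_eval {r n : ℕ} (hn : 1 ≤ n) (q : Polynomial ℝ) (hq : q.degree < r) (x : ℝ) :
    leftInterp r n (fun u => q.eval u) x = q.eval x := by
  unfold leftInterp
  rw [← Lagrange.eq_interpolate (f := q) ?_ (by simpa using hq)]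
  intro i _ j _ hij
  by_contra h
  have := left_nodes_sep hn i j h
  simp only at hij
  rw [hij, sub_self, abs_zero] at this
  exact absurd this (not_le.2 (by positivity))

theorem rightInterp_eval {r n : ℕ} (hn : 1 ≤ n) (q : Polynomial ℝ) (hq : q.degree < r) (x : ℝ) :
    rightInterp r n (fun u => q.eval u) x = q.eval x := by
  unfold rightInterp
  rw [← Lagrange.eq_interpolate (f := q) ?_ (by simpa using hq)]
  intro i _ j _ hij
  by_contra h
  have := left_nodes_sep hn i j h
  simp only [sub_right_inj] at hij
  rw [hij, sub_self, abs_zero] at this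
  exact absurd this (not_le.2 (by positivity))

theorem modFun_eval (ψ : ℝ → ℝ) {r n : ℕ} (hn : 1 ≤ n) (q : Polynomial ℝ) (hq : q.degree < r)
    (x : ℝ) : modFun ψ r n (fun u => q.eval u) x = q.eval x := by
  simp only [modFun, leftInterp_eval hn q hq, rightInterp_eval hn q hq]
  split_ifs <;> ring

theorem IsCutoff.mem_Icc {ψ : ℝ → ℝ} (hψ : IsCutoff ψ) (x : ℝ) : ψ x ∈ Icc (0 : ℝ) 1 := by
  constructor
  · rcases le_total x 0 with h | h
    · rw [hψ.eq_zero x h]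
    · exact (hψ.eq_zero 0 le_rfl).symm.le.trans (hψ.monotone h)
  · rcases le_total x 1 with h | h
    · exact (hψ.monotone h).trans (hψ.eq_one 1 le_rfl).le
    · rw [hψ.eq_one x h]

theorem abs_blend_le {a b c S : ℝ} (ha : a ∈ Icc (0 : ℝ) 1) (hb : |b| ≤ S) (hc : |c| ≤ S) :
    |(1 - a) * b + a * c| ≤ S := by
  obtain ⟨h0, h1⟩ := ha
  rw [abs_le] at *
  constructor <;> nlinarith

/-- The spread is at least 1/n, so a shift by (r+2)/n is at most r+2 units. -/
theorem localGrowth_le {n r : ℕ} (hn : 1 ≤ n) {x u v : ℝ} (h : |u - v| ≤ (r + 2) / n) :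
    localGrowth n x u ≤ (r + 3) * localGrowth n x v := by
  have hs := localScale_pos hn x
  have h1 : |u - x| ≤ |v - x| + (r + 2) * localScale n x := by
    have e : u - x = (u - v) + (v - x) := by ring
    have := one_div_le_localScale n x
    have h2 : ((r : ℝ) + 2) / n ≤ (r + 2) * localScale n x := by
      rw [div_eq_mul_one_div]; gcongr
    rw [e]
    linarith [abs_add_le (u - v) (v - x)]
  have h3 : |u - x| / localScale n x ≤ |v - x| / localScale n x + (r + 2) := by
    rw [div_le_iff₀ hs, add_mul, div_mul_cancel₀ _ hs.ne']; exact h1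
  have h4 : 0 ≤ |v - x| / localScale n x := by positivity
  unfold localGrowth
  nlinarith [(Nat.cast_nonneg r : (0 : ℝ) ≤ r)]

/-- The modification near the endpoints preserves bounds of polynomial growth. -/
theorem exists_abs_modFun_le {ψ : ℝ → ℝ} (hψ : IsCutoff ψ) (r d : ℕ) (hr : 1 ≤ r) :
    ∃ C : ℝ, 0 < C ∧ ∀ n : ℕ, 5 ≤ n → r + 1 ≤ n → ∀ (x : ℝ) (D : ℝ → ℝ) (E : ℝ), 0 ≤ E →
      (∀ u ∈ Icc (1 / (n : ℝ)) (1 - 1 / n), |D u| ≤ E * localGrowth n x u ^ d) →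
      ∀ v ∈ Icc (0 : ℝ) 1, |modFun ψ r n D v| ≤ C * E * localGrowth n x v ^ d := by
  -- The factor r(r+2)^r is the interpolation bound for r nodes with gap 1/n, all within (r+2)/n of
  -- the evaluation point. The factor (r+3)^d moves the growth bound from a node to that point by
  -- `localGrowth_le`.
  set C : ℝ := r * (r + 2) ^ r * (r + 3) ^ d with hC
  have hr' : (1 : ℝ) ≤ r := by exact_mod_cast hr
  have hC1 : 1 ≤ C := by
    have h1 : (1 : ℝ) ≤ (r + 2) ^ r := one_le_pow₀ (by linarith)
    have h2 : (1 : ℝ) ≤ (r + 3) ^ d := one_le_pow₀ (by linarith)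
    exact one_le_mul_of_one_le_of_one_le (one_le_mul_of_one_le_of_one_le hr' h1) h2
  refine ⟨C, by linarith, ?_⟩
  intro n hn hrn x D E hE hD v hv
  have hn1 : 1 ≤ n := by omega
  have hnR : (0 : ℝ) < n := by positivity
  have hn5 : (5 : ℝ) ≤ n := by exact_mod_cast hn
  have hrnR : (r : ℝ) + 1 ≤ n := by exact_mod_cast hrn
  have hd1 : 1 / (n : ℝ) ≤ 1 / 5 := one_div_le_one_div_of_le (by norm_num) hn5
  have hd0 : 0 < 1 / (n : ℝ) := by positivity
  have h2n : 2 / (n : ℝ) = 2 * (1 / n) := by ring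
  have hG : 0 ≤ localGrowth n x v := by linarith [one_le_localGrowth hn1 x v]
  have hnode : ∀ i ∈ Finset.Icc 1 r, 1 / (n : ℝ) ≤ (i : ℝ) / n ∧ (i : ℝ) / n ≤ 1 - 1 / n ∧
      (i : ℝ) / n ≤ r / n := by
    intro i hi
    rw [Finset.mem_Icc] at hi
    have hi1 : (1 : ℝ) ≤ i := by exact_mod_cast hi.1
    have hi2 : (i : ℝ) ≤ r := by exact_mod_cast hi.2
    refine ⟨by gcongr, ?_, by gcongr⟩
    rw [le_sub_iff_add_le, ← add_div, div_le_one hnR]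
    linarith
  have hr2 : ((r : ℝ) + 2) / n = r / n + 2 * (1 / n) := by ring
  have key : ∀ nd : ℕ → ℝ, (∀ i ∈ Finset.Icc 1 r, nd i ∈ Icc (1 / (n : ℝ)) (1 - 1 / n)) →
      (∀ i ∈ Finset.Icc 1 r, |nd i - v| ≤ (r + 2) / n) →
      (∀ i ∈ Finset.Icc 1 r, ∀ j ∈ Finset.Icc 1 r, i ≠ j → 1 / (n : ℝ) ≤ |nd i - nd j|) →
      |(Lagrange.interpolate (Finset.Icc 1 r) nd fun i => D (nd i)).eval v| ≤
        C * E * localGrowth n x v ^ d := by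
    intro nd hm hdist hsep
    have := abs_interpolate_le (s := Finset.Icc 1 r) (v := nd) (y := fun i => D (nd i))
      (x := v) (δ := 1 / n) (R := (r + 2) / n) (K := E * ((r + 3) * localGrowth n x v) ^ d) hd0
      (by gcongr; linarith) hsep (fun j hj => by rw [abs_sub_comm]; exact hdist j hj) ?_
    · refine this.trans (le_of_eq ?_)
      simp only [Nat.card_Icc, Nat.add_sub_cancel]
      have e : ((r : ℝ) + 2) / n / (1 / n) = r + 2 := by field_simp
      rw [e, mul_pow, hC]; ring
    · intro i hi
      refine (hD _ (hm i hi)).trans ?_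
      refine mul_le_mul_of_nonneg_left ?_ hE
      exact pow_le_pow_left₀ (by linarith [one_le_localGrowth hn1 x (nd i)])
        (localGrowth_le hn1 (hdist i hi)) d
  have hleft : v ≤ 2 / n → |leftInterp r n D v| ≤ C * E * localGrowth n x v ^ d := by
    intro hv2
    refine key (fun i => (i : ℝ) / n) (fun i hi => ⟨(hnode i hi).1, (hnode i hi).2.1⟩) ?_
      fun i _ j _ hij => left_nodes_sep hn1 i j hij
    intro i hi
    obtain ⟨a, b, c⟩ := hnode i hi
    rw [hr2, abs_le]; constructor <;> linarith [hv.1, (by positivity : 0 ≤ (r : ℝ) / n)]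
  have hright : 1 - 2 / n ≤ v → |rightInterp r n D v| ≤ C * E * localGrowth n x v ^ d := by
    intro hv2
    refine key (fun i => 1 - (i : ℝ) / n)
      (fun i hi => ⟨by linarith [(hnode i hi).2.1], by linarith [(hnode i hi).1]⟩) ?_ ?_
    · intro i hi
      obtain ⟨a, b, c⟩ := hnode i hi
      rw [hr2, abs_le]; constructor <;> linarith [hv.2, (by positivity : 0 ≤ (r : ℝ) / n)]
    · intro i _ j _ hij
      have := left_nodes_sep hn1 i j hij
      rwa [sub_sub_sub_cancel_left, abs_sub_comm]
  have hmid : v ∈ Icc (1 / (n : ℝ)) (1 - 1 / n) → |D v| ≤ C * E * localGrowth n x v ^ d := by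
    intro h
    refine (hD v h).trans ?_
    have : 0 ≤ E * localGrowth n x v ^ d := by positivity
    nlinarith
  unfold modFun
  split_ifs with c1 c2 c3 c4
  · exact hleft (by linarith)
  · exact abs_blend_le (hψ.mem_Icc _) (hleft c2) (hmid ⟨by linarith, by linarith⟩)
  · exact hmid ⟨by linarith, by linarith⟩
  · exact abs_blend_le (hψ.mem_Icc _) (hright (by linarith)) (hmid ⟨by linarith, by linarith⟩)
  · exact hright (by linarith)

/-- Composition with 1 - X does not raise the degree and carries the nodes i/n to 1 - i/n, so
uniqueness of interpolation exchanges the two endpoint polynomials; the conventions at the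
breakpoints are mirror images. This reduces the right half of the interval to the left half. -/
theorem modFun_reflect {ψ : ℝ → ℝ} (hψ : IsCutoff ψ) {r n : ℕ} (hn : 5 ≤ n) (f : ℝ → ℝ) (x : ℝ) :
    modFun ψ r n (fun u => f (1 - u)) x = modFun ψ r n f (1 - x) := by
  have hn1 : 1 ≤ n := by omega
  have hnR : (0 : ℝ) < n := by positivity
  have hn5 : (5 : ℝ) ≤ n := by exact_mod_cast hn
  have hd1 : 1 / (n : ℝ) ≤ 1 / 5 := one_div_le_one_div_of_le (by norm_num) hn5
  have hd0 : 0 < 1 / (n : ℝ) := by positivity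
  have h2n : 2 / (n : ℝ) = 2 * (1 / n) := by ring
  have hinj : Set.InjOn (fun i : ℕ => (i : ℝ) / n) (Finset.Icc 1 r : Finset ℕ) := by
    intro i _ j _ hij
    simp only at hij
    field_simp at hij
    exact_mod_cast hij
  have hinj' : Set.InjOn (fun i : ℕ => 1 - (i : ℝ) / n) (Finset.Icc 1 r : Finset ℕ) := by
    intro i hi j hj hij
    exact hinj hi hj (by simpa using hij)
  have aux : ∀ (v w : ℕ → ℝ) (y : ℕ → ℝ), Set.InjOn v (Finset.Icc 1 r : Finset ℕ) →
      Set.InjOn w (Finset.Icc 1 r : Finset ℕ) → (∀ i, w i = 1 - v i) → ∀ z : ℝ,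
      (Lagrange.interpolate (Finset.Icc 1 r) v y).eval z =
        (Lagrange.interpolate (Finset.Icc 1 r) w y).eval (1 - z) := by
    intro v w y hv hw hvw z
    rcases Nat.eq_zero_or_pos r with h0 | h0
    · subst h0; simp
    have e : (Lagrange.interpolate (Finset.Icc 1 r) w y).comp (1 - Polynomial.X) =
        Lagrange.interpolate (Finset.Icc 1 r) v y := by
      refine Lagrange.eq_interpolate_of_eval_eq _ hv ?_ ?_
      · have hdeg := Lagrange.degree_interpolate_lt (s := Finset.Icc 1 r) (r := y) hw
        rcases eq_or_ne (Lagrange.interpolate (Finset.Icc 1 r) w y) 0 with h | h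
        · rw [h]; simp
        · have h1 := (Polynomial.natDegree_lt_iff_degree_lt h).2 hdeg
          refine Polynomial.degree_le_natDegree.trans_lt ?_
          rw [Polynomial.natDegree_comp]
          have : (1 - Polynomial.X : Polynomial ℝ).natDegree = 1 := by
            rw [← Polynomial.C_1, ← neg_sub, Polynomial.natDegree_neg,
              Polynomial.natDegree_X_sub_C]
          rw [this, mul_one]
          exact_mod_cast h1
      · intro i hi
        rw [Polynomial.eval_comp]
        simp only [Polynomial.eval_sub, Polynomial.eval_one, Polynomial.eval_X, ← hvw]
        exact Lagrange.eval_interpolate_at_node y hw hi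
    rw [← e, Polynomial.eval_comp]; simp
  have hL : ∀ z, leftInterp r n (fun u => f (1 - u)) z = rightInterp r n f (1 - z) := fun z =>
    aux _ _ _ hinj hinj' (fun _ => rfl) z
  have hR : ∀ z, rightInterp r n (fun u => f (1 - u)) z = leftInterp r n f (1 - z) := by
    intro z
    have := aux _ _ (fun i : ℕ => f ((i : ℝ) / n)) hinj' hinj (fun _ => by ring) z
    rw [leftInterp, ← this, rightInterp]
    simp
  have hR' : ∀ z, 1 - (1 - z) = (z : ℝ) := fun z => by ring
  unfold modFun
  simp only [hL, hR, hR']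
  rcases lt_trichotomy x (1 / n) with h | h | h
  · rw [if_pos h.le, if_neg (by linarith), if_neg (by linarith), if_neg (by linarith),
      if_neg (by linarith)]
  · rw [if_pos h.le, if_neg (by linarith), if_neg (by linarith), if_neg (by linarith),
      if_neg (by linarith)]
  rw [if_neg (not_le.2 h)]
  rcases lt_trichotomy x (2 / n) with h' | h' | h'
  · rw [if_pos h'.le, if_neg (by linarith), if_neg (by linarith), if_neg (by linarith),
      if_pos (by linarith)]
  · rw [if_pos h'.le, if_neg (by linarith), if_neg (by linarith), if_neg (by linarith),
      if_pos (by linarith)]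
  rw [if_neg (not_le.2 h')]
  have hone : ψ (n * (2 / n) - 1) = 1 := hψ.eq_one _ (by field_simp; norm_num)
  have hzero : ψ (n * (1 / n) - 1) = 0 := hψ.eq_zero _ (by field_simp; norm_num)
  rcases lt_trichotomy x (1 - 2 / n) with h1 | h1 | h1
  · rw [if_pos h1, if_neg (by linarith), if_neg (by linarith), if_pos (by linarith)]
  · rw [if_neg (by linarith), if_pos (by linarith), if_neg (by linarith), if_pos (by linarith)]
  rw [if_neg (by linarith)]
  rcases lt_trichotomy x (1 - 1 / n) with h2 | h2 | h2
  · rw [if_pos h2, if_neg (by linarith), if_pos (by linarith)]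
  · rw [if_neg (by linarith), if_pos (by linarith)]
  · rw [if_neg (by linarith), if_pos (by linarith)]

theorem bernsteinOp_reflect (n : ℕ) (hn : 1 ≤ n) (g : ℝ → ℝ) (x : ℝ) :
    bernsteinOp n (fun u => g (1 - u)) x = bernsteinOp n g (1 - x) := by
  have hnR : (n : ℝ) ≠ 0 := by positivity
  simp only [bernsteinOp]
  rw [← Finset.sum_range_reflect]
  refine Finset.sum_congr rfl fun k hk => ?_
  have hk : k ≤ n := Nat.lt_succ_iff.1 (Finset.mem_range.1 hk)
  rw [show n + 1 - 1 - k = n - k by omega, Nat.choose_symm hk, Nat.sub_sub_self hk]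
  have : (1 : ℝ) - ((n - k : ℕ) : ℝ) / n = k / n := by
    push_cast [hk]; field_simp; ring
  rw [this, sub_sub_cancel]
  ring

theorem bernsteinStar_reflect {ψ : ℝ → ℝ} (hψ : IsCutoff ψ) {r : ℕ} {nd : ℕ → ℕ → ℕ}
    {c : ℕ → ℕ → ℝ} (hc : IsCombination (r - 1) nd c) {n : ℕ} (hn : 5 ≤ n) (f : ℝ → ℝ) (x : ℝ) :
    bernsteinStar ψ r nd c n (fun u => f (1 - u)) x = bernsteinStar ψ r nd c n f (1 - x) := by
  unfold bernsteinStar bernsteinComb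
  refine Finset.sum_congr rfl fun i hi => ?_
  have h1 := hc.le_node (by omega : 1 ≤ n) (Finset.mem_range.1 hi)
  rw [← bernsteinOp_reflect _ (by omega)]
  have : modFun ψ r n (fun u => f (1 - u)) = fun u => modFun ψ r n f (1 - u) :=
    funext (modFun_reflect hψ hn f)
  rw [this]

/-- Splitting the error of `B*` with respect to a polynomial, together with a bound for the
remaining part on a complex disc. -/
theorem exists_norm_bernsteinComb_modFun_le {ψ : ℝ → ℝ} (hψ : IsCutoff ψ) {r : ℕ} (hr : 2 ≤ r)
    {nd : ℕ → ℕ → ℕ} {c : ℕ → ℕ → ℝ} (hc : IsCombination (r - 1) nd c) (d : ℕ) :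
    ∃ C : ℝ, 0 < C ∧ ∀ n : ℕ, 16 ≤ n → r + 1 ≤ n → ∀ x : ℝ, 0 < x → x ≤ 1 / 2 →
      ∀ (f : ℝ → ℝ) (Q : Polynomial ℝ) (E : ℝ), Q.degree < r → 0 ≤ E →
      (∀ u ∈ Icc (1 / (n : ℝ)) (1 - 1 / n), |f u - Q.eval u| ≤ E * localGrowth n x u ^ d) →
      ∃ g : ℂ → ℂ, Differentiable ℂ g ∧ (∀ z : ℂ, ‖z - x‖ ≤ localScale n x → ‖g z‖ ≤ C * E) ∧
        ∀ v : ℝ, bernsteinStar ψ r nd c n f v = (g v).re + Q.eval v := by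
  obtain ⟨C₁, hC₁, h₁⟩ := exists_abs_modFun_le hψ r d (by omega)
  obtain ⟨C₂, hC₂, h₂⟩ := exists_norm_bernsteinCombComplex_le hc d
  refine ⟨C₂ * C₁, by positivity, ?_⟩
  intro n hn hrn x h0 hx f Q E hQ hE hfQ
  -- Modification and combination both fix Q, so only f - Q has to be continued to complex points.
  refine ⟨bernsteinCombComplex (r - 1) nd c n (modFun ψ r n fun u => f u - Q.eval u),
    differentiable_bernsteinCombComplex _ _ _ _ _, ?_, ?_⟩
  · intro z hz
    rw [mul_assoc]
    exact h₂ n hn x h0 hx _ _ (h₁ n (by omega) hrn x _ E hE hfQ) z hz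
  · intro v
    rw [bernsteinCombComplex_ofReal, Complex.ofReal_re]
    have e1 : modFun ψ r n (fun u => f u - Q.eval u) =
        fun u => modFun ψ r n f u - Q.eval u := by
      funext u
      rw [modFun_sub, modFun_eval ψ (by omega) Q hQ]
    rw [e1, bernsteinComb_sub, bernsteinComb_eval hc (by omega) Q
      (by rwa [Nat.sub_add_cancel (by omega)]), bernsteinStar]
    ring

/-! ### Comparing approximating polynomials across scales. -/

theorem div_two_rpow_neg {y : ℝ} (hy : 0 < y) (α : ℝ) : (y / 2) ^ (-α) = 2 ^ α * y ^ (-α) := by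
  rw [Real.div_rpow hy.le (by norm_num), Real.rpow_neg (by norm_num : (0 : ℝ) ≤ 2), div_inv_eq_mul,
    mul_comm]

/-- Polynomials approximating `f` on all dyadic scales above `η` control `f` from one scale down
to `η`. -/
theorem exists_abs_sub_le_of_scales (r : ℕ) (hr : 1 ≤ r) {α γ : ℝ} (hα : 0 < α) (hγ : 0 ≤ γ) :
    ∃ C : ℝ, 1 ≤ C ∧ ∀ (f : ℝ → ℝ) (η K : ℝ), 0 < η → 0 ≤ K →
      (∀ y ∈ Icc η (1 / 2), ∃ P : Polynomial ℝ, P.degree < r ∧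
        ∀ u ∈ Icc (y / 2) (3 * y / 2), |f u - P.eval u| ≤ K * y ^ γ * y ^ (-α)) →
      ∀ y ∈ Icc η (1 / 2), ∀ P : Polynomial ℝ, P.degree < r →
        (∀ u ∈ Icc (y / 2) (3 * y / 2), |f u - P.eval u| ≤ K * y ^ γ * y ^ (-α)) →
        ∀ u ∈ Icc η (3 * y / 2), |f u - P.eval u| ≤ C * K * y ^ γ * u ^ (-α) := by
  obtain ⟨C₀, hC₀, hext⟩ := exists_extrapolation_bound r hr
  -- The cost of passing from the polynomial at scale y to the one at y/2: they are compared on the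
  -- common interval [y/2, 3y/4] and the difference is extrapolated down to u, with factor at most
  -- 3^r.
  set D : ℝ := 2 * 2 ^ α * C₀ * 3 ^ r with hD
  have h2α : 1 < (2 : ℝ) ^ α := Real.one_lt_rpow (by norm_num) hα
  have hDpos : 0 < D := by positivity
  -- The summand 2 handles u in [y/2, y]. The other summand gives D ≤ C₃(2^α-1)/2, which absorbs the
  -- cost of a scale change; α > 0 makes the denominator positive.
  set C₃ : ℝ := 2 + 2 * D / (2 ^ α - 1) with hC₃
  have hC₃2 : 2 ≤ C₃ := by
    have : 0 ≤ 2 * D / (2 ^ α - 1) := div_nonneg (by positivity) (by linarith)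
    linarith
  have hC₃D : D ≤ C₃ * (2 ^ α - 1) / 2 := by
    have h : 2 * D / (2 ^ α - 1) * (2 ^ α - 1) = 2 * D := div_mul_cancel₀ _ (by linarith)
    rw [hC₃, add_mul, h]; linarith
  refine ⟨C₃ + 2 ^ α, by linarith, ?_⟩
  intro f η K hη hK H
  -- Subtracting y^{-α}/2 makes the induction close: halving y increases the subtracted term by
  -- (2^α-1) y^{-α}/2, which pays for one change of polynomial without enlarging C₃.
  have claim : ∀ k : ℕ, ∀ y ∈ Icc η (1 / 2), ∀ P : Polynomial ℝ, P.degree < r →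
      (∀ u ∈ Icc (y / 2) (3 * y / 2), |f u - P.eval u| ≤ K * y ^ γ * y ^ (-α)) →
      ∀ u ∈ Icc η y, y ≤ 2 ^ k * u →
        |f u - P.eval u| ≤ K * y ^ γ * (C₃ * (u ^ (-α) - y ^ (-α) / 2)) := by
    intro k
    induction k with
    | zero =>
      intro y hy P _ hP u hu hyu
      have hy0 : 0 < y := hη.trans_le hy.1
      have huy : u = y := le_antisymm hu.2 (by simpa using hyu)
      subst huy
      refine (hP u ⟨by linarith, by linarith⟩).trans ?_
      have := Real.rpow_pos_of_pos hy0 (-α)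
      refine mul_le_mul_of_nonneg_left ?_ (by positivity)
      nlinarith
    | succ k ih =>
      intro y hy P hPd hP u hu hyu
      have hy0 : 0 < y := hη.trans_le hy.1
      have hu0 : 0 < u := hη.trans_le hu.1
      have hypos := Real.rpow_pos_of_pos hy0 (-α)
      rcases le_or_gt (y / 2) u with h | h
      · have hmono : y ^ (-α) ≤ u ^ (-α) :=
          Real.rpow_le_rpow_of_nonpos hu0 hu.2 (by linarith)
        refine (hP u ⟨h, by linarith [hu.2]⟩).trans ?_
        refine mul_le_mul_of_nonneg_left ?_ (by positivity)
        nlinarith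
      · have hy2 : y / 2 ∈ Icc η (1 / 2) := ⟨hu.1.trans h.le, by linarith [hy.2]⟩
        obtain ⟨P', hP'd, hP'⟩ := H _ hy2
        have h1 := ih (y / 2) hy2 P' hP'd hP' u ⟨hu.1, h.le⟩ (by rw [pow_succ] at hyu; linarith)
        rw [div_two_rpow_neg hy0] at h1
        have hle : (y / 2) ^ γ ≤ y ^ γ := Real.rpow_le_rpow (by linarith) (by linarith) hγ
        have hd : ∀ v ∈ Icc (y / 2) (y / 2 + y / 4),
            |(P' - P).eval v| ≤ 2 * (K * y ^ γ * (2 ^ α * y ^ (-α))) := by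
          intro v hv
          have a := hP v ⟨hv.1, by linarith [hv.2]⟩
          have b := hP' v ⟨by linarith [hv.1], by linarith [hv.2]⟩
          rw [div_two_rpow_neg hy0] at b
          have b' : K * (y / 2) ^ γ * (2 ^ α * y ^ (-α)) ≤ K * y ^ γ * (2 ^ α * y ^ (-α)) := by
            gcongr
          have a' : K * y ^ γ * y ^ (-α) ≤ K * y ^ γ * (2 ^ α * y ^ (-α)) := by
            gcongr
            nlinarith
          rw [Polynomial.eval_sub, show P'.eval v - P.eval v =
            (f v - P.eval v) - (f v - P'.eval v) by ring]
          refine (abs_sub _ _).trans ?_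
          linarith
        have h2 := hext (P' - P) (y / 2) (y / 4) _
          ((Polynomial.degree_sub_le _ _).trans_lt (max_lt hP'd hPd)) (by linarith) hd u
        have h3 : 1 + |u - y / 2| / (y / 4) ≤ 3 := by
          have : |u - y / 2| / (y / 4) ≤ 2 := by
            rw [div_le_iff₀ (by linarith), abs_le]; constructor <;> linarith
          linarith
        have h4 : |(P' - P).eval u| ≤ K * y ^ γ * (D * y ^ (-α)) := by
          refine h2.trans ?_
          have : (1 + |u - y / 2| / (y / 4)) ^ r ≤ 3 ^ r := pow_le_pow_left₀ (by positivity) h3 r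
          calc _ ≤ C₀ * (2 * (K * y ^ γ * (2 ^ α * y ^ (-α)))) * 3 ^ r := by gcongr
            _ = _ := by rw [hD]; ring
        have hmono : 2 ^ α * y ^ (-α) ≤ u ^ (-α) := by
          rw [← div_two_rpow_neg hy0]
          exact Real.rpow_le_rpow_of_nonpos hu0 h.le (by linarith)
        have h5 : |f u - P'.eval u| ≤
            K * y ^ γ * (C₃ * (u ^ (-α) - 2 ^ α * y ^ (-α) / 2)) := by
          refine h1.trans ?_
          have : 0 ≤ C₃ * (u ^ (-α) - 2 ^ α * y ^ (-α) / 2) := by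
            apply mul_nonneg (by linarith)
            have : 0 < 2 ^ α * y ^ (-α) := by positivity
            linarith
          gcongr
        rw [show f u - P.eval u = (f u - P'.eval u) + (P' - P).eval u by
          rw [Polynomial.eval_sub]; ring]
        refine (abs_add_le _ _).trans ((add_le_add h5 h4).trans ?_)
        rw [← mul_add]
        refine mul_le_mul_of_nonneg_left ?_ (by positivity)
        nlinarith [mul_le_mul_of_nonneg_right hC₃D hypos.le]
  intro y hy P hPd hP u hu
  have hy0 : 0 < y := hη.trans_le hy.1
  have hu0 : 0 < u := hη.trans_le hu.1
  have hypos := Real.rpow_pos_of_pos hy0 (-α)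
  have hupos := Real.rpow_pos_of_pos hu0 (-α)
  rcases le_or_gt u y with h | h
  · obtain ⟨k, hk⟩ := pow_unbounded_of_one_lt (y / u) (by norm_num : (1 : ℝ) < 2)
    have h1 := claim k y hy P hPd hP u ⟨hu.1, h⟩ ((div_lt_iff₀ hu0).1 hk).le
    refine h1.trans ?_
    rw [show (C₃ + 2 ^ α) * K * y ^ γ * u ^ (-α) = K * y ^ γ * ((C₃ + 2 ^ α) * u ^ (-α)) by ring]
    refine mul_le_mul_of_nonneg_left ?_ (by positivity)
    nlinarith
  · refine (hP u ⟨by linarith, hu.2⟩).trans ?_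
    have h1 : y ^ (-α) ≤ 2 ^ α * u ^ (-α) := by
      rw [← div_two_rpow_neg hu0]
      exact Real.rpow_le_rpow_of_nonpos (by linarith) (by linarith [hu.2]) (by linarith)
    rw [show (C₃ + 2 ^ α) * K * y ^ γ * u ^ (-α) = K * y ^ γ * ((C₃ + 2 ^ α) * u ^ (-α)) by ring]
    refine mul_le_mul_of_nonneg_left ?_ (by positivity)
    nlinarith

theorem rpow_le_pow_of_le {L a : ℝ} {d : ℕ} (hL : 1 ≤ L) (h : a ≤ d) : L ^ a ≤ L ^ d := by
  rw [← Real.rpow_natCast]; exact Real.rpow_le_rpow_of_exponent_le hL h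

set_option maxHeartbeats 1000000 in
/-- Growth on `[η,1)` of the error of an approximating polynomial at the scale `x`. -/
theorem exists_abs_sub_le_growth (r : ℕ) (hr : 1 ≤ r) {α β γ : ℝ} (hα : 0 < α) (hβ : 0 < β)
    (hγ : 0 ≤ γ) :
    ∃ C : ℝ, ∃ d : ℕ, 1 ≤ C ∧ ∀ (f : ℝ → ℝ) (η K M₀ : ℝ), 0 < η → 0 ≤ K → 0 ≤ M₀ →
      (∀ v ∈ Ioo (0 : ℝ) 1, |f v| ≤ M₀ * v ^ (-α) * (1 - v) ^ (-β)) →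
      (∀ y ∈ Icc η (1 / 2), ∃ P : Polynomial ℝ, P.degree < r ∧
        ∀ u ∈ Icc (y / 2) (3 * y / 2), |f u - P.eval u| ≤ K * y ^ γ * y ^ (-α)) →
      ∀ y ∈ Icc η (1 / 2), ∀ P : Polynomial ℝ, P.degree < r →
        (∀ u ∈ Icc (y / 2) (3 * y / 2), |f u - P.eval u| ≤ K * y ^ γ * y ^ (-α)) →
        ∀ u ∈ Ico η 1, ∀ L, y / u ≤ L → u / y ≤ L → 1 / (1 - u) ≤ L →
          |f u - P.eval u| ≤ C * (K + M₀) * y ^ γ * y ^ (-α) * L ^ d := by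
  obtain ⟨C₀, hC₀, hext⟩ := exists_extrapolation_bound r hr
  obtain ⟨C₁, hC₁, hscale⟩ := exists_abs_sub_le_of_scales r hr hα hγ
  obtain ⟨d₀, hd₀⟩ := exists_nat_ge (α + β + γ)
  set C : ℝ := C₁ + C₀ * (C₁ + 1) * 2 ^ r + 1 + 2 ^ α * 2 ^ γ + C₀ * (4 ^ β + 1) * 2 ^ r * 2 ^ γ
    with hC
  have p1 : 0 < C₀ * (C₁ + 1) * 2 ^ r := by positivity
  have p2 : 0 < (2 : ℝ) ^ α * 2 ^ γ := by positivity
  have p3 : 0 < C₀ * (4 ^ β + 1) * 2 ^ r * 2 ^ γ := by positivity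
  refine ⟨C, d₀ + r, by linarith, ?_⟩
  intro f η K M₀ hη hK hM₀ hf H x hx P hPd hP u hu L hL1 hL2 hL3
  have hx0 : 0 < x := hη.trans_le hx.1
  have hu0 : 0 < u := hη.trans_le hu.1
  have hx2 := hx.2
  have hu1 := hu.2
  have hL : 1 ≤ L := by
    refine le_trans ?_ hL3
    rw [le_div_iff₀ (by linarith)]; linarith
  have hL0 : 0 < L := by linarith
  have hLr : 1 ≤ L ^ r := one_le_pow₀ hL
  have hLd : 1 ≤ L ^ d₀ := one_le_pow₀ hL
  have eα : L ^ α ≤ L ^ d₀ := rpow_le_pow_of_le hL (by linarith)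
  have eγ : L ^ γ ≤ L ^ d₀ := rpow_le_pow_of_le hL (by linarith)
  have eβγ : L ^ β * L ^ γ ≤ L ^ d₀ := by
    rw [← Real.rpow_add hL0]; exact rpow_le_pow_of_le hL (by linarith)
  have hxα := Real.rpow_pos_of_pos hx0 (-α)
  have hxγ := Real.rpow_pos_of_pos hx0 γ
  have hLγ := Real.rpow_pos_of_pos hL0 γ
  set Z := x ^ γ * x ^ (-α) with hZ
  have hZ0 : 0 < Z := by positivity
  have goalform : C * (K + M₀) * x ^ γ * x ^ (-α) * L ^ (d₀ + r) =
      C * (K + M₀) * Z * (L ^ d₀ * L ^ r) := by rw [hZ, pow_add]; ring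
  rw [goalform]
  have extfac : x ≤ u → 1 + |u - x| / (x / 2) ≤ 2 * L := by
    intro h
    rw [abs_of_nonneg (by linarith)]
    have : (u - x) / (x / 2) = 2 * (u / x) - 2 := by field_simp
    rw [this]; linarith
  have hscx := hscale f η K hη hK H x hx P hPd hP
  -- Three zones. Here the dyadic descent applies, and (x/u)^α is at most a power of L.
  rcases le_or_gt u (3 * x / 2) with h | h
  · have h1 := hscx u ⟨hu.1, h⟩
    have h2 : u ^ (-α) = x ^ (-α) * (x / u) ^ α := by
      rw [Real.div_rpow hx0.le hu0.le, Real.rpow_neg hx0.le, Real.rpow_neg hu0.le]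
      have := Real.rpow_pos_of_pos hx0 α
      field_simp
    have h3 : (x / u) ^ α ≤ L ^ d₀ :=
      (Real.rpow_le_rpow (by positivity) hL1 hα.le).trans eα
    calc |f u - P.eval u| ≤ C₁ * K * Z * (x / u) ^ α := by
          rw [h2] at h1; rw [hZ]; linarith
      _ ≤ C₁ * K * Z * (L ^ d₀ * L ^ r) := by
          gcongr
          exact h3.trans (le_mul_of_one_le_right (by positivity) hLr)
      _ ≤ C * (K + M₀) * Z * (L ^ d₀ * L ^ r) := by
          gcongr
          · linarith
          · linarith
  have huγ : u ^ γ ≤ x ^ γ * L ^ γ := by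
    rw [← Real.mul_rpow hx0.le hL0.le]
    refine Real.rpow_le_rpow hu0.le ?_ hγ
    rwa [div_le_iff₀' hx0] at hL2
  -- In the middle zone, compare with the polynomial at a scale y near u, no larger than 1/2. The
  -- dyadic descent brings its error down to [x, 3x/2], where it can be compared with P; the
  -- difference is then extrapolated back to u.
  rcases le_or_gt u (3 / 4) with h' | h'
  · obtain ⟨y, hy, hxy, hyu, huy⟩ : ∃ y ∈ Icc η (1 / 2), x ≤ y ∧ y ≤ u ∧ u ≤ 3 * y / 2 := by
      rcases le_total u (1 / 2) with h1 | h1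
      · exact ⟨u, ⟨hu.1, h1⟩, by linarith, le_rfl, by linarith⟩
      · exact ⟨1 / 2, ⟨hx.1.trans hx.2, le_rfl⟩, hx.2, h1, by linarith⟩
    have hy0 : 0 < y := by linarith
    obtain ⟨Py, hPyd, hPy⟩ := H y hy
    have hyγ : y ^ γ ≤ x ^ γ * L ^ γ := (Real.rpow_le_rpow hy0.le hyu hγ).trans huγ
    have hxyγ : x ^ γ ≤ x ^ γ * L ^ γ := (Real.rpow_le_rpow hx0.le (by linarith) hγ).trans huγ
    have hyα : y ^ (-α) ≤ x ^ (-α) := Real.rpow_le_rpow_of_nonpos hx0 hxy (by linarith)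
    have h1 : |f u - Py.eval u| ≤ K * Z * L ^ γ := by
      refine (hPy u ⟨by linarith, huy⟩).trans ?_
      calc K * y ^ γ * y ^ (-α) ≤ K * (x ^ γ * L ^ γ) * x ^ (-α) := by gcongr
        _ = _ := by rw [hZ]; ring
    have h2 : ∀ v ∈ Icc x (x + x / 2), |(Py - P).eval v| ≤ (C₁ + 1) * K * Z * L ^ γ := by
      intro v hv
      have hv0 : 0 < v := by linarith [hv.1]
      have a := hscale f η K hη hK H y hy Py hPyd hPy v
        ⟨hx.1.trans hv.1, by linarith [hv.2]⟩
      have b := hP v ⟨by linarith [hv.1], by linarith [hv.2]⟩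
      have hvα : v ^ (-α) ≤ x ^ (-α) := Real.rpow_le_rpow_of_nonpos hx0 hv.1 (by linarith)
      have a' : C₁ * K * y ^ γ * v ^ (-α) ≤ C₁ * K * (x ^ γ * L ^ γ) * x ^ (-α) := by gcongr
      have b' : K * x ^ γ * x ^ (-α) ≤ K * (x ^ γ * L ^ γ) * x ^ (-α) := by gcongr
      rw [Polynomial.eval_sub, show Py.eval v - P.eval v =
        (f v - P.eval v) - (f v - Py.eval v) by ring]
      refine (abs_sub _ _).trans ?_
      have e : (C₁ + 1) * K * Z * L ^ γ = C₁ * K * (x ^ γ * L ^ γ) * x ^ (-α) +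
        K * (x ^ γ * L ^ γ) * x ^ (-α) := by rw [hZ]; ring
      rw [e]; linarith
    have h3 := hext (Py - P) x (x / 2) _
      ((Polynomial.degree_sub_le _ _).trans_lt (max_lt hPyd hPd)) (by linarith) h2 u
    have h4 : |(Py - P).eval u| ≤ C₀ * (C₁ + 1) * 2 ^ r * K * Z * (L ^ γ * L ^ r) := by
      refine h3.trans ?_
      have : (1 + |u - x| / (x / 2)) ^ r ≤ (2 * L) ^ r :=
        pow_le_pow_left₀ (by positivity) (extfac (by linarith)) r
      calc _ ≤ C₀ * ((C₁ + 1) * K * Z * L ^ γ) * (2 * L) ^ r := by gcongr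
        _ = _ := by rw [mul_pow]; ring
    rw [show f u - P.eval u = (f u - Py.eval u) + (Py - P).eval u by
      rw [Polynomial.eval_sub]; ring]
    calc _ ≤ K * Z * L ^ γ + C₀ * (C₁ + 1) * 2 ^ r * K * Z * (L ^ γ * L ^ r) :=
          (abs_add_le _ _).trans (add_le_add h1 h4)
      _ ≤ K * Z * (L ^ γ * L ^ r) + C₀ * (C₁ + 1) * 2 ^ r * K * Z * (L ^ γ * L ^ r) := by
          gcongr
          exact le_mul_of_one_le_right hLγ.le hLr
      _ = (1 + C₀ * (C₁ + 1) * 2 ^ r) * K * Z * (L ^ γ * L ^ r) := by ring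
      _ ≤ C * (K + M₀) * Z * (L ^ d₀ * L ^ r) := by
          gcongr
          · linarith
          · linarith
  -- Near the right endpoint no approximation is available, so f and P are bounded separately. As
  -- u/x ≤ L and u > 3/4, the scale x is at least 1/(2L), and the missing factor x^γ is bought with
  -- powers of L.
  · have hxγ1 : 1 ≤ x ^ γ * (2 ^ γ * L ^ γ) := by
      rw [← Real.mul_rpow (by norm_num) hL0.le, ← Real.mul_rpow hx0.le (by positivity)]
      refine Real.one_le_rpow ?_ hγ
      rw [div_le_iff₀' hx0] at hL2
      linarith
    have h1 : |f u| ≤ 2 ^ α * 2 ^ γ * M₀ * Z * (L ^ β * L ^ γ) := by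
      have a1 : u ^ (-α) ≤ 2 ^ α * x ^ (-α) := by
        have : u ^ (-α) ≤ (x / 2) ^ (-α) :=
          Real.rpow_le_rpow_of_nonpos (by linarith) (by linarith) (by linarith)
        rwa [div_two_rpow_neg hx0] at this
      have a2 : (1 - u) ^ (-β) ≤ L ^ β := by
        rw [Real.rpow_neg (by linarith), ← Real.inv_rpow (by linarith)]
        refine Real.rpow_le_rpow (inv_nonneg.2 (by linarith)) ?_ hβ.le
        rwa [← one_div]
      have hLβ := Real.rpow_pos_of_pos hL0 β
      have h1u : 0 ≤ (1 - u) ^ (-β) := Real.rpow_nonneg (by linarith) _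
      calc |f u| ≤ M₀ * u ^ (-α) * (1 - u) ^ (-β) := hf u ⟨hu0, hu1⟩
        _ ≤ M₀ * (2 ^ α * x ^ (-α)) * L ^ β := by gcongr
        _ ≤ M₀ * (2 ^ α * x ^ (-α)) * L ^ β * (x ^ γ * (2 ^ γ * L ^ γ)) :=
          le_mul_of_one_le_right (by positivity) hxγ1
        _ = _ := by rw [hZ]; ring
    have h2 : ∀ v ∈ Icc x (x + x / 2), |P.eval v| ≤ (4 ^ β + 1) * (K + M₀) * x ^ (-α) := by
      intro v hv
      have hv0 : 0 < v := by linarith [hv.1]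
      have b := hP v ⟨by linarith [hv.1], by linarith [hv.2]⟩
      have a1 : v ^ (-α) ≤ x ^ (-α) := Real.rpow_le_rpow_of_nonpos hx0 hv.1 (by linarith)
      have a2 : (1 - v) ^ (-β) ≤ 4 ^ β := by
        have : (1 - v) ^ (-β) ≤ (1 / 4) ^ (-β) :=
          Real.rpow_le_rpow_of_nonpos (by norm_num) (by linarith [hv.2]) (by linarith)
        rwa [one_div, Real.inv_rpow (by norm_num), ← Real.rpow_neg (by norm_num), neg_neg] at this
      have hv1 : 0 ≤ (1 - v) ^ (-β) := Real.rpow_nonneg (by linarith [hv.2]) _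
      have a3 : |f v| ≤ M₀ * x ^ (-α) * 4 ^ β := by
        refine (hf v ⟨hv0, by linarith [hv.2]⟩).trans ?_
        gcongr
      have a4 : x ^ γ ≤ 1 := Real.rpow_le_one hx0.le (by linarith) hγ
      have a5 : K * x ^ γ * x ^ (-α) ≤ K * 1 * x ^ (-α) := by gcongr
      have e : P.eval v = f v - (f v - P.eval v) := by ring
      rw [e]
      refine (abs_sub _ _).trans ((add_le_add a3 (b.trans a5)).trans ?_)
      have p4 : 0 < (4 : ℝ) ^ β := by positivity
      have q1 : 0 ≤ (4 : ℝ) ^ β * (K * x ^ (-α)) := by positivity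
      have q2 : 0 ≤ M₀ * x ^ (-α) := by positivity
      nlinarith
    have h3 := hext P x (x / 2) _ hPd (by linarith) h2 u
    have h4 : |P.eval u| ≤
        C₀ * (4 ^ β + 1) * 2 ^ r * 2 ^ γ * (K + M₀) * Z * (L ^ γ * L ^ r) := by
      refine h3.trans ?_
      have : (1 + |u - x| / (x / 2)) ^ r ≤ (2 * L) ^ r :=
        pow_le_pow_left₀ (by positivity) (extfac (by linarith)) r
      calc _ ≤ C₀ * ((4 ^ β + 1) * (K + M₀) * x ^ (-α)) * (2 * L) ^ r := by gcongr
        _ ≤ C₀ * ((4 ^ β + 1) * (K + M₀) * x ^ (-α)) * (2 * L) ^ r * (x ^ γ * (2 ^ γ * L ^ γ)) :=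
          le_mul_of_one_le_right (by positivity) hxγ1
        _ = _ := by rw [mul_pow, hZ]; ring
    calc _ ≤ 2 ^ α * 2 ^ γ * M₀ * Z * (L ^ β * L ^ γ) +
          C₀ * (4 ^ β + 1) * 2 ^ r * 2 ^ γ * (K + M₀) * Z * (L ^ γ * L ^ r) :=
          (abs_sub _ _).trans (add_le_add h1 h4)
      _ ≤ 2 ^ α * 2 ^ γ * (K + M₀) * Z * (L ^ d₀ * L ^ r) +
          C₀ * (4 ^ β + 1) * 2 ^ r * 2 ^ γ * (K + M₀) * Z * (L ^ d₀ * L ^ r) := by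
          have e5 : L ^ β * L ^ γ ≤ L ^ d₀ * L ^ r :=
            eβγ.trans (le_mul_of_one_le_right (by positivity) hLr)
          refine add_le_add (mul_le_mul ?_ e5 (by positivity) (by positivity)) (by gcongr)
          gcongr
          linarith
      _ = (2 ^ α * 2 ^ γ + C₀ * (4 ^ β + 1) * 2 ^ r * 2 ^ γ) * (K + M₀) * Z *
          (L ^ d₀ * L ^ r) := by ring
      _ ≤ _ := by
          gcongr
          linarith

/-! ### Local approximability and growth at the kernel scale. -/

/-- `f` is approximable by polynomials of degree less than `r` on `[x-σ,x+σ]`, `σ ≤ x/2`, with error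
`M x^{-α} (σ x^{-b})^a`, as long as the normalized radius `σ x^{-b}` is at least `τ`. -/
def LocallyApproximable (r : ℕ) (α b a τ M : ℝ) (f : ℝ → ℝ) : Prop :=
  ∀ x ∈ Ioc (0 : ℝ) (1 / 2), ∀ σ ∈ Ioc (0 : ℝ) (x / 2), τ ≤ σ * x ^ (-b) →
    ∃ Q : Polynomial ℝ, Q.degree < r ∧
      ∀ u, |u - x| ≤ σ → |f u - Q.eval u| ≤ M * x ^ (-α) * (σ * x ^ (-b)) ^ a

/-- The size condition `|f| ≤ M₀ / w` on `(0,1)`. -/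
def WeightedBound (α β M₀ : ℝ) (f : ℝ → ℝ) : Prop :=
  ∀ v ∈ Ioo (0 : ℝ) 1, |f v| ≤ M₀ * v ^ (-α) * (1 - v) ^ (-β)

theorem localScale_le_two_mul_max {n : ℕ} (hn : 1 ≤ n) {x : ℝ} (h0 : 0 < x) :
    localScale n x ≤ 2 * max x (1 / n) := by
  have hnR : (0 : ℝ) < n := by positivity
  have h1 : x * (1 - x) / n ≤ (max x (1 / n)) ^ 2 := by
    have a : x * (1 - x) / n ≤ x * (1 / n) := by
      rw [mul_one_div]; gcongr; nlinarith
    refine a.trans ?_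
    rw [sq]
    gcongr
    · exact le_max_left _ _
    · exact le_max_right _ _
  have h2 := Real.sqrt_le_sqrt h1
  rw [Real.sqrt_sq (h0.le.trans (le_max_left _ _))] at h2
  unfold localScale
  linarith [le_max_right x (1 / (n : ℝ))]

theorem localScale_sq_le {n : ℕ} {x : ℝ} (h : 1 / (n : ℝ) ≤ x) (h1 : x ≤ 1) (hn : 1 ≤ n) :
    n * localScale n x ^ 2 ≤ 4 * x := by
  have := mul_localScale_sq_le hn ((by positivity : 0 ≤ 1 / (n : ℝ)).trans h) h1
  have e : 2 / (n : ℝ) = 2 * (1 / n) := by ring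
  rw [e] at this; linarith

/-- A point at distance comparable to x, or to 1, from x is many spreads away, and n s² ≲ x + 1/n
quantifies how many. Since u keeps distance 1/n from the endpoints, the ratios x/u and 1/(1-u) are
at most nx and n in the cases where they could be large. -/
theorem localGrowth_bounds {n : ℕ} (hn : 16 ≤ n) {x : ℝ} (h0 : 0 < x) (h1 : x ≤ 1 / 2) {u : ℝ}
    (hu : u ∈ Icc (1 / (n : ℝ)) (1 - 1 / n)) :
    max x (1 / n) / u ≤ 64 * localGrowth n x u ^ 2 ∧
      u / max x (1 / n) ≤ 64 * localGrowth n x u ^ 2 ∧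
      1 / (1 - u) ≤ 64 * localGrowth n x u ^ 2 := by
  have hn1 : 1 ≤ n := by omega
  have hnR : (0 : ℝ) < n := by positivity
  have hn16 : (16 : ℝ) ≤ n := by exact_mod_cast hn
  have hd0 : 0 < 1 / (n : ℝ) := by positivity
  have hs := localScale_pos hn1 x
  have hG := one_le_localGrowth hn1 x u
  have hu0 : 0 < u := hd0.trans_le hu.1
  have hu1 : u < 1 := by linarith [hu.2]
  have hGs : |u - x| = (localGrowth n x u - 1) * localScale n x := by
    unfold localGrowth; field_simp; ring
  set G := localGrowth n x u
  set s := localScale n x with hsdef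
  set y := max x (1 / (n : ℝ)) with hy
  have hxy : x ≤ y := le_max_left _ _
  have hny : 1 / (n : ℝ) ≤ y := le_max_right _ _
  have hy0 : 0 < y := hd0.trans_le hny
  have hsy : s ≤ 2 * y := localScale_le_two_mul_max hn1 h0
  have hGG : G ≤ G ^ 2 := by nlinarith
  refine ⟨?_, ?_, ?_⟩
  · rcases le_or_gt y (2 * u) with h | h
    · rw [div_le_iff₀ hu0]
      nlinarith
    · have hyx : y = x := by
        rcases le_total (1 / (n : ℝ)) x with h' | h'
        · exact max_eq_left h'
        · have : y = 1 / n := max_eq_right h'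
          linarith [hu.1]
      have h2 : x / 2 ≤ G * s := by linarith [neg_abs_le (u - x)]
      have h3 : n * s ^ 2 ≤ 4 * x := localScale_sq_le (hyx ▸ hny) (by linarith) hn1
      have h4 : n * x ≤ 16 * G ^ 2 := by
        have h5 : (x / 2) ^ 2 ≤ (G * s) ^ 2 := pow_le_pow_left₀ (by linarith) h2 2
        have h6 : n * (x / 2) ^ 2 ≤ G ^ 2 * (4 * x) := by
          calc n * (x / 2) ^ 2 ≤ n * (G * s) ^ 2 := by gcongr
            _ = G ^ 2 * (n * s ^ 2) := by ring
            _ ≤ _ := by gcongr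
        have h7 : x * (n * x) ≤ x * (16 * G ^ 2) := by linarith
        exact le_of_mul_le_mul_left h7 h0
      rw [hyx]
      have h8 : x / u ≤ x * n := by
        rw [div_le_iff₀ hu0]
        have e : (n : ℝ) * (1 / n) = 1 := by field_simp
        have : 1 ≤ n * u := by rw [← e]; exact mul_le_mul_of_nonneg_left hu.1 hnR.le
        nlinarith
      nlinarith
  · rw [div_le_iff₀ hy0]
    have h2 : u ≤ x + (G - 1) * s := by linarith [le_abs_self (u - x)]
    nlinarith
  · rcases le_or_gt u (3 / 4) with h | h
    · rw [div_le_iff₀ (by linarith)]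
      nlinarith
    · have h2 : 1 / 4 ≤ G * s := by linarith [le_abs_self (u - x)]
      have h3 : n * s ^ 2 ≤ 2 * x + 2 / n := mul_localScale_sq_le hn1 h0.le (by linarith)
      have h4 : 2 / (n : ℝ) ≤ 1 := by rw [div_le_one hnR]; linarith
      have h5 : (n : ℝ) ≤ 32 * G ^ 2 := by
        have : 1 / 16 ≤ G ^ 2 * s ^ 2 := by nlinarith
        nlinarith [sq_nonneg G]
      have h6 : 1 / (1 - u) ≤ n := by
        rw [div_le_iff₀ (by linarith)]
        have := hu.2
        have e : (n : ℝ) * (1 / n) = 1 := by field_simp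
        nlinarith
      nlinarith

/-- Polynomial approximation at all scales above `η`. -/
theorem LocallyApproximable.scales {r : ℕ} {α β b a τ M M₀ : ℝ} {f : ℝ → ℝ} (hα : 0 < α)
    (hβ : 0 < β) (ha : 0 < a) (hM : 0 ≤ M) (hM₀ : 0 ≤ M₀) (hf : WeightedBound α β M₀ f)
    (h : LocallyApproximable r α b a τ M f) {η : ℝ} (hη : 0 < η)
    (hτ : b < 1 → 2 * τ ≤ η ^ (1 - b)) :
    ∀ y ∈ Icc η (1 / 2), ∃ P : Polynomial ℝ, P.degree < r ∧
      ∀ u ∈ Icc (y / 2) (3 * y / 2), |f u - P.eval u| ≤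
        (M + 2 ^ α * 4 ^ β * M₀) * y ^ (a * max (1 - b) 0) * y ^ (-α) := by
  intro y hy
  have hy0 : 0 < y := hη.trans_le hy.1
  have hyα := Real.rpow_pos_of_pos hy0 (-α)
  rcases lt_or_ge b 1 with hb | hb
  · have e1 : y / 2 * y ^ (-b) = y ^ (1 - b) / 2 := by
      rw [sub_eq_add_neg, Real.rpow_add hy0, Real.rpow_one]; ring
    obtain ⟨Q, hQ, hQu⟩ := h y ⟨hy0, hy.2⟩ (y / 2) ⟨by linarith, le_rfl⟩ (by
      rw [e1]
      have := Real.rpow_le_rpow hη.le hy.1 (by linarith : 0 ≤ 1 - b)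
      linarith [hτ hb])
    refine ⟨Q, hQ, fun u hu => ?_⟩
    refine (hQu u (by rw [abs_le]; constructor <;> linarith [hu.1, hu.2])).trans ?_
    rw [e1, max_eq_left (by linarith), mul_comm a, Real.rpow_mul hy0.le]
    have h1 : (y ^ (1 - b) / 2) ^ a ≤ (y ^ (1 - b)) ^ a := by
      refine Real.rpow_le_rpow (by positivity) ?_ ha.le
      linarith [Real.rpow_pos_of_pos hy0 (1 - b)]
    have h2 : 0 ≤ 2 ^ α * 4 ^ β * M₀ := by positivity
    calc _ ≤ M * y ^ (-α) * (y ^ (1 - b)) ^ a := by gcongr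
      _ = M * (y ^ (1 - b)) ^ a * y ^ (-α) := by ring
      _ ≤ _ := by gcongr; linarith
  -- For b ≥ 1 the exponent of y gained is 0, so the size bound on f suffices and no approximation
  -- is needed.
  · refine ⟨0, by simp, fun u hu => ?_⟩
    have hu0 : 0 < u := by linarith [hu.1]
    rw [max_eq_right (by linarith), mul_zero, Real.rpow_zero, mul_one, Polynomial.eval_zero,
      sub_zero]
    have a1 : u ^ (-α) ≤ 2 ^ α * y ^ (-α) := by
      rw [← div_two_rpow_neg hy0]
      exact Real.rpow_le_rpow_of_nonpos (by linarith) (by linarith [hu.1]) (by linarith)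
    have a2 : (1 - u) ^ (-β) ≤ 4 ^ β := by
      have : (1 - u) ^ (-β) ≤ (1 / 4) ^ (-β) :=
        Real.rpow_le_rpow_of_nonpos (by norm_num) (by linarith [hu.2, hy.2]) (by linarith)
      rwa [one_div, Real.inv_rpow (by norm_num), ← Real.rpow_neg (by norm_num), neg_neg] at this
    have hv1 : 0 ≤ (1 - u) ^ (-β) := Real.rpow_nonneg (by linarith [hu.2, hy.2]) _
    calc |f u| ≤ M₀ * u ^ (-α) * (1 - u) ^ (-β) := hf u ⟨hu0, by linarith [hu.2, hy.2]⟩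
      _ ≤ M₀ * (2 ^ α * y ^ (-α)) * 4 ^ β := by gcongr
      _ = 2 ^ α * 4 ^ β * M₀ * y ^ (-α) := by ring
      _ ≤ _ := by gcongr; linarith

theorem rpow_max_le {y b : ℝ} (h0 : 0 < y) (h1 : y ≤ 1) : y ^ max (1 - b) 0 ≤ y * y ^ (-b) := by
  have e : y * y ^ (-b) = y ^ (1 - b) := by
    rw [sub_eq_add_neg, Real.rpow_add h0, Real.rpow_one]
  rw [e]
  exact Real.rpow_le_rpow_of_exponent_ge h0 h1 (le_max_left _ _)

set_option maxHeartbeats 1600000 in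
/-- A polynomial approximating `f` at the kernel scale around `x`, with error of polynomial growth
in units of that scale. -/
theorem exists_polynomial_localGrowth (r : ℕ) (hr : 1 ≤ r) {α β b a : ℝ} (hα : 0 < α) (hβ : 0 < β)
    (hb : 0 ≤ b) (ha : 0 < a) :
    ∃ C : ℝ, ∃ d : ℕ, 0 < C ∧ ∀ (f : ℝ → ℝ) (τ M M₀ : ℝ), 0 ≤ M → 0 ≤ M₀ → WeightedBound α β M₀ f →
      LocallyApproximable r α b a τ M f → ∀ n : ℕ, 16 ≤ n → ∀ x ∈ Ioc (0 : ℝ) (1 / 2),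
      (b < 1 → 2 * τ ≤ (1 / (n : ℝ)) ^ (1 - b)) → τ ≤ localScale n x * x ^ (-b) →
      ∃ Q : Polynomial ℝ, Q.degree < r ∧
        (∀ u ∈ Icc (1 / (n : ℝ)) (1 - 1 / n), |f u - Q.eval u| ≤
          C * (M + M₀) * (localScale n x * x ^ (-b)) ^ a * (max x (1 / n)) ^ (-α) *
            localGrowth n x u ^ d) ∧
        (τ ≤ 0 → |f x - Q.eval x| ≤
          C * (M + M₀) * (localScale n x * x ^ (-b)) ^ a * x ^ (-α)) := by
  set γ := a * max (1 - b) 0 with hγdef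
  have hγ : 0 ≤ γ := mul_nonneg ha.le (le_max_right _ _)
  obtain ⟨C₀, hC₀, hext⟩ := exists_extrapolation_bound r hr
  obtain ⟨C₁, hC₁, hdown⟩ := exists_abs_sub_le_of_scales r hr hα hγ
  obtain ⟨C₂, d, hC₂, hgrow⟩ := exists_abs_sub_le_growth r hr hα hβ hγ
  obtain ⟨e, he⟩ := exists_nat_ge a
  set B : ℝ := 1 + 2 ^ α * 4 ^ β with hB
  have hB1 : 1 ≤ B := by
    have : 0 ≤ (2 : ℝ) ^ α * 4 ^ β := by positivity
    linarith
  set C : ℝ := C₁ * B * 2 ^ a + (C₂ * (2 * B) * 64 ^ d * 2 ^ a + C₀ * (2 * B) * 2 ^ a) +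
    (1 + 2 * C₀) with hC
  have p1 : 0 < C₁ * B * 2 ^ a := by positivity
  have p2 : 0 < C₂ * (2 * B) * 64 ^ d * 2 ^ a := by positivity
  have p3 : 0 < C₀ * (2 * B) * 2 ^ a := by positivity
  -- Growth orders: 2d because the macroscopic ratios cost a square of the growth factor, e ≥ a for
  -- enlarging the radius, r for extrapolation.
  refine ⟨C, 2 * d + e + r, by linarith, ?_⟩
  intro f τ M M₀ hM hM₀ hf hLA n hn x hx hτn hτ
  have hn1 : 1 ≤ n := by omega
  have hnR : (0 : ℝ) < n := by positivity
  have hn16 : (16 : ℝ) ≤ n := by exact_mod_cast hn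
  have hd0 : 0 < 1 / (n : ℝ) := by positivity
  have hd1 : 1 / (n : ℝ) ≤ 1 / 16 := one_div_le_one_div_of_le (by norm_num) hn16
  have hx0 := hx.1
  have hx2 := hx.2
  set s := localScale n x with hs
  have hs0 : 0 < s := localScale_pos hn1 x
  have hns : 1 / (n : ℝ) ≤ s := one_div_le_localScale n x
  set T := s * x ^ (-b) with hT
  have hxb := Real.rpow_pos_of_pos hx0 (-b)
  have hxα := Real.rpow_pos_of_pos hx0 (-α)
  have hT0 : 0 < T := by positivity
  have hTa := Real.rpow_pos_of_pos hT0 a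
  set y := max x (1 / (n : ℝ)) with hy
  have hxy : x ≤ y := le_max_left _ _
  have hny : 1 / (n : ℝ) ≤ y := le_max_right _ _
  have hy0 : 0 < y := hd0.trans_le hny
  have hy2 : y ≤ 1 / 2 := max_le hx2 (by linarith)
  have hyα := Real.rpow_pos_of_pos hy0 (-α)
  set K := M + 2 ^ α * 4 ^ β * M₀ with hK
  have hK0 : 0 ≤ K := by positivity
  have hKM : K ≤ B * (M + M₀) := by
    have h1 : 0 ≤ (2 : ℝ) ^ α * 4 ^ β * M := by positivity
    have h2 : B * (M + M₀) = M + M₀ + 2 ^ α * 4 ^ β * M + 2 ^ α * 4 ^ β * M₀ := by rw [hB]; ring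
    rw [h2]; linarith
  have hKM2 : K + M₀ ≤ 2 * B * (M + M₀) := by nlinarith
  have hMM : 0 ≤ M + M₀ := by linarith
  have H := hLA.scales hα hβ ha hM hM₀ hf hd0 hτn
  obtain ⟨P, hPd, hP⟩ := H y ⟨hny, hy2⟩
  have hgr : ∀ u ∈ Icc (1 / (n : ℝ)) (1 - 1 / n), |f u - P.eval u| ≤
      C₂ * (2 * B) * 64 ^ d * (M + M₀) * y ^ γ * y ^ (-α) * localGrowth n x u ^ (2 * d) := by
    intro u hu
    obtain ⟨g1, g2, g3⟩ := localGrowth_bounds hn hx0 hx2 hu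
    have h1 := hgrow f (1 / n) K M₀ hd0 hK0 hM₀ hf H y ⟨hny, hy2⟩ P hPd hP u
      ⟨hu.1, by linarith [hu.2]⟩ _ g1 g2 g3
    refine h1.trans ?_
    have hG := one_le_localGrowth hn1 x u
    rw [mul_pow, ← pow_mul]
    calc _ ≤ C₂ * (2 * B * (M + M₀)) * y ^ γ * y ^ (-α) *
          (64 ^ d * localGrowth n x u ^ (2 * d)) := by gcongr
      _ = _ := by ring
  -- When the spread exceeds x/2, local approximation at radius s is not available; the polynomial
  -- at scale y = max x (1/n) ≤ 2s replaces it.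
  rcases lt_or_ge (x / 2) s with hsx | hsx
  · have hyT : y ^ γ ≤ 2 ^ a * T ^ a := by
      rw [hγdef, mul_comm a, Real.rpow_mul hy0.le, ← Real.mul_rpow (by norm_num) hT0.le]
      refine Real.rpow_le_rpow (by positivity) ?_ ha.le
      refine (rpow_max_le hy0 (by linarith)).trans ?_
      have h1 : y ^ (-b) ≤ x ^ (-b) := Real.rpow_le_rpow_of_nonpos hx0 hxy (by linarith)
      have h2 : y ≤ 2 * s := max_le (by linarith) (by linarith)
      calc y * y ^ (-b) ≤ 2 * s * x ^ (-b) := by gcongr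
        _ = _ := by rw [hT]; ring
    refine ⟨P, hPd, fun u hu => ?_, fun hτ0 => ?_⟩
    · have hG := one_le_localGrowth hn1 x u
      refine (hgr u hu).trans ?_
      calc _ ≤ C₂ * (2 * B) * 64 ^ d * (M + M₀) * (2 ^ a * T ^ a) * y ^ (-α) *
            localGrowth n x u ^ (2 * d + e + r) := by
            gcongr
            omega
        _ = (C₂ * (2 * B) * 64 ^ d * 2 ^ a) * (M + M₀) * T ^ a * y ^ (-α) *
            localGrowth n x u ^ (2 * d + e + r) := by ring
        _ ≤ _ := by
            gcongr
            linarith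
    -- The point x may lie below 1/n, so the descent must continue to the smaller of the two. This
    -- needs approximation at every scale, hence τ ≤ 0.
    · have hη : 0 < min x (1 / (n : ℝ)) := lt_min hx0 hd0
      have H' := hLA.scales hα hβ ha hM hM₀ hf hη fun _ =>
        (by linarith : 2 * τ ≤ 0).trans (Real.rpow_nonneg hη.le _)
      have h1 := hdown f _ K hη hK0 H' y ⟨(min_le_right _ _).trans hny, hy2⟩ P hPd hP x
        ⟨min_le_left _ _, by linarith⟩
      refine h1.trans ?_
      calc _ ≤ C₁ * (B * (M + M₀)) * (2 ^ a * T ^ a) * x ^ (-α) := by gcongr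
        _ = C₁ * B * 2 ^ a * (M + M₀) * T ^ a * x ^ (-α) := by ring
        _ ≤ _ := by
            gcongr
            linarith
  · have hyx : y = x := max_eq_left (by linarith)
    rw [hyx] at hP hgr ⊢
    obtain ⟨Q, hQd, hQ⟩ := hLA x hx s ⟨hs0, hsx⟩ hτ
    rw [← hT] at hQ
    have hxγ : ∀ G : ℝ, 1 ≤ G → x / s ≤ 2 * G → x ^ γ ≤ 2 ^ a * T ^ a * G ^ a := by
      intro G hG hxs
      rw [hγdef, mul_comm a, Real.rpow_mul hx0.le, ← Real.mul_rpow (by norm_num) hT0.le,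
        ← Real.mul_rpow (by positivity) (by positivity)]
      refine Real.rpow_le_rpow (by positivity) ?_ ha.le
      refine (rpow_max_le hx0 (by linarith)).trans ?_
      have h1 : x * x ^ (-b) = T * (x / s) := by rw [hT]; field_simp
      rw [h1]
      nlinarith
    have hfin : ∀ u ∈ Icc (1 / (n : ℝ)) (1 - 1 / n), |f u - Q.eval u| ≤
        C * (M + M₀) * T ^ a * x ^ (-α) * localGrowth n x u ^ (2 * d + e + r) := by
      intro u hu
      have hG := one_le_localGrowth hn1 x u
      have hGe : localGrowth n x u = 1 + |u - x| / s := rfl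
      have hGs : |u - x| ≤ localGrowth n x u * s := by
        rw [hGe, add_mul, div_mul_cancel₀ _ hs0.ne']; linarith
      have hGs1 : s ≤ localGrowth n x u * s := by nlinarith
      set G := localGrowth n x u
      have hG0 : 0 < G := by linarith
      have hGa : G ^ a ≤ G ^ e := rpow_le_pow_of_le hG he
      have hGap := Real.rpow_pos_of_pos hG0 a
      have hpow : ∀ {i j : ℕ}, i ≤ j → G ^ i ≤ G ^ j := fun h => pow_le_pow_right₀ hG h
      -- For u within x/2, compare Q with the local polynomial whose radius just reaches u; beyond
      -- that, with the polynomial P at scale x, where x/s ≤ 2G pays for the change of scale.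
      rcases le_or_gt |u - x| (x / 2) with h | h
      · set σ := max s |u - x| with hσ
        have hσs : s ≤ σ := le_max_left _ _
        have hσ0 : 0 < σ := hs0.trans_le hσs
        have hTσ : T ≤ σ * x ^ (-b) := by rw [hT]; gcongr
        obtain ⟨Q', hQ'd, hQ'⟩ := hLA x hx σ ⟨hσ0, max_le hsx h⟩ (hτ.trans hTσ)
        have hσT : σ * x ^ (-b) ≤ T * G := by
          rw [hT]
          have : σ ≤ G * s := max_le hGs1 hGs
          calc σ * x ^ (-b) ≤ G * s * x ^ (-b) := by gcongr
            _ = _ := by ring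
        have hσTa : (σ * x ^ (-b)) ^ a ≤ T ^ a * G ^ a := by
          rw [← Real.mul_rpow hT0.le hG0.le]
          exact Real.rpow_le_rpow (by positivity) hσT ha.le
        have hTTa : T ^ a ≤ T ^ a * G ^ a :=
          le_mul_of_one_le_right hTa.le (Real.one_le_rpow hG ha.le)
        have h1 : |f u - Q'.eval u| ≤ M * x ^ (-α) * (T ^ a * G ^ a) :=
          (hQ' u (le_max_right _ _)).trans (by gcongr)
        have h2 : ∀ v ∈ Icc x (x + s), |(Q' - Q).eval v| ≤
            2 * (M * x ^ (-α) * (T ^ a * G ^ a)) := by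
          intro v hv
          have hvx : |v - x| ≤ s := by rw [abs_le]; constructor <;> linarith [hv.1, hv.2]
          have a1 : |f v - Q.eval v| ≤ M * x ^ (-α) * (T ^ a * G ^ a) :=
            (hQ v hvx).trans (by gcongr)
          have a2 : |f v - Q'.eval v| ≤ M * x ^ (-α) * (T ^ a * G ^ a) :=
            (hQ' v (hvx.trans hσs)).trans (by gcongr)
          rw [Polynomial.eval_sub, show Q'.eval v - Q.eval v =
            (f v - Q.eval v) - (f v - Q'.eval v) by ring]
          refine (abs_sub _ _).trans ?_
          linarith
        have h3 := hext (Q' - Q) x s _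
          ((Polynomial.degree_sub_le _ _).trans_lt (max_lt hQ'd hQd)) hs0 h2 u
        rw [← hGe] at h3
        rw [show f u - Q.eval u = (f u - Q'.eval u) + (Q' - Q).eval u by
          rw [Polynomial.eval_sub]; ring]
        have hGr : 1 ≤ G ^ r := one_le_pow₀ hG
        calc _ ≤ M * x ^ (-α) * (T ^ a * G ^ a) + C₀ * (2 * (M * x ^ (-α) * (T ^ a * G ^ a))) *
              G ^ r := (abs_add_le _ _).trans (add_le_add h1 h3)
          _ ≤ M * x ^ (-α) * (T ^ a * G ^ a) * G ^ r +
              C₀ * (2 * (M * x ^ (-α) * (T ^ a * G ^ a))) * G ^ r := by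
              exact add_le_add (le_mul_of_one_le_right (by positivity) hGr) le_rfl
          _ = (1 + 2 * C₀) * M * T ^ a * x ^ (-α) * (G ^ a * G ^ r) := by ring
          _ ≤ C * (M + M₀) * T ^ a * x ^ (-α) * G ^ (2 * d + e + r) := by
              have : G ^ a * G ^ r ≤ G ^ (2 * d + e + r) := by
                calc G ^ a * G ^ r ≤ G ^ e * G ^ r := by gcongr
                  _ = G ^ (e + r) := by rw [pow_add]
                  _ ≤ _ := hpow (by omega)
              gcongr
              · linarith
              · linarith
      · have hxs : x / s ≤ 2 * G := by
          rw [div_le_iff₀ hs0]; linarith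
        have hxγG := hxγ G hG hxs
        have h1 := hgr u hu
        have h2 : ∀ v ∈ Icc x (x + s), |(P - Q).eval v| ≤
            2 * B * (M + M₀) * x ^ (-α) * (2 ^ a * T ^ a * G ^ a) := by
          intro v hv
          have a1 : |f v - Q.eval v| ≤ M * x ^ (-α) * (2 ^ a * T ^ a * G ^ a) := by
            refine (hQ v (by rw [abs_le]; constructor <;> linarith [hv.1, hv.2])).trans ?_
            have b1 : T ^ a ≤ 2 ^ a * T ^ a * G ^ a := by
              have c1 : 1 ≤ (2 : ℝ) ^ a := Real.one_le_rpow (by norm_num) ha.le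
              have c2 : 1 ≤ G ^ a := Real.one_le_rpow hG ha.le
              calc T ^ a = 1 * T ^ a * 1 := by ring
                _ ≤ _ := by gcongr
            gcongr
          have a2 : |f v - P.eval v| ≤ K * x ^ (-α) * (2 ^ a * T ^ a * G ^ a) := by
            refine (hP v ⟨by linarith [hv.1], by linarith [hv.2]⟩).trans ?_
            calc _ ≤ K * (2 ^ a * T ^ a * G ^ a) * x ^ (-α) := by gcongr
              _ = _ := by ring
          rw [Polynomial.eval_sub, show P.eval v - Q.eval v =
            (f v - Q.eval v) - (f v - P.eval v) by ring]
          refine (abs_sub _ _).trans ((add_le_add a1 a2).trans ?_)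
          rw [← add_mul, ← add_mul]
          gcongr
          nlinarith
        have h3 := hext (P - Q) x s _
          ((Polynomial.degree_sub_le _ _).trans_lt (max_lt hPd hQd)) hs0 h2 u
        rw [← hGe] at h3
        rw [show f u - Q.eval u = (f u - P.eval u) + (P - Q).eval u by
          rw [Polynomial.eval_sub]; ring]
        have g1 : G ^ e * G ^ (2 * d) ≤ G ^ (2 * d + e + r) := by
          rw [← pow_add]; exact hpow (by omega)
        have g2 : G ^ e * G ^ r ≤ G ^ (2 * d + e + r) := by
          rw [← pow_add]; exact hpow (by omega)
        calc _ ≤ C₂ * (2 * B) * 64 ^ d * (M + M₀) * x ^ γ * x ^ (-α) * G ^ (2 * d) +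
              C₀ * (2 * B * (M + M₀) * x ^ (-α) * (2 ^ a * T ^ a * G ^ a)) * G ^ r :=
              (abs_add_le _ _).trans (add_le_add h1 h3)
          _ ≤ C₂ * (2 * B) * 64 ^ d * (M + M₀) * (2 ^ a * T ^ a * G ^ e) * x ^ (-α) *
                G ^ (2 * d) +
              C₀ * (2 * B * (M + M₀) * x ^ (-α) * (2 ^ a * T ^ a * G ^ e)) * G ^ r := by
              have : x ^ γ ≤ 2 ^ a * T ^ a * G ^ e := hxγG.trans (by gcongr)
              gcongr
          _ = C₂ * (2 * B) * 64 ^ d * 2 ^ a * ((M + M₀) * T ^ a * x ^ (-α)) *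
                (G ^ e * G ^ (2 * d)) +
              C₀ * (2 * B) * 2 ^ a * ((M + M₀) * T ^ a * x ^ (-α)) * (G ^ e * G ^ r) := by ring
          _ ≤ C₂ * (2 * B) * 64 ^ d * 2 ^ a * ((M + M₀) * T ^ a * x ^ (-α)) *
                G ^ (2 * d + e + r) +
              C₀ * (2 * B) * 2 ^ a * ((M + M₀) * T ^ a * x ^ (-α)) * G ^ (2 * d + e + r) := by
              gcongr
          _ = (C₂ * (2 * B) * 64 ^ d * 2 ^ a + C₀ * (2 * B) * 2 ^ a) * (M + M₀) * T ^ a *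
                x ^ (-α) * G ^ (2 * d + e + r) := by ring
          _ ≤ _ := by
              gcongr
              linarith
    refine ⟨Q, hQd, hfin, fun _ => ?_⟩
    refine (hfin x ⟨by linarith, by linarith⟩).trans (le_of_eq ?_)
    simp [localGrowth]

theorem LocallyApproximable.mono {r : ℕ} {α b a τ M M' : ℝ} {f : ℝ → ℝ}
    (h : LocallyApproximable r α b a τ M f) (hM : M ≤ M') :
    LocallyApproximable r α b a τ M' f := by
  intro x hx σ hσ hτ
  obtain ⟨Q, hQ, hQu⟩ := h x hx σ hσ hτ
  refine ⟨Q, hQ, fun u hu => (hQu u hu).trans ?_⟩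
  have h1 := Real.rpow_nonneg hx.1.le (-α)
  have h2 : 0 ≤ (σ * x ^ (-b)) ^ a :=
    Real.rpow_nonneg (mul_nonneg hσ.1.le (Real.rpow_nonneg hx.1.le _)) _
  gcongr

/-! ### From local approximability to the error estimate. -/

/-- Direct estimate on the left half of the interval. -/
theorem exists_bernsteinStar_error_le {ψ : ℝ → ℝ} (hψ : IsCutoff ψ) {r : ℕ} (hr : 2 ≤ r)
    {nd : ℕ → ℕ → ℕ} {c : ℕ → ℕ → ℝ} (hc : IsCombination (r - 1) nd c) {α β b a M M₀ : ℝ}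
    (hα : 0 < α) (hβ : 0 < β) (hb : 0 ≤ b) (ha : 0 < a) (hM : 0 ≤ M) (hM₀ : 0 ≤ M₀) {f : ℝ → ℝ}
    (hf : WeightedBound α β M₀ f) (hLA : LocallyApproximable r α b a 0 M f) :
    ∃ C : ℝ, 0 ≤ C ∧ ∀ n : ℕ, 16 ≤ n → r + 1 ≤ n → ∀ x ∈ Ioc (0 : ℝ) (1 / 2),
      |f x - bernsteinStar ψ r nd c n f x| ≤ C * (localScale n x * x ^ (-b)) ^ a * x ^ (-α) := by
  obtain ⟨C₁, d, hC₁, h₁⟩ := exists_polynomial_localGrowth r (by omega) hα hβ hb ha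
  obtain ⟨C₂, hC₂, h₂⟩ := exists_norm_bernsteinComb_modFun_le hψ hr hc d
  refine ⟨C₁ * (M + M₀) + C₂ * (C₁ * (M + M₀)), by positivity, ?_⟩
  intro n hn hrn x hx
  have hn1 : 1 ≤ n := by omega
  have hs := localScale_pos hn1 x
  have hT : 0 ≤ localScale n x * x ^ (-b) := mul_nonneg hs.le (Real.rpow_nonneg hx.1.le _)
  obtain ⟨Q, hQd, hQ, hQx⟩ := h₁ f 0 M M₀ hM hM₀ hf hLA n hn x hx
    (fun _ => by rw [mul_zero]; positivity) hT
  have hTa := Real.rpow_nonneg hT a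
  have hy0 : 0 < max x (1 / (n : ℝ)) := hx.1.trans_le (le_max_left _ _)
  have hyx : (max x (1 / (n : ℝ))) ^ (-α) ≤ x ^ (-α) :=
    Real.rpow_le_rpow_of_nonpos hx.1 (le_max_left _ _) (by linarith)
  -- Only the centre of the disc is needed here: the error is (f - Q)(x) minus the real part of g at
  -- x.
  obtain ⟨g, -, hg, hgv⟩ := h₂ n hn hrn x hx.1 hx.2 f Q _ hQd (by positivity) hQ
  have h3 : |(g x).re| ≤ _ := (Complex.abs_re_le_norm _).trans (hg x (by simpa using hs.le))
  rw [hgv x, show f x - ((g x).re + Q.eval x) = (f x - Q.eval x) - (g x).re by ring]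
  refine (abs_sub _ _).trans ((add_le_add (hQx le_rfl) h3).trans ?_)
  calc _ ≤ C₁ * (M + M₀) * (localScale n x * x ^ (-b)) ^ a * x ^ (-α) +
        C₂ * (C₁ * (M + M₀) * (localScale n x * x ^ (-b)) ^ a * x ^ (-α)) := by gcongr
    _ = _ := by ring

/-! ### From the error estimate to local approximability. -/

/-- For fixed x the spread tends to 0 and loses at most a factor 2 from n to n+1. Taking the first n
≥ N whose successor falls below ρ therefore lands in [ρ, 2ρ]. -/
theorem exists_localScale_between {x ρ : ℝ} (h0 : 0 < x) (h1 : x ≤ 1) (hρ : 0 < ρ) {N : ℕ}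
    (hN : 1 ≤ N) (hρN : ρ ≤ localScale N x) :
    ∃ n, N ≤ n ∧ ρ ≤ localScale n x ∧ localScale n x ≤ 2 * ρ := by
  have hlim : Tendsto (fun n : ℕ => localScale n x) atTop (𝓝 0) := by
    have a1 := tendsto_const_div_atTop_nhds_zero_nat (x * (1 - x))
    have a2 := tendsto_const_div_atTop_nhds_zero_nat (1 : ℝ)
    have a3 := (Real.continuous_sqrt.tendsto 0).comp a1
    rw [Real.sqrt_zero] at a3
    simpa [localScale] using a3.add a2
  have hex : ∃ n, N ≤ n ∧ localScale (n + 1) x < ρ := by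
    have := ((tendsto_add_atTop_iff_nat 1).2 hlim).eventually (gt_mem_nhds hρ)
    obtain ⟨n, hn⟩ := (this.and (eventually_ge_atTop N)).exists
    exact ⟨n, hn.2, hn.1⟩
  classical
  obtain ⟨hn1, hn2⟩ := Nat.find_spec hex
  set n := Nat.find hex with hn
  have hpos : 1 ≤ n := hN.trans hn1
  have hnR : (1 : ℝ) ≤ n := by exact_mod_cast hpos
  refine ⟨n, hn1, ?_, ?_⟩
  · rcases eq_or_lt_of_le hn1 with h | h
    · rwa [← h]
    · by_contra! hlt
      have := Nat.find_min hex (m := n - 1) (by omega)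
      exact this ⟨by omega, by rwa [Nat.sub_add_cancel hpos]⟩
  · have hc : 0 ≤ x * (1 - x) := mul_nonneg h0.le (by linarith)
    have b1 : √(x * (1 - x) / n) ≤ 2 * √(x * (1 - x) / (n + 1)) := by
      have : (2 : ℝ) = √(2 ^ 2) := by rw [Real.sqrt_sq (by norm_num)]
      rw [this, ← Real.sqrt_mul (by norm_num)]
      apply Real.sqrt_le_sqrt
      rw [← mul_div_assoc, div_le_div_iff₀ (by linarith) (by linarith)]
      nlinarith
    have b2 : 1 / (n : ℝ) ≤ 2 * (1 / (n + 1)) := by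
      rw [← mul_div_assoc, div_le_div_iff₀ (by linarith) (by linarith)]
      linarith
    have : localScale n x ≤ 2 * localScale (n + 1) x := by
      unfold localScale; push_cast; linarith
    linarith

theorem WeightedBound.abs_le_of_near {α β M₀ : ℝ} {f : ℝ → ℝ} (hα : 0 < α) (hβ : 0 < β) (hM₀ : 0 ≤ M₀)
    (hf : WeightedBound α β M₀ f) {x u : ℝ} (hx : x ∈ Ioc (0 : ℝ) (1 / 2)) (hu : |u - x| ≤ x / 2) :
    |f u| ≤ 2 ^ α * 4 ^ β * M₀ * x ^ (-α) := by
  obtain ⟨h1, h2⟩ := abs_le.1 hu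
  obtain ⟨hx0, hx2⟩ := hx
  have a1 : u ^ (-α) ≤ 2 ^ α * x ^ (-α) := by
    rw [← div_two_rpow_neg hx0]
    exact Real.rpow_le_rpow_of_nonpos (by linarith) (by linarith) (by linarith)
  have a2 : (1 - u) ^ (-β) ≤ 4 ^ β := by
    have : (1 - u) ^ (-β) ≤ (1 / 4) ^ (-β) :=
      Real.rpow_le_rpow_of_nonpos (by norm_num) (by linarith) (by linarith)
    rwa [one_div, Real.inv_rpow (by norm_num), ← Real.rpow_neg (by norm_num), neg_neg] at this
  have hv1 : 0 ≤ (1 - u) ^ (-β) := Real.rpow_nonneg (by linarith) _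
  have hxα := Real.rpow_nonneg hx0.le (-α)
  calc |f u| ≤ M₀ * u ^ (-α) * (1 - u) ^ (-β) := hf u ⟨by linarith, by linarith⟩
    _ ≤ M₀ * (2 ^ α * x ^ (-α)) * 4 ^ β := by gcongr
    _ = _ := by ring

theorem localScale_le_of_abs_sub_le {n : ℕ} {x u : ℝ} (hx : x ∈ Ioc (0 : ℝ) (1 / 2))
    (hu : |u - x| ≤ x / 2) : localScale n u ≤ 2 * localScale n x := by
  obtain ⟨h1, h2⟩ := abs_le.1 hu
  obtain ⟨hx0, hx2⟩ := hx
  have b1 : √(u * (1 - u) / n) ≤ 2 * √(x * (1 - x) / n) := by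
    have : (2 : ℝ) = √(2 ^ 2) := by rw [Real.sqrt_sq (by norm_num)]
    rw [this, ← Real.sqrt_mul (by norm_num)]
    apply Real.sqrt_le_sqrt
    rw [← mul_div_assoc]
    refine div_le_div_of_nonneg_right ?_ (Nat.cast_nonneg n)
    nlinarith [sq_nonneg u, mul_le_mul_of_nonneg_left hx2 hx0.le]
  unfold localScale
  have : 0 ≤ 1 / (n : ℝ) := by positivity
  linarith

/-- Relation between the normalized kernel scale and the scale `1/n`. -/
theorem localScale_mul_rpow_le {n : ℕ} (hn : 1 ≤ n) {x b : ℝ} (hnx : 1 / (n : ℝ) ≤ x) (hx : x ≤ 1)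
    (hb : 1 / 2 ≤ b) : localScale n x * x ^ (-b) ≤ 2 * (1 / (n : ℝ)) ^ (1 - b) := by
  have hnR : (0 : ℝ) < n := by positivity
  have hd : 0 < 1 / (n : ℝ) := by positivity
  have hx0 : 0 < x := hd.trans_le hnx
  have h1 := localScale_sq_le hnx hx hn
  refine abs_le_of_sq_le_sq' ?_ (by positivity) |>.2
  have e1 : (x ^ (-b)) ^ 2 = x ^ (-1 : ℝ) * x ^ (1 - 2 * b) := by
    rw [← Real.rpow_natCast, ← Real.rpow_mul hx0.le, ← Real.rpow_add hx0]
    congr 1; push_cast; ring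
  have e2 : ((1 / (n : ℝ)) ^ (1 - b)) ^ 2 = (1 / n) * (1 / (n : ℝ)) ^ (1 - 2 * b) := by
    nth_rewrite 2 [← Real.rpow_one (1 / (n : ℝ))]
    rw [← Real.rpow_natCast, ← Real.rpow_mul hd.le, ← Real.rpow_add hd]
    congr 1; push_cast; ring
  -- The squared left side is at most (4/n) x^{1-2b}. Because b ≥ 1/2 this exponent is nonpositive,
  -- and x may be replaced by its lower bound 1/n.
  have h2 : x ^ (1 - 2 * b) ≤ (1 / (n : ℝ)) ^ (1 - 2 * b) :=
    Real.rpow_le_rpow_of_nonpos hd hnx (by linarith)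
  have h3 : localScale n x ^ 2 ≤ 4 * x * (1 / n) := by
    rw [mul_one_div, le_div_iff₀ hnR]; linarith
  rw [mul_pow, mul_pow, e1, e2, Real.rpow_neg_one]
  calc localScale n x ^ 2 * (x⁻¹ * x ^ (1 - 2 * b))
      ≤ 4 * x * (1 / n) * (x⁻¹ * (1 / (n : ℝ)) ^ (1 - 2 * b)) := by gcongr
    _ = 2 ^ 2 * (1 / n * (1 / (n : ℝ)) ^ (1 - 2 * b)) := by field_simp; norm_num

theorem exists_large_rpow_le {a r A ε : ℝ} (har : a < r) (hε : 0 < ε) :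
    ∃ B : ℝ, 4 ≤ B ∧ A * (B ^ a * B ^ (-r)) ≤ ε := by
  have h := (tendsto_rpow_neg_atTop (sub_pos.2 har)).const_mul A
  rw [mul_zero] at h
  obtain ⟨B, hB, hB4⟩ := ((h.eventually (gt_mem_nhds hε)).and (eventually_ge_atTop 4)).exists
  refine ⟨B, hB4, ?_⟩
  rw [← Real.rpow_add (by linarith), show a + -r = -(r - a) by ring]
  exact hB.le

set_option maxHeartbeats 800000 in
/-- One step of the inverse estimate: improving the constant in the local approximation at the
expense of the truncation parameter. -/
theorem exists_improvement {ψ : ℝ → ℝ} (hψ : IsCutoff ψ) {r : ℕ} (hr : 2 ≤ r)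
    {nd : ℕ → ℕ → ℕ} {c : ℕ → ℕ → ℝ} (hc : IsCombination (r - 1) nd c) {α β b a C₀ M₀ : ℝ}
    (hα : 0 < α) (hβ : 0 < β) (hb : 1 / 2 ≤ b) (ha : 0 < a) (har : a < r) (hC₀ : 0 ≤ C₀)
    (hM₀ : 0 ≤ M₀) {f : ℝ → ℝ} (hf : WeightedBound α β M₀ f) {N : ℕ}
    (hB : ∀ n : ℕ, N ≤ n → ∀ u ∈ Ioc (0 : ℝ) (3 / 4), |f u - bernsteinStar ψ r nd c n f u| ≤
      C₀ * (localScale n u * u ^ (-b)) ^ a * u ^ (-α)) {θ : ℝ} (hθ : 0 < θ) :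
    ∃ D : ℝ, 0 ≤ D ∧ ∀ M τ : ℝ, 0 ≤ M → 0 < τ → LocallyApproximable r α b a (τ / 4) M f →
      LocallyApproximable r α b a τ (D + θ * M) f := by
  obtain ⟨C₁, d, hC₁, h₁⟩ :=
    exists_polynomial_localGrowth r (by omega) hα hβ (by linarith : 0 ≤ b) ha
  obtain ⟨C₂, hC₂, h₂⟩ := exists_norm_bernsteinComb_modFun_le hψ hr hc d
  -- B is the ratio between kernel scale and target radius. The Taylor step gains B^{-r} and the
  -- larger scale costs B^a, so a < r permits any prescribed θ.
  obtain ⟨B, hB4, hBθ⟩ := exists_large_rpow_le (A := C₂ * C₁ * 2 ^ a * 2 ^ r) har hθ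
  set N' := max N (max 16 (r + 1)) with hN'
  have hB0 : 0 < B := by linarith
  have hN'1 : 1 ≤ N' := by omega
  set D₁ := C₀ * (2 ^ α * (2 * 2 ^ b * (2 * B)) ^ a) with hD₁
  set D₂ := 2 ^ α * 4 ^ β * M₀ * (N' * B) ^ a with hD₂
  have hD₁0 : 0 ≤ D₁ := by positivity
  have hD₂0 : 0 ≤ D₂ := by positivity
  refine ⟨D₁ + D₂ + θ * M₀, by positivity, ?_⟩
  intro M τ hM hτ hLA x hx σ hσ hτσ
  have hx0 := hx.1
  have hσ0 := hσ.1
  have hxb := Real.rpow_pos_of_pos hx0 (-b)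
  have hxα := Real.rpow_pos_of_pos hx0 (-α)
  set t := σ * x ^ (-b) with ht
  have ht0 : 0 < t := by positivity
  have hta := Real.rpow_pos_of_pos ht0 a
  have hN'R : (0 : ℝ) < N' := by exact_mod_cast hN'1
  -- Radii small enough to be matched by some n ≥ N' are treated by the operator; for all others σ
  -- is bounded below.
  rcases le_or_gt (B * σ) (localScale N' x) with hcase | hcase
  · obtain ⟨n, hn, hs1, hs2⟩ := exists_localScale_between hx0 (by linarith [hx.2])
      (by positivity) hN'1 hcase
    have hnN : N ≤ n := (le_max_left _ _).trans hn
    have hn16 : 16 ≤ n := ((le_max_left _ _).trans (le_max_right _ _)).trans hn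
    have hnr : r + 1 ≤ n := ((le_max_right _ _).trans (le_max_right _ _)).trans hn
    have hn1 : 1 ≤ n := by omega
    have hd0 : 0 < 1 / (n : ℝ) := by positivity
    set s := localScale n x with hs
    have hs0 : 0 < s := localScale_pos hn1 x
    have hTt : B * t ≤ s * x ^ (-b) := by
      rw [ht, ← mul_assoc]; gcongr
    have hTt2 : s * x ^ (-b) ≤ 2 * B * t := by
      rw [ht, ← mul_assoc]; gcongr; linarith
    have hT0 : 0 ≤ s * x ^ (-b) := by positivity
    have hTa : (s * x ^ (-b)) ^ a ≤ 2 ^ a * B ^ a * t ^ a := by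
      rw [← Real.mul_rpow (by norm_num) hB0.le, ← Real.mul_rpow (by positivity) ht0.le]
      exact Real.rpow_le_rpow hT0 hTt2 ha.le
    -- The truncation condition at scale 1/n must be checked. For x ≥ 1/n it follows from Bt ≤ s
    -- x^{-b} ≤ 2(1/n)^{1-b}; for x < 1/n from σ ≤ x/2.
    obtain ⟨Q, hQd, hQ, -⟩ := h₁ f (τ / 4) M M₀ hM hM₀ hf hLA n hn16 x hx (by
        intro hb1
        rcases le_or_gt (1 / (n : ℝ)) x with h | h
        · have := localScale_mul_rpow_le hn1 h (by linarith [hx.2]) hb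
          nlinarith
        · have h3 : x ^ (1 - b) ≤ (1 / (n : ℝ)) ^ (1 - b) :=
            Real.rpow_le_rpow hx0.le h.le (by linarith)
          have h4 : x ^ (1 - b) = x * x ^ (-b) := by
            rw [sub_eq_add_neg, Real.rpow_add hx0, Real.rpow_one]
          have h5 : t ≤ x * x ^ (-b) := by
            rw [ht]; gcongr; linarith [hσ.2]
          linarith) (by nlinarith)
    set y := max x (1 / (n : ℝ)) with hy
    have hy0 : 0 < y := hx0.trans_le (le_max_left _ _)
    have hyx : y ^ (-α) ≤ x ^ (-α) :=
      Real.rpow_le_rpow_of_nonpos hx0 (le_max_left _ _) (by linarith)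
    obtain ⟨g, hgd, hg, hgv⟩ := h₂ n hn16 hnr x hx0 hx.2 f Q _ hQd (by positivity) hQ
    obtain ⟨P, hPd, hP⟩ := exists_polynomial_approx_of_norm_le r hs0 g _ hgd
      fun z hz => hg z (by rw [Metric.mem_ball, dist_eq_norm] at hz; exact hz.le)
    refine ⟨P + Q, (Polynomial.degree_add_le _ _).trans_lt (max_lt hPd hQd), fun u hu => ?_⟩
    have hux : |u - x| ≤ x / 2 := hu.trans hσ.2
    obtain ⟨hu1, hu2⟩ := abs_le.1 hux
    have hu0 : 0 < u := by linarith
    have hus : |u - x| < s := by nlinarith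
    have e1 := hB n hnN u ⟨hu0, by linarith [hx.2]⟩
    have e2 := hP u hus
    have f1 : |f u - bernsteinStar ψ r nd c n f u| ≤ D₁ * x ^ (-α) * t ^ a := by
      refine e1.trans ?_
      have g1 : u ^ (-α) ≤ 2 ^ α * x ^ (-α) := by
        rw [← div_two_rpow_neg hx0]
        exact Real.rpow_le_rpow_of_nonpos (by linarith) (by linarith) (by linarith)
      have g2 : u ^ (-b) ≤ 2 ^ b * x ^ (-b) := by
        rw [← div_two_rpow_neg hx0]
        exact Real.rpow_le_rpow_of_nonpos (by linarith) (by linarith) (by linarith)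
      have g3 := localScale_le_of_abs_sub_le (n := n) hx hux
      have hub := Real.rpow_pos_of_pos hu0 (-b)
      have hus0 := localScale_pos hn1 u
      have g4 : localScale n u * u ^ (-b) ≤ 2 * 2 ^ b * (2 * B) * t := by
        calc localScale n u * u ^ (-b) ≤ (2 * s) * (2 ^ b * x ^ (-b)) := by gcongr
          _ = 2 * 2 ^ b * (s * x ^ (-b)) := by ring
          _ ≤ 2 * 2 ^ b * (2 * B * t) := by gcongr
          _ = _ := by ring
      have g5 : (localScale n u * u ^ (-b)) ^ a ≤ (2 * 2 ^ b * (2 * B)) ^ a * t ^ a := by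
        rw [← Real.mul_rpow (by positivity) ht0.le]
        exact Real.rpow_le_rpow (by positivity) g4 ha.le
      calc _ ≤ C₀ * ((2 * 2 ^ b * (2 * B)) ^ a * t ^ a) * (2 ^ α * x ^ (-α)) := by gcongr
        _ = _ := by rw [hD₁]; ring
    -- The contraction: on |u-x| ≤ σ ≤ s/B the Taylor remainder has the factor (2/B)^r, against
    -- (2B)^a from measuring the error at scale s instead of σ.
    have f2 : |(g u).re - P.eval u| ≤ θ * (M + M₀) * x ^ (-α) * t ^ a := by
      refine e2.trans ?_
      have g1 : 2 * |u - x| / s ≤ 2 * B⁻¹ := by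
        rw [div_le_iff₀ hs0]
        have : σ ≤ B⁻¹ * s := by rwa [inv_mul_eq_div, le_div_iff₀' hB0]
        linarith
      have g2 : (2 * |u - x| / s) ^ r ≤ 2 ^ r * B ^ (-(r : ℝ)) := by
        rw [Real.rpow_neg hB0.le, Real.rpow_natCast, ← inv_pow, ← mul_pow]
        exact pow_le_pow_left₀ (by positivity) g1 r
      calc _ ≤ C₂ * (C₁ * (M + M₀) * (2 ^ a * B ^ a * t ^ a) * x ^ (-α)) *
            (2 ^ r * B ^ (-(r : ℝ))) := by gcongr
        _ = C₂ * C₁ * 2 ^ a * 2 ^ r * (B ^ a * B ^ (-(r : ℝ))) *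
            ((M + M₀) * x ^ (-α) * t ^ a) := by ring
        _ ≤ θ * ((M + M₀) * x ^ (-α) * t ^ a) := by gcongr
        _ = _ := by ring
    rw [Polynomial.eval_add, show f u - (P.eval u + Q.eval u) =
      (f u - bernsteinStar ψ r nd c n f u) + ((g u).re - P.eval u) by rw [hgv u]; ring]
    refine (abs_add_le _ _).trans ((add_le_add f1 f2).trans ?_)
    have : 0 ≤ D₂ * x ^ (-α) * t ^ a := by positivity
    nlinarith
  -- Here σ ≥ 1/(N'B), so t is bounded below and the size bound on f is already of the required
  -- form.
  · refine ⟨0, by simp, fun u hu => ?_⟩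
    have h1 := hf.abs_le_of_near hα hβ hM₀ hx (hu.trans hσ.2)
    rw [Polynomial.eval_zero, sub_zero]
    have h2 : 1 ≤ N' * B * t := by
      have a1 : 1 / (N' : ℝ) ≤ B * σ := (one_div_le_localScale N' x).trans hcase.le
      have a2 : 1 ≤ x ^ (-b) :=
        Real.one_le_rpow_of_pos_of_le_one_of_nonpos hx0 (by linarith [hx.2]) (by linarith)
      have a3 : σ ≤ t := le_mul_of_one_le_right hσ0.le a2
      rw [div_le_iff₀' hN'R] at a1
      calc 1 ≤ N' * (B * σ) := a1
        _ ≤ N' * (B * t) := by gcongr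
        _ = _ := by ring
    have h3 : 1 ≤ (N' * B) ^ a * t ^ a := by
      rw [← Real.mul_rpow (by positivity) ht0.le]
      exact Real.one_le_rpow h2 ha.le
    calc |f u| ≤ 2 ^ α * 4 ^ β * M₀ * x ^ (-α) * 1 := by rw [mul_one]; exact h1
      _ ≤ 2 ^ α * 4 ^ β * M₀ * x ^ (-α) * ((N' * B) ^ a * t ^ a) := by gcongr
      _ = D₂ * x ^ (-α) * t ^ a := by rw [hD₂]; ring
      _ ≤ _ := by
        gcongr
        have : 0 ≤ θ * M₀ := by positivity
        have : 0 ≤ θ * M := by positivity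
        linarith

/-- Inverse estimate on the left half of the interval. -/
theorem exists_locallyApproximable_of_error_le {ψ : ℝ → ℝ} (hψ : IsCutoff ψ) {r : ℕ} (hr : 2 ≤ r)
    {nd : ℕ → ℕ → ℕ} {c : ℕ → ℕ → ℝ} (hc : IsCombination (r - 1) nd c) {α β b a C₀ M₀ : ℝ}
    (hα : 0 < α) (hβ : 0 < β) (hb : 1 / 2 ≤ b) (ha : 0 < a) (har : a < r) (hC₀ : 0 ≤ C₀)
    (hM₀ : 0 ≤ M₀) {f : ℝ → ℝ} (hf : WeightedBound α β M₀ f) {N : ℕ}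
    (hB : ∀ n : ℕ, N ≤ n → ∀ u ∈ Ioc (0 : ℝ) (3 / 4), |f u - bernsteinStar ψ r nd c n f u| ≤
      C₀ * (localScale n u * u ^ (-b)) ^ a * u ^ (-α)) :
    ∃ M : ℝ, 0 ≤ M ∧ LocallyApproximable r α b a 0 M f := by
  have h4a : 1 ≤ (4 : ℝ) ^ a := Real.one_le_rpow (by norm_num) ha.le
  -- Replacing τ by τ/4 multiplies the starting constant M₁ τ^{-a} by 4^a; with this θ each round
  -- still halves it.
  set θ : ℝ := ((4 : ℝ) ^ a)⁻¹ / 2 with hθ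
  have hθ0 : 0 < θ := by positivity
  have hθ1 : θ ≤ 1 / 2 := by
    have := inv_le_one_of_one_le₀ h4a
    rw [hθ]; linarith
  have hθ4 : θ * 4 ^ a = 1 / 2 := by rw [hθ]; field_simp
  obtain ⟨D, hD, hstep⟩ := exists_improvement hψ hr hc hα hβ hb ha har hC₀ hM₀ hf hB hθ0
  set M₁ := 2 ^ α * 4 ^ β * M₀ with hM₁
  have hM₁0 : 0 ≤ M₁ := by positivity
  have claim : ∀ k : ℕ, ∀ τ : ℝ, 0 < τ →
      LocallyApproximable r α b a τ (2 * D + (1 / 2) ^ k * (M₁ * τ ^ (-a))) f := by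
    intro k
    induction k with
    | zero =>
      intro τ hτ x hx σ hσ hτσ
      refine ⟨0, by simp, fun u hu => ?_⟩
      have h1 := hf.abs_le_of_near hα hβ hM₀ hx (hu.trans hσ.2)
      have hxα := Real.rpow_pos_of_pos hx.1 (-α)
      have h2 : 1 ≤ τ ^ (-a) * (σ * x ^ (-b)) ^ a := by
        rw [Real.rpow_neg hτ.le, ← div_eq_inv_mul, one_le_div (by positivity)]
        exact Real.rpow_le_rpow hτ.le hτσ ha.le
      have h3 : 0 ≤ (σ * x ^ (-b)) ^ a :=
        Real.rpow_nonneg (mul_nonneg hσ.1.le (Real.rpow_nonneg hx.1.le _)) _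
      rw [Polynomial.eval_zero, sub_zero, pow_zero, one_mul]
      calc |f u| ≤ M₁ * x ^ (-α) * 1 := by rw [mul_one]; exact h1
        _ ≤ M₁ * x ^ (-α) * (τ ^ (-a) * (σ * x ^ (-b)) ^ a) := by gcongr
        _ = M₁ * τ ^ (-a) * x ^ (-α) * (σ * x ^ (-b)) ^ a := by ring
        _ ≤ _ := by gcongr; linarith
    | succ k ih =>
      intro τ hτ
      have hτa : 0 < τ ^ (-a) := Real.rpow_pos_of_pos hτ _
      have e : (τ / 4) ^ (-a) = 4 ^ a * τ ^ (-a) := by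
        rw [Real.div_rpow hτ.le (by norm_num), Real.rpow_neg (by norm_num : (0 : ℝ) ≤ 4),
          div_inv_eq_mul, mul_comm]
      have h1 := ih (τ / 4) (by linarith)
      rw [e] at h1
      refine (hstep _ τ (by positivity) hτ h1).mono ?_
      have e2 : θ * (2 * D + (1 / 2) ^ k * (M₁ * (4 ^ a * τ ^ (-a)))) =
          θ * 2 * D + (θ * 4 ^ a) * ((1 / 2) ^ k * (M₁ * τ ^ (-a))) := by ring
      rw [e2, hθ4, pow_succ]
      nlinarith
  -- The rate at which the second term decays depends on τ. So fix x and σ, take τ equal to their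
  -- normalized radius, and iterate until that term is below 1.
  refine ⟨2 * D + 1, by linarith, ?_⟩
  intro x hx σ hσ _
  have ht : 0 < σ * x ^ (-b) := mul_pos hσ.1 (Real.rpow_pos_of_pos hx.1 _)
  have hlim : Tendsto (fun k : ℕ => (1 / 2 : ℝ) ^ k * (M₁ * (σ * x ^ (-b)) ^ (-a))) atTop
      (𝓝 (0 * (M₁ * (σ * x ^ (-b)) ^ (-a)))) :=
    (tendsto_pow_atTop_nhds_zero_of_lt_one (by norm_num) (by norm_num)).mul_const _
  rw [zero_mul] at hlim
  obtain ⟨k, hk⟩ := (hlim.eventually (gt_mem_nhds one_pos)).exists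
  exact ((claim k _ ht).mono (by linarith)) x hx σ hσ le_rfl

/-! ### A Whitney inequality by iterated averages. -/

/-- The `k`-fold iterate of the averaging operator `g ↦ ∫_0^1 g(· + v) dv`. -/
noncomputable def iterAvg : ℕ → (ℝ → ℝ) → ℝ → ℝ
  | 0, g => g
  | k + 1, g => fun θ => ∫ v in (0 : ℝ)..1, iterAvg k g (θ + v)

theorem continuous_iterAvg (k : ℕ) {g : ℝ → ℝ} (hg : Continuous g) :
    Continuous (iterAvg k g) := by
  induction k with
  | zero => exact hg
  | succ k ih =>
    exact intervalIntegral.continuous_parametric_intervalIntegral_of_continuous'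
      (f := fun θ v => iterAvg k g (θ + v)) (ih.comp (continuous_fst.add continuous_snd)) 0 1

theorem iterAvg_sum (k : ℕ) {ι : Type*} (s : Finset ι) (c : ι → ℝ) (g : ι → ℝ → ℝ)
    (hg : ∀ i ∈ s, Continuous (g i)) (θ : ℝ) :
    iterAvg k (fun x => ∑ i ∈ s, c i * g i x) θ = ∑ i ∈ s, c i * iterAvg k (g i) θ := by
  induction k generalizing θ with
  | zero => rfl
  | succ k ih =>
    simp only [iterAvg, ih]
    rw [intervalIntegral.integral_finsetSum]
    · simp only [intervalIntegral.integral_const_mul]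
    · intro i hi
      exact (((continuous_iterAvg k (hg i hi)).comp (continuous_const.add
        continuous_id)).const_mul _).intervalIntegrable _ _

theorem iterAvg_const (k : ℕ) (a θ : ℝ) : iterAvg k (fun _ => a) θ = a := by
  induction k generalizing θ with
  | zero => rfl
  | succ k ih => simp [iterAvg, ih]

theorem iterAvg_shift (k : ℕ) (g : ℝ → ℝ) (δ θ : ℝ) :
    iterAvg k (fun x => g (x + δ)) θ = iterAvg k g (θ + δ) := by
  induction k generalizing θ with
  | zero => rfl
  | succ k ih => simp only [iterAvg, ih, add_right_comm θ]

theorem abs_iterAvg_le (k : ℕ) {g : ℝ → ℝ} {ε θ : ℝ}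
    (h : ∀ x ∈ Icc θ (θ + k), |g x| ≤ ε) : |iterAvg k g θ| ≤ ε := by
  induction k generalizing θ with
  | zero => exact h θ (by simp)
  | succ k ih =>
    have := intervalIntegral.norm_integral_le_of_norm_le_const (a := 0) (b := 1) (C := ε)
      (f := fun v => iterAvg k g (θ + v)) (by
        intro v hv
        rw [uIoc_of_le zero_le_one] at hv
        refine ih fun x hx => h x ⟨by linarith [hx.1, hv.1], ?_⟩
        push_cast
        linarith [hx.2, hv.2])
    rw [sub_zero, abs_one, mul_one] at this
    exact this

/-- Each average trades a derivative for a unit forward difference, so small k-th differences make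
the k-fold average nearly polynomial. -/
theorem hasDerivAt_iterAvg_succ (k : ℕ) {g : ℝ → ℝ} (hg : Continuous g) (θ : ℝ) :
    HasDerivAt (iterAvg (k + 1) g) (iterAvg k (fwdDiff 1 g) θ) θ := by
  have hc := continuous_iterAvg k hg
  have e1 : iterAvg (k + 1) g = fun θ => (∫ v in (0 : ℝ)..(θ + 1), iterAvg k g v) -
      ∫ v in (0 : ℝ)..θ, iterAvg k g v := by
    funext θ
    rw [intervalIntegral.integral_interval_sub_left (hc.intervalIntegrable _ _)
      (hc.intervalIntegrable _ _)]
    simp only [iterAvg]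
    rw [intervalIntegral.integral_comp_add_left, add_zero]
  have e2 : iterAvg k (fwdDiff 1 g) θ = iterAvg k g (θ + 1) - iterAvg k g θ := by
    have h := iterAvg_sum k (Finset.univ : Finset (Fin 2)) ![1, -1] ![fun x => g (x + 1), g]
      (by
        intro i _
        fin_cases i
        · exact hg.comp (continuous_id.add continuous_const)
        · exact hg) θ
    simp only [Fin.sum_univ_two, Matrix.cons_val_zero, Matrix.cons_val_one, one_mul, neg_mul,
      ← sub_eq_add_neg, iterAvg_shift] at h
    exact h
  rw [e1, e2]
  refine HasDerivAt.sub ?_ (intervalIntegral.integral_hasDerivAt_right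
    (hc.intervalIntegrable _ _) (hc.stronglyMeasurableAtFilter _ _) hc.continuousAt)
  exact (intervalIntegral.integral_hasDerivAt_right (hc.intervalIntegrable _ _)
    (hc.stronglyMeasurableAtFilter _ _) hc.continuousAt).comp_add_const θ 1

open Polynomial in
theorem exists_derivative_eq {k : ℕ} {p : ℝ[X]} (hp : p.degree < k) :
    ∃ P : ℝ[X], derivative P = p ∧ P.degree < (k + 1 : ℕ) := by
  refine ⟨∑ j ∈ Finset.range k, monomial (j + 1) (p.coeff j / (j + 1)), ?_, ?_⟩
  · ext m
    simp only [map_sum, derivative_monomial, finsetSum_coeff, coeff_monomial, Nat.add_sub_cancel]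
    rw [Finset.sum_ite_eq' (Finset.range k) m]
    split_ifs with h
    · push_cast
      field_simp
    · rw [Finset.mem_range, not_lt] at h
      exact (coeff_eq_zero_of_degree_lt (hp.trans_le (by exact_mod_cast h))).symm
  · rw [← mem_degreeLT]
    refine Submodule.sum_mem _ fun j hj => ?_
    rw [mem_degreeLT]
    refine (degree_monomial_le _ _).trans_lt ?_
    rw [Finset.mem_range] at hj
    exact_mod_cast (by omega : j + 1 < k + 1)

/-- Iterated averages of a function with small differences are close to polynomials. -/
theorem exists_polynomial_near_iterAvg (k : ℕ) {g : ℝ → ℝ} (hg : Continuous g) {A B ε : ℝ}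
    (hAB : A ≤ B) (h : ∀ θ ∈ Icc A B, |(fwdDiff 1)^[k] g θ| ≤ ε) :
    ∃ p : Polynomial ℝ, p.degree < k ∧
      ∀ θ ∈ Icc A B, |iterAvg k g θ - p.eval θ| ≤ (B - A) ^ k * ε := by
  induction k generalizing g with
  | zero => exact ⟨0, by simp, fun θ hθ => by simpa [iterAvg] using h θ hθ⟩
  | succ k ih =>
    have hg' : Continuous (fwdDiff 1 g) :=
      (hg.comp (continuous_id.add continuous_const)).sub hg
    obtain ⟨p, hp, hpθ⟩ := ih hg' h
    obtain ⟨P, hP, hPd⟩ := exists_derivative_eq hp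
    -- Integrating the polynomial near the derivative and matching values at A, the mean value
    -- inequality costs one factor B - A.
    set c := iterAvg (k + 1) g A - P.eval A
    have hε : 0 ≤ ε := (abs_nonneg _).trans (h A ⟨le_rfl, hAB⟩)
    have hBA : 0 ≤ B - A := by linarith
    refine ⟨P + Polynomial.C c, ?_, fun θ hθ => ?_⟩
    · refine (Polynomial.degree_add_le _ _).trans_lt (max_lt hPd
        (Polynomial.degree_C_le.trans_lt ?_))
      exact_mod_cast Nat.succ_pos k
    · have := norm_image_sub_le_of_norm_deriv_le_segment' (a := A) (b := B)
        (f := fun θ => iterAvg (k + 1) g θ - P.eval θ) (C := (B - A) ^ k * ε)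
        (fun θ _ => ((hasDerivAt_iterAvg_succ k hg θ).sub (P.hasDerivAt θ)).hasDerivWithinAt)
        (fun θ hθ => by rw [hP]; exact hpθ θ ⟨hθ.1, hθ.2.le⟩) θ hθ
      rw [Real.norm_eq_abs] at this
      rw [Polynomial.eval_add, Polynomial.eval_C, ← sub_sub, pow_succ]
      refine this.trans ?_
      calc (B - A) ^ k * ε * (θ - A) ≤ (B - A) ^ k * ε * (B - A) := by
            gcongr
            exact hθ.2
        _ = _ := by ring

theorem fwdDiff_iter_eq_sum (r : ℕ) (h : ℝ) (F : ℝ → ℝ) (y : ℝ) :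
    (fwdDiff h)^[r] F y =
      ∑ i ∈ Finset.range (r + 1), (-1) ^ (r - i) * (r.choose i : ℝ) * F (y + i * h) := by
  rw [fwdDiff_iter_eq_sum_shift]
  refine Finset.sum_congr rfl fun i _ => ?_
  rw [zsmul_eq_mul, nsmul_eq_mul]
  push_cast
  ring

theorem fwdDiff_iter_zero_step {r : ℕ} (hr : 1 ≤ r) (F : ℝ → ℝ) (y : ℝ) :
    (fwdDiff (0 : ℝ))^[r] F y = 0 := by
  obtain ⟨k, rfl⟩ : ∃ k, r = k + 1 := ⟨r - 1, by omega⟩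
  rw [Function.iterate_succ_apply']
  simp [fwdDiff]

/-- A Whitney type inequality. -/
theorem exists_whitney_bound (r : ℕ) (hr : 1 ≤ r) {κ : ℝ} (hκ : 0 < κ) :
    ∃ C : ℝ, 0 < C ∧ ∀ (F : ℝ → ℝ) (x σ ε : ℝ), Continuous F → 0 < σ →
      (∀ y, |y - x| ≤ σ → ∀ h ∈ Ioc 0 (κ * σ), |(fwdDiff h)^[r] F y| ≤ ε) →
      ∃ Q : Polynomial ℝ, Q.degree < r ∧ ∀ u, |u - x| ≤ σ → |F u - Q.eval u| ≤ C * ε := by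
  have hrR : (1 : ℝ) ≤ r := by exact_mod_cast hr
  have hr0 : (0 : ℝ) < r := by linarith
  refine ⟨1 + ∑ i ∈ Finset.range r, (r.choose (i + 1) : ℝ) * (2 * r / κ) ^ r, ?_, ?_⟩
  · have : 0 ≤ ∑ i ∈ Finset.range r, (r.choose (i + 1) : ℝ) * (2 * r / κ) ^ r :=
      Finset.sum_nonneg fun _ _ => by positivity
    linarith
  intro F x σ ε hF hσ hd
  have hε : 0 ≤ ε := (abs_nonneg _).trans (hd x (by simpa using hσ.le) (κ * σ) ⟨by positivity, le_rfl⟩)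
  -- The r-fold average runs over θ in [0, r], so this choice keeps every step θh at most κσ.
  set h := κ * σ / r with hh
  have hh0 : 0 < h := by positivity
  have hrh : r * h = κ * σ := by rw [hh]; field_simp
  -- Averaging the r-th difference at u over its step leaves F(u) in the term without shift. Every
  -- other term is an r-fold average of F at step m = (i+1)h, and after rescaling by m such an
  -- average is nearly polynomial in u.
  have hp : ∀ i ∈ Finset.range r, ∃ p : Polynomial ℝ, p.degree < r ∧
      ∀ u, |u - x| ≤ σ → |iterAvg r (fun θ => F (u + (i + 1 : ℕ) * (θ * h))) 0 - p.eval u| ≤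
        (2 * r / κ) ^ r * ε := by
    intro i hi
    set m : ℝ := ((i + 1 : ℕ) : ℝ) * h with hm
    have hi1 : (1 : ℝ) ≤ ((i + 1 : ℕ) : ℝ) := by exact_mod_cast (by omega : 1 ≤ i + 1)
    have hi2 : ((i + 1 : ℕ) : ℝ) ≤ r := by
      exact_mod_cast (by have := Finset.mem_range.1 hi; omega : i + 1 ≤ r)
    have hm0 : 0 < m := by positivity
    have hmκ : m ≤ κ * σ := by rw [← hrh, hm]; gcongr
    have hG : Continuous fun θ => F (θ * m) := hF.comp (continuous_id.mul continuous_const)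
    obtain ⟨p, hpd, hp⟩ := exists_polynomial_near_iterAvg r hG (A := (x - σ) / m)
      (B := (x + σ) / m) (ε := ε) (by gcongr; linarith) (by
        intro θ hθ
        rw [fwdDiff_iter_eq_sum]
        have := hd (θ * m) (by
          rw [abs_le]
          have h1 := hθ.1
          have h2 := hθ.2
          rw [div_le_iff₀ hm0] at h1
          rw [le_div_iff₀ hm0] at h2
          constructor <;> linarith) m ⟨hm0, hmκ⟩
        rw [fwdDiff_iter_eq_sum] at this
        convert this using 4
        ring_nf)
    refine ⟨p.comp (Polynomial.C m⁻¹ * Polynomial.X), ?_, fun u hu => ?_⟩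
    · rcases eq_or_ne p 0 with h0 | h0
      · rw [h0, Polynomial.zero_comp, Polynomial.degree_zero]
        exact WithBot.bot_lt_coe r
      · have h1 := (Polynomial.natDegree_lt_iff_degree_lt h0).2 hpd
        refine Polynomial.degree_le_natDegree.trans_lt ?_
        rw [Polynomial.natDegree_comp, Polynomial.natDegree_C_mul_X _ (by positivity), mul_one]
        exact_mod_cast h1
    · obtain ⟨h1, h2⟩ := abs_le.1 hu
      have h3 := hp (u / m) ⟨by gcongr; linarith, by gcongr; linarith⟩
      have e1 : (fun θ => F (u + (i + 1 : ℕ) * (θ * h))) = fun θ => F ((θ + u / m) * m) := by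
        funext θ
        congr 1
        rw [add_mul, div_mul_cancel₀ _ hm0.ne', hm]; ring
      rw [e1, iterAvg_shift r (fun θ => F (θ * m)), zero_add, Polynomial.eval_comp]
      simp only [Polynomial.eval_mul, Polynomial.eval_C, Polynomial.eval_X]
      rw [inv_mul_eq_div]
      refine h3.trans ?_
      have e2 : (x + σ) / m - (x - σ) / m ≤ 2 * r / κ := by
        rw [← sub_div, div_le_div_iff₀ hm0 hκ]
        have : h ≤ m := le_mul_of_one_le_left hh0.le hi1
        nlinarith
      have e3 : 0 ≤ (x + σ) / m - (x - σ) / m := by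
        rw [← sub_div]; apply div_nonneg _ hm0.le; linarith
      gcongr
  choose! p hpd hp using hp
  -- Q solves the averaged difference for F(u), whose coefficient there is (-1)^r.
  refine ⟨∑ i ∈ Finset.range r,
    Polynomial.C (-((-1) ^ r * ((-1) ^ (r - (i + 1)) * (r.choose (i + 1) : ℝ)))) * p i, ?_, ?_⟩
  · rw [← Polynomial.mem_degreeLT]
    refine Submodule.sum_mem _ fun i hi => ?_
    rw [← Polynomial.smul_eq_C_mul]
    exact Submodule.smul_mem _ _ (Polynomial.mem_degreeLT.2 (hpd i hi))
  · intro u hu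
    have hcont : ∀ i : ℕ, Continuous fun θ => F (u + i * (θ * h)) := fun i =>
      hF.comp (continuous_const.add (continuous_const.mul (continuous_id.mul continuous_const)))
    have h1 : |iterAvg r (fun θ => ∑ i ∈ Finset.range (r + 1),
        ((-1) ^ (r - i) * (r.choose i : ℝ)) * F (u + i * (θ * h))) 0| ≤ ε := by
      refine abs_iterAvg_le r fun θ hθ => ?_
      rw [zero_add] at hθ
      rw [← fwdDiff_iter_eq_sum]
      rcases eq_or_lt_of_le hθ.1 with h0 | h0
      · rw [← h0, zero_mul, fwdDiff_iter_zero_step hr, abs_zero]; exact hε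
      · refine hd u hu _ ⟨by positivity, ?_⟩
        rw [← hrh]; gcongr; exact hθ.2
    rw [iterAvg_sum r _ _ _ fun i _ => hcont i, Finset.sum_range_succ'] at h1
    simp only [Nat.cast_zero, zero_mul, add_zero, iterAvg_const, Nat.sub_zero, Nat.choose_zero_right,
      Nat.cast_one, mul_one] at h1
    rw [Polynomial.eval_finsetSum]
    simp only [Polynomial.eval_mul, Polynomial.eval_C]
    set S := ∑ i ∈ Finset.range r, (-1) ^ (r - (i + 1)) * (r.choose (i + 1) : ℝ) *
      iterAvg r (fun θ => F (u + (i + 1 : ℕ) * (θ * h))) 0 with hS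
    have hsq : ((-1 : ℝ) ^ r) * (-1) ^ r = 1 := by rw [← mul_pow]; norm_num
    have habs : ∀ j : ℕ, |(-1 : ℝ) ^ j| = 1 := fun j => by simp
    have e : F u - ∑ i ∈ Finset.range r,
        -((-1) ^ r * ((-1) ^ (r - (i + 1)) * (r.choose (i + 1) : ℝ))) * (p i).eval u =
        (-1) ^ r * (S + (-1) ^ r * F u) - (-1) ^ r * ∑ i ∈ Finset.range r,
          (-1) ^ (r - (i + 1)) * (r.choose (i + 1) : ℝ) *
          (iterAvg r (fun θ => F (u + (i + 1 : ℕ) * (θ * h))) 0 - (p i).eval u) := by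
      simp only [mul_sub, Finset.sum_sub_distrib, neg_mul, Finset.sum_neg_distrib, Finset.mul_sum,
        mul_add, hS]
      rw [← mul_assoc ((-1 : ℝ) ^ r), hsq]
      simp only [← mul_assoc]
      ring
    rw [e, add_mul, one_mul, Finset.sum_mul]
    refine (abs_sub _ _).trans (add_le_add ?_ ?_)
    · rw [abs_mul, habs, one_mul]; exact h1
    · rw [abs_mul, habs, one_mul]
      refine (Finset.abs_sum_le_sum_abs _ _).trans (Finset.sum_le_sum fun i hi => ?_)
      rw [abs_mul, abs_mul, habs, one_mul, Nat.abs_cast, mul_assoc]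
      gcongr
      exact hp i hi u hu

/-! ### Finite differences and local approximability. -/

theorem symmDifference_eq_fwdDiff (r : ℕ) (s : ℝ) (f : ℝ → ℝ) (x : ℝ) :
    symmDifference r s f x = (fwdDiff s)^[r] f (x - r / 2 * s) := by
  rw [fwdDiff_iter_eq_sum, ← Finset.sum_range_reflect]
  unfold symmDifference
  refine Finset.sum_congr rfl fun k hk => ?_
  have hk : k ≤ r := Nat.lt_succ_iff.1 (Finset.mem_range.1 hk)
  rw [show r + 1 - 1 - k = r - k by omega, Nat.sub_sub_self hk, Nat.choose_symm hk]
  congr 2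
  push_cast [hk]; ring

/-- Small symmetric differences give local approximability. -/
theorem exists_locallyApproximable_of_symmDifference_le {r : ℕ} (hr : 1 ≤ r) {α β b a κ C M₀ : ℝ}
    (hα : 0 < α) (hβ : 0 < β) (hb : 0 ≤ b) (ha : 0 < a) (hκ : 0 < κ) (hC : 0 ≤ C) (hM₀ : 0 ≤ M₀)
    {f : ℝ → ℝ} (hcont : ContinuousOn f (Ioo 0 1)) (hf : WeightedBound α β M₀ f)
    (hD : ∀ y ∈ Ioc (0 : ℝ) (15 / 16), ∀ h, 0 < h → h ≤ κ * y → h ≤ κ * y ^ b →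
      |symmDifference r h f y| ≤ C * y ^ (-α) * (h * y ^ (-b)) ^ a) :
    ∃ M : ℝ, 0 ≤ M ∧ LocallyApproximable r α b a 0 M f := by
  have hrR : (1 : ℝ) ≤ r := by exact_mod_cast hr
  have hr0 : (0 : ℝ) < r := by linarith
  -- The first bound keeps the span rh of the difference below σ/4. The second turns h ≤ μσ with σ ≤
  -- x^b into h ≤ κ z^b for midpoints z ≥ x/2.
  set μ := min (1 / (4 * (r : ℝ))) (κ * 2 ^ (-b)) with hμ
  have h2b : (0 : ℝ) < 2 ^ (-b) := by positivity
  have h2b1 : (2 : ℝ) ^ (-b) ≤ 1 := Real.rpow_le_one_of_one_le_of_nonpos (by norm_num) (by linarith)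
  have hμ0 : 0 < μ := lt_min (by positivity) (by positivity)
  have hμr : r * μ ≤ 1 / 4 := by
    have : μ ≤ 1 / (4 * (r : ℝ)) := min_le_left _ _
    rw [le_div_iff₀ (by positivity)] at this
    linarith
  have hμ1 : μ ≤ 1 / 4 := by nlinarith
  have hμκ : μ ≤ κ * 2 ^ (-b) := min_le_right _ _
  have hμκ' : μ ≤ κ := hμκ.trans (mul_le_of_le_one_right hκ.le h2b1)
  obtain ⟨W, hW, hwhit⟩ := exists_whitney_bound r hr hμ0
  refine ⟨W * (C * 2 ^ α * (2 ^ b) ^ a) + 2 ^ α * 4 ^ β * M₀, by positivity, ?_⟩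
  intro x hx σ hσ _
  have hx0 := hx.1
  have hx2 := hx.2
  have hσ0 := hσ.1
  have hσx := hσ.2
  have hxb := Real.rpow_pos_of_pos hx0 (-b)
  have hxb' := Real.rpow_pos_of_pos hx0 b
  have hxα := Real.rpow_pos_of_pos hx0 (-α)
  set t := σ * x ^ (-b) with ht
  have ht0 : 0 < t := by positivity
  have hta := Real.rpow_pos_of_pos ht0 a
  have hσt : σ = t * x ^ b := by
    rw [ht, mul_assoc, ← Real.rpow_add hx0, neg_add_cancel, Real.rpow_zero, mul_one]
  rcases le_or_gt t 1 with h1 | h1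
  -- The Whitney inequality asks for continuity on the whole line. Clamping the argument to [3x/8,
  -- 13x/8] provides it and changes no value that the differences use.
  · set F : ℝ → ℝ := fun y => f (max (3 * x / 8) (min y (13 * x / 8))) with hF
    have hFc : Continuous F := by
      refine hcont.comp_continuous (by fun_prop) fun y => ⟨?_, ?_⟩
      · exact lt_of_lt_of_le (by linarith) (le_max_left _ _)
      · exact max_lt (by linarith) (lt_of_le_of_lt (min_le_right _ _) (by linarith))
    have hFf : ∀ y, 3 * x / 8 ≤ y → y ≤ 13 * x / 8 → F y = f y := fun y h1 h2 => by
      simp only [hF]; rw [min_eq_left h2, max_eq_right h1]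
    obtain ⟨Q, hQd, hQ⟩ := hwhit F x σ (C * (2 ^ α * x ^ (-α)) * ((2 ^ b) ^ a * t ^ a)) hFc hσ0 (by
      intro y hy h hh
      obtain ⟨hy1, hy2⟩ := abs_le.1 hy
      have hrh : r * h ≤ σ / 4 := by
        calc r * h ≤ r * (μ * σ) := by gcongr; exact hh.2
          _ = (r * μ) * σ := by ring
          _ ≤ 1 / 4 * σ := by gcongr
          _ = _ := by ring
      have e : (fwdDiff h)^[r] F y = symmDifference r h f (y + r / 2 * h) := by
        rw [symmDifference_eq_fwdDiff, add_sub_cancel_right, fwdDiff_iter_eq_sum,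
          fwdDiff_iter_eq_sum]
        refine Finset.sum_congr rfl fun i hi => ?_
        have hi : (i : ℝ) ≤ r := by
          exact_mod_cast Nat.lt_succ_iff.1 (Finset.mem_range.1 hi)
        have h2 : (i : ℝ) * h ≤ r * h := by
          have := hh.1; gcongr
        have h3 : 0 ≤ (i : ℝ) * h := mul_nonneg (by positivity) hh.1.le
        rw [hFf _ (by linarith) (by linarith)]
      rw [e]
      have hh0 := hh.1
      have hz0 : 0 ≤ r / 2 * h := by positivity
      set z := y + r / 2 * h with hz
      have hz1 : x / 2 ≤ z := by linarith
      have hz2 : z ≤ 15 / 16 := by linarith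
      have hzpos : 0 < z := by linarith
      have hzα : z ^ (-α) ≤ 2 ^ α * x ^ (-α) := by
        rw [← div_two_rpow_neg hx0]
        exact Real.rpow_le_rpow_of_nonpos (by linarith) (by linarith) (by linarith)
      have hzb : z ^ (-b) ≤ 2 ^ b * x ^ (-b) := by
        rw [← div_two_rpow_neg hx0]
        exact Real.rpow_le_rpow_of_nonpos (by linarith) (by linarith) (by linarith)
      have hzb' : x ^ b * 2 ^ (-b) ≤ z ^ b := by
        rw [Real.rpow_neg (by norm_num), ← div_eq_mul_inv, ← Real.div_rpow hx0.le (by norm_num)]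
        exact Real.rpow_le_rpow (by linarith) hz1 hb
      have hzbp := Real.rpow_pos_of_pos hzpos (-b)
      have hhσ : h ≤ σ := hh.2.trans (mul_le_of_le_one_left hσ0.le (by linarith))
      refine (hD z ⟨hzpos, hz2⟩ h hh0 ?_ ?_).trans ?_
      · calc h ≤ μ * σ := hh.2
          _ ≤ κ * z := by gcongr; linarith
      · calc h ≤ μ * σ := hh.2
          _ ≤ (κ * 2 ^ (-b)) * (1 * x ^ b) := by
            rw [hσt]; gcongr
          _ = κ * (x ^ b * 2 ^ (-b)) := by ring
          _ ≤ κ * z ^ b := by gcongr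
      · have : (h * z ^ (-b)) ^ a ≤ (2 ^ b) ^ a * t ^ a := by
          rw [← Real.mul_rpow (by positivity) ht0.le]
          refine Real.rpow_le_rpow (by positivity) ?_ ha.le
          calc h * z ^ (-b) ≤ σ * (2 ^ b * x ^ (-b)) := by gcongr
            _ = _ := by rw [ht]; ring
        gcongr)
    refine ⟨Q, hQd, fun u hu => ?_⟩
    obtain ⟨hu1, hu2⟩ := abs_le.1 hu
    have := hQ u hu
    rw [hFf u (by linarith) (by linarith)] at this
    refine this.trans ?_
    have h3 : 0 ≤ 2 ^ α * 4 ^ β * M₀ * x ^ (-α) * t ^ a := by positivity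
    nlinarith
  · refine ⟨0, by simp, fun u hu => ?_⟩
    have h2 := hf.abs_le_of_near hα hβ hM₀ hx (hu.trans hσx)
    rw [Polynomial.eval_zero, sub_zero]
    have h3 : 1 ≤ t ^ a := Real.one_le_rpow h1.le ha.le
    calc |f u| ≤ 2 ^ α * 4 ^ β * M₀ * x ^ (-α) * 1 := by rw [mul_one]; exact h2
      _ ≤ 2 ^ α * 4 ^ β * M₀ * x ^ (-α) * t ^ a := by gcongr
      _ ≤ _ := by
        gcongr
        have : 0 ≤ W * (C * 2 ^ α * (2 ^ b) ^ a) := by positivity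
        linarith

theorem symmDifference_eval {r : ℕ} (Q : Polynomial ℝ) (hQ : Q.degree < r) (s x : ℝ) :
    symmDifference r s (fun u => Q.eval u) x = 0 := by
  rcases eq_or_ne Q 0 with h | h
  · simp [symmDifference, h]
  have hd := (Polynomial.natDegree_lt_iff_degree_lt h).2 hQ
  set y := x - r / 2 * s with hy
  set P := Q.comp (Polynomial.C y + Polynomial.C s * Polynomial.X) with hP
  have hPd : P.natDegree < r := by
    refine lt_of_le_of_lt Polynomial.natDegree_comp_le (lt_of_le_of_lt ?_ hd)
    refine mul_le_of_le_one_right (Nat.zero_le _) ?_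
    refine (Polynomial.natDegree_add_le _ _).trans (max_le (by simp) ?_)
    exact (Polynomial.natDegree_C_mul_le s _).trans Polynomial.natDegree_X_le
  have h0 := congrFun (Polynomial.fwdDiff_iter_eq_zero_of_degree_lt hPd) 0
  have h1 : (fwdDiff (1 : ℝ))^[r] (fun u => P.eval u) 0 = 0 := h0
  rw [fwdDiff_iter_eq_sum] at h1
  rw [symmDifference_eq_fwdDiff, fwdDiff_iter_eq_sum, ← h1]
  refine Finset.sum_congr rfl fun i _ => ?_
  simp only [hP, Polynomial.eval_comp, Polynomial.eval_add, Polynomial.eval_mul, Polynomial.eval_C,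
    Polynomial.eval_X, zero_add, mul_one, mul_comm s, hy]

theorem abs_symmDifference_le {r : ℕ} (Q : Polynomial ℝ) (hQ : Q.degree < r) {s x E : ℝ}
    {f : ℝ → ℝ} (h : ∀ k : ℕ, k ≤ r → |f (x + ((r : ℝ) / 2 - k) * s) -
      Q.eval (x + ((r : ℝ) / 2 - k) * s)| ≤ E) :
    |symmDifference r s f x| ≤ 2 ^ r * E := by
  have e : symmDifference r s f x = ∑ k ∈ Finset.range (r + 1), (-1) ^ k * (r.choose k : ℝ) *
      (f (x + ((r : ℝ) / 2 - k) * s) - Q.eval (x + ((r : ℝ) / 2 - k) * s)) := by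
    have := symmDifference_eval Q hQ s x
    simp only [symmDifference] at this ⊢
    simp only [mul_sub, Finset.sum_sub_distrib]
    rw [this, sub_zero]
  rw [e]
  have hsum : (2 : ℝ) ^ r = ∑ k ∈ Finset.range (r + 1), (r.choose k : ℝ) := by
    exact_mod_cast (Nat.sum_range_choose r).symm
  rw [hsum, Finset.sum_mul]
  refine (Finset.abs_sum_le_sum_abs _ _).trans (Finset.sum_le_sum fun k hk => ?_)
  rw [abs_mul, abs_mul, abs_pow, abs_neg, abs_one, one_pow, one_mul, Nat.abs_cast]
  exact mul_le_mul_of_nonneg_left (h k (Nat.lt_succ_iff.1 (Finset.mem_range.1 hk)))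
    (by positivity)

theorem LocallyApproximable.abs_symmDifference_le {r : ℕ} (hr : 1 ≤ r) {α b a M : ℝ} {f : ℝ → ℝ}
    (h : LocallyApproximable r α b a 0 M f) {x s : ℝ} (hx : x ∈ Ioc (0 : ℝ) (1 / 2)) (hs : 0 < s)
    (hsx : r * s ≤ x) :
    |symmDifference r s f x| ≤ 2 ^ r * (M * x ^ (-α) * (r / 2 * s * x ^ (-b)) ^ a) := by
  have hr0 : (0 : ℝ) < r := by exact_mod_cast hr
  have hxb := Real.rpow_pos_of_pos hx.1 (-b)
  obtain ⟨Q, hQd, hQ⟩ := h x hx (r / 2 * s) ⟨by positivity, by linarith⟩ (by positivity)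
  refine BernsteinComb.abs_symmDifference_le Q hQd fun k hk => hQ _ ?_
  have hk' : (k : ℝ) ≤ r := by exact_mod_cast hk
  rw [add_sub_cancel_left, abs_mul, abs_of_pos hs]
  gcongr
  rw [abs_le]
  constructor <;> linarith [(Nat.cast_nonneg k : (0 : ℝ) ≤ k)]

theorem fwdDifference_eq_symmDifference (r : ℕ) (h : ℝ) (f : ℝ → ℝ) (x : ℝ) :
    fwdDifference r h f x = symmDifference r h f (x + r / 2 * h) := by
  unfold fwdDifference symmDifference
  refine Finset.sum_congr rfl fun k _ => ?_
  congr 2; ring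

theorem abs_symmDifference_reflect (r : ℕ) (h : ℝ) (f : ℝ → ℝ) (x : ℝ) :
    |symmDifference r h (fun u => f (1 - u)) (1 - x)| = |symmDifference r h f x| := by
  have : symmDifference r h (fun u => f (1 - u)) (1 - x) = (-1) ^ r * symmDifference r h f x := by
    unfold symmDifference
    rw [← Finset.sum_range_reflect, Finset.mul_sum]
    refine Finset.sum_congr rfl fun k hk => ?_
    have hk : k ≤ r := Nat.lt_succ_iff.1 (Finset.mem_range.1 hk)
    rw [show r + 1 - 1 - k = r - k by omega, Nat.choose_symm hk]
    have e1 : (-1 : ℝ) ^ (r - k) = (-1) ^ r * (-1) ^ k := by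
      rw [← Nat.sub_add_cancel hk, Nat.add_sub_cancel, pow_add, mul_assoc, ← mul_pow]; norm_num
    rw [e1]
    have e2 : 1 - (1 - x + ((r : ℝ) / 2 - (r - k : ℕ)) * h) = x + ((r : ℝ) / 2 - k) * h := by
      push_cast [hk]; ring
    beta_reduce
    rw [e2]; ring
  rw [this, abs_mul, abs_pow, abs_neg, abs_one, one_pow, one_mul]

theorem abs_bwdDifference_eq (r : ℕ) (h : ℝ) (f : ℝ → ℝ) (x : ℝ) :
    |bwdDifference r h f x| = |fwdDifference r h (fun u => f (1 - u)) (1 - x)| := by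
  rw [fwdDifference_eq_symmDifference, show 1 - x + (r : ℝ) / 2 * h = 1 - (x - r / 2 * h) by ring,
    abs_symmDifference_reflect]
  congr 1
  unfold bwdDifference symmDifference
  refine Finset.sum_congr rfl fun k _ => ?_
  congr 2; ring

/-- One polynomial chosen at scale Y approximates f on all of [x, Y] with weight x^{-α}, by dyadic
descent down to η = x. The step h need not be small compared with x. -/
theorem LocallyApproximable.exists_abs_fwdDifference_le {r : ℕ} (hr : 1 ≤ r) {α β b a M M₀ : ℝ}
    (hα : 0 < α) (hβ : 0 < β) (ha : 0 < a) (hM : 0 ≤ M) (hM₀ : 0 ≤ M₀) (hb : b < 1) {f : ℝ → ℝ}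
    (hf : WeightedBound α β M₀ f) (hLA : LocallyApproximable r α b a 0 M f) :
    ∃ C : ℝ, 0 ≤ C ∧ ∀ Y ∈ Ioc (0 : ℝ) (1 / 2), ∀ x h : ℝ, 0 < x → 0 < h → x + r * h ≤ Y →
      |fwdDifference r h f x| ≤ C * x ^ (-α) * Y ^ (a * (1 - b)) := by
  set γ := a * max (1 - b) 0 with hγ
  have hγe : γ = a * (1 - b) := by rw [hγ, max_eq_left (by linarith)]
  have hγ0 : 0 ≤ γ := by rw [hγe]; apply mul_nonneg ha.le; linarith
  obtain ⟨C₁, hC₁, hdown⟩ := exists_abs_sub_le_of_scales r hr hα hγ0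
  refine ⟨2 ^ r * (C₁ * (M + 2 ^ α * 4 ^ β * M₀)), by positivity, ?_⟩
  intro Y hY x h hx hh hxh
  have hrh : 0 ≤ r * h := by positivity
  have hxY : x ≤ Y := by linarith
  have H := hLA.scales hα hβ ha hM hM₀ hf hx fun _ => by rw [mul_zero]; positivity
  obtain ⟨P, hPd, hP⟩ := H Y ⟨hxY, hY.2⟩
  have hP' := hdown f x _ hx (by positivity) H Y ⟨hxY, hY.2⟩ P hPd hP
  have hY0 := hY.1
  rw [fwdDifference_eq_symmDifference]
  have := BernsteinComb.abs_symmDifference_le (s := h) (x := x + r / 2 * h)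
    (E := C₁ * (M + 2 ^ α * 4 ^ β * M₀) * Y ^ γ * x ^ (-α)) (f := f) P hPd (by
      intro k hk
      have hk' : (k : ℝ) ≤ r := by exact_mod_cast hk
      have e : x + (r : ℝ) / 2 * h + ((r : ℝ) / 2 - k) * h = x + (r - k) * h := by ring
      have h1 : 0 ≤ ((r : ℝ) - k) * h := mul_nonneg (by linarith) hh.le
      have h2 : ((r : ℝ) - k) * h ≤ r * h := by
        gcongr; linarith [(Nat.cast_nonneg k : (0 : ℝ) ≤ k)]
      rw [e]
      refine (hP' _ ⟨by linarith, by linarith⟩).trans ?_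
      gcongr ?_ * ?_
      exact Real.rpow_le_rpow_of_nonpos hx (by linarith) (by linarith))
  refine this.trans (le_of_eq ?_)
  rw [hγe]; ring

/-! ### Weights, step-weights and reflection. -/

theorem weight_reflect (α β x : ℝ) : weight β α (1 - x) = weight α β x := by
  unfold weight; rw [sub_sub_cancel, mul_comm]

theorem weight_pos {α β x : ℝ} (hx : x ∈ Ioo (0 : ℝ) 1) : 0 < weight α β x :=
  mul_pos (Real.rpow_pos_of_pos hx.1 _) (Real.rpow_pos_of_pos (by linarith [hx.2]) _)

theorem weight_le_rpow {α β x : ℝ} (hβ : 0 < β) (hx : x ∈ Ioo (0 : ℝ) 1) :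
    weight α β x ≤ x ^ α :=
  mul_le_of_le_one_right (Real.rpow_nonneg hx.1.le _)
    (Real.rpow_le_one (by linarith [hx.2]) (by linarith [hx.1]) hβ.le)

theorem rpow_le_weight {α β x : ℝ} (hβ : 0 < β) (hx0 : 0 < x) (hx : x ≤ 15 / 16) :
    x ^ α ≤ 16 ^ β * weight α β x := by
  have h1 : 1 ≤ 16 ^ β * (1 - x) ^ β := by
    rw [← Real.mul_rpow (by norm_num) (by linarith)]
    exact Real.one_le_rpow (by linarith) hβ.le
  have h2 := Real.rpow_pos_of_pos hx0 α
  unfold weight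
  calc x ^ α = x ^ α * 1 := by ring
    _ ≤ x ^ α * (16 ^ β * (1 - x) ^ β) := by gcongr
    _ = _ := by ring

/-- The limits bound wf near the endpoints, compactness in between. The endpoint limits are used for
nothing else. -/
theorem MemCw.exists_weightedBound {α β : ℝ} {f : ℝ → ℝ} (hf : MemCw α β f) :
    ∃ M₀ : ℝ, 0 ≤ M₀ ∧ WeightedBound α β M₀ f := by
  have hw : ContinuousOn (fun x => weight α β x * f x) (Ioo 0 1) := by
    refine ContinuousOn.mul ?_ hf.continuousOn
    intro x hx
    refine ContinuousAt.continuousWithinAt ?_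
    refine (Real.continuousAt_rpow_const x α (Or.inl hx.1.ne')).mul ?_
    exact ContinuousAt.rpow_const (by fun_prop) (Or.inl (by linarith [hx.2]))
  have e0 : ∀ᶠ x in 𝓝[>] (0 : ℝ), |weight α β x * f x| < 1 := by
    have := hf.tendsto_zero.abs
    rw [abs_zero] at this
    exact this.eventually (gt_mem_nhds one_pos)
  have e1 : ∀ᶠ x in 𝓝[<] (1 : ℝ), |weight α β x * f x| < 1 := by
    have := hf.tendsto_one.abs
    rw [abs_zero] at this
    exact this.eventually (gt_mem_nhds one_pos)
  obtain ⟨p, hp, hp'⟩ := mem_nhdsGT_iff_exists_Ioo_subset.1 e0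
  obtain ⟨q, hq, hq'⟩ := mem_nhdsLT_iff_exists_Ioo_subset.1 e1
  have hp0 : (0 : ℝ) < p := hp
  have hq1 : q < (1 : ℝ) := hq
  set p' := min (p / 2) (1 / 2) with hp'd
  set q' := max ((q + 1) / 2) (1 / 2) with hq'd
  have hpp : 0 < p' := lt_min (by linarith) (by norm_num)
  have hqq : q' < 1 := max_lt (by linarith) (by norm_num)
  obtain ⟨B, hB⟩ := isCompact_Icc.exists_bound_of_continuousOn
    (hw.mono fun x (hx : x ∈ Icc p' q') => ⟨hpp.trans_le hx.1, hx.2.trans_lt hqq⟩)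
  have hall : ∀ x ∈ Ioo (0 : ℝ) 1, |weight α β x * f x| ≤ max B 1 := by
    intro x hx
    rcases lt_or_ge x p' with h | h
    · refine le_trans (le_of_lt (hp' ⟨hx.1, ?_⟩)) (le_max_right _ _)
      linarith [min_le_left (p / 2) (1 / 2 : ℝ)]
    rcases lt_or_ge q' x with h' | h'
    · refine le_trans (le_of_lt (hq' ⟨?_, hx.2⟩)) (le_max_right _ _)
      linarith [le_max_left ((q + 1) / 2) (1 / 2 : ℝ)]
    · exact (hB x ⟨h, h'⟩).trans (le_max_left _ _)
  refine ⟨max B 1, zero_le_one.trans (le_max_right _ _), fun x hx => ?_⟩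
  have h := hall x hx
  rw [abs_mul, abs_of_pos (weight_pos hx)] at h
  rw [Real.rpow_neg hx.1.le, Real.rpow_neg (by linarith [hx.2]), mul_assoc, ← mul_inv,
    ← div_eq_mul_inv]
  have hwp : 0 < x ^ α * (1 - x) ^ β := weight_pos (α := α) (β := β) hx
  rw [le_div_iff₀ hwp, mul_comm]
  exact h

theorem WeightedBound.reflect {α β M₀ : ℝ} {f : ℝ → ℝ} (h : WeightedBound α β M₀ f) :
    WeightedBound β α M₀ fun u => f (1 - u) := by
  intro v hv
  have := h (1 - v) ⟨by linarith [hv.2], by linarith [hv.1]⟩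
  rw [sub_sub_cancel] at this
  linarith

theorem tendsto_one_sub_nhdsGT : Tendsto (fun x : ℝ => 1 - x) (𝓝[>] 0) (𝓝[<] 1) := by
  refine tendsto_nhdsWithin_iff.2 ⟨?_, ?_⟩
  · have : Tendsto (fun x : ℝ => 1 - x) (𝓝 0) (𝓝 (1 - 0)) := by
      exact (continuous_const.sub continuous_id).tendsto 0
    rw [sub_zero] at this
    exact this.mono_left nhdsWithin_le_nhds
  · filter_upwards [self_mem_nhdsWithin] with x hx
    have : (0 : ℝ) < x := hx
    simpa using this

theorem tendsto_one_sub_nhdsLT : Tendsto (fun x : ℝ => 1 - x) (𝓝[<] 1) (𝓝[>] 0) := by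
  refine tendsto_nhdsWithin_iff.2 ⟨?_, ?_⟩
  · have : Tendsto (fun x : ℝ => 1 - x) (𝓝 1) (𝓝 (1 - 1)) := by
      exact (continuous_const.sub continuous_id).tendsto 1
    rw [sub_self] at this
    exact this.mono_left nhdsWithin_le_nhds
  · filter_upwards [self_mem_nhdsWithin] with x hx
    have : x < (1 : ℝ) := hx
    simpa using this

theorem IsAdmissibleStepWeight.reflect {ϕ : ℝ → ℝ} {b₀ b₁ : ℝ}
    (h : IsAdmissibleStepWeight ϕ b₀ b₁) : IsAdmissibleStepWeight (fun x => ϕ (1 - x)) b₁ b₀ where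
  exponent_zero := h.exponent_one
  exponent_one := h.exponent_zero
  compact_bound a b ha hab hb := by
    obtain ⟨M, hM, hMx⟩ := h.compact_bound (1 - b) (1 - a) (by linarith) (by linarith) (by linarith)
    exact ⟨M, hM, fun x hx => hMx (1 - x) ⟨by linarith [hx.2], by linarith [hx.1]⟩⟩
  near_zero := by
    obtain ⟨M, hM, hMx⟩ := h.near_one
    refine ⟨M, hM, ?_⟩
    filter_upwards [tendsto_one_sub_nhdsGT.eventually hMx] with x hx
    simpa using hx
  near_one := by
    obtain ⟨M, hM, hMx⟩ := h.near_zero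
    exact ⟨M, hM, tendsto_one_sub_nhdsLT.eventually hMx⟩

/-- Join the asymptotic lower bound at 0 with the one on a compact interval; the matching upper
bound is the condition that defines A. -/
theorem IsAdmissibleStepWeight.exists_lower_bound {ϕ : ℝ → ℝ} {b₀ b₁ : ℝ}
    (h : IsAdmissibleStepWeight ϕ b₀ b₁) :
    ∃ c : ℝ, 0 < c ∧ ∀ x ∈ Ioc (0 : ℝ) (15 / 16), c * x ^ b₀ ≤ ϕ x := by
  obtain ⟨M, hM, hMx⟩ := h.near_zero
  obtain ⟨p, hp, hp'⟩ := mem_nhdsGT_iff_exists_Ioo_subset.1 hMx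
  have hp0 : (0 : ℝ) < p := hp
  set p' := min (p / 2) (1 / 2) with hp'd
  have hpp : 0 < p' := lt_min (by linarith) (by norm_num)
  obtain ⟨M', hM', hMx'⟩ := h.compact_bound p' (15 / 16) hpp
    ((min_le_right _ _).trans (by norm_num)) (by norm_num)
  refine ⟨min M⁻¹ M'⁻¹, by positivity, fun x hx => ?_⟩
  have hxb := Real.rpow_pos_of_pos hx.1 b₀
  rcases lt_or_ge x p' with hlt | hge
  · have h1 : x ∈ Ioo (0 : ℝ) p := ⟨hx.1, by linarith [min_le_left (p / 2) (1 / 2 : ℝ)]⟩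
    refine le_trans ?_ (hp' h1).1
    gcongr
    exact min_le_left _ _
  · have h1 : x ^ b₀ ≤ 1 := Real.rpow_le_one hx.1.le (by linarith [hx.2]) h.exponent_zero
    calc min M⁻¹ M'⁻¹ * x ^ b₀ ≤ M'⁻¹ * 1 := by
          gcongr
          exact min_le_right _ _
      _ ≤ ϕ x := by rw [mul_one]; exact (hMx' x ⟨hge, hx.2⟩).1

theorem IsAdmissibleStepWeight.pos {ϕ : ℝ → ℝ} {b₀ b₁ : ℝ}
    (h : IsAdmissibleStepWeight ϕ b₀ b₁) {x : ℝ} (hx : x ∈ Ioo (0 : ℝ) 1) : 0 < ϕ x := by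
  obtain ⟨M, hM, hMx⟩ := h.compact_bound x x hx.1 le_rfl hx.2
  exact (inv_pos.2 hM).trans_le (hMx x ⟨le_rfl, le_rfl⟩).1

/-! ### Translating the error estimate and the modulus. -/

/-- The pointwise error estimate of the equivalence theorem. -/
def ErrorBound (ψ : ℝ → ℝ) (r : ℕ) (nd : ℕ → ℕ → ℕ) (c : ℕ → ℕ → ℝ) (α β a : ℝ)
    (ϕ f : ℝ → ℝ) : Prop :=
  ∃ C : ℝ, ∃ N : ℕ, ∀ n : ℕ, N ≤ n → ∀ x ∈ Ioo (0 : ℝ) 1,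
    weight α β x * |f x - bernsteinStar ψ r nd c n f x| ≤
      C * ((n : ℝ) ^ (-(1 / 2) : ℝ) * (ϕ x)⁻¹ * delta n x) ^ a

/-- This identifies the right side of the error estimate with the kernel spread measured in units of
ϕ. -/
theorem rpow_mul_delta_eq {n : ℕ} (x p : ℝ) :
    (n : ℝ) ^ (-(1 / 2) : ℝ) * p * delta n x = localScale n x * p := by
  have h1 : (n : ℝ) ^ (-(1 / 2) : ℝ) = 1 / √n := by
    rw [Real.rpow_neg (by positivity), ← Real.sqrt_eq_rpow, one_div]
  have h2 : (1 / √(n : ℝ)) * (1 / √n) = 1 / n := by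
    rw [div_mul_div_comm, one_mul, Real.mul_self_sqrt (Nat.cast_nonneg n)]
  have h3 : √(x * (1 - x) / n) = 1 / √n * √(x * (1 - x)) := by
    rw [Real.sqrt_div' _ (Nat.cast_nonneg n)]; ring
  unfold delta varphi localScale
  rw [h1, h3, ← h2]; ring

theorem ErrorBound.reflect {ψ : ℝ → ℝ} (hψ : IsCutoff ψ) {r : ℕ} {nd : ℕ → ℕ → ℕ} {c : ℕ → ℕ → ℝ}
    (hc : IsCombination (r - 1) nd c) {α β a : ℝ} {ϕ f : ℝ → ℝ}
    (h : ErrorBound ψ r nd c α β a ϕ f) :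
    ErrorBound ψ r nd c β α a (fun x => ϕ (1 - x)) fun x => f (1 - x) := by
  obtain ⟨C, N, hN⟩ := h
  refine ⟨C, max N 5, fun n hn x hx => ?_⟩
  have := hN n ((le_max_left _ _).trans hn) (1 - x) ⟨by linarith [hx.2], by linarith [hx.1]⟩
  rw [weight_reflect] at this
  rw [bernsteinStar_reflect hψ hc ((le_max_right _ _).trans hn)]
  have e : delta n (1 - x) = delta n x := by
    unfold delta varphi; rw [sub_sub_cancel, mul_comm]
  rwa [e] at this

theorem ErrorBound.exists_left {ψ : ℝ → ℝ} {r : ℕ} {nd : ℕ → ℕ → ℕ} {c : ℕ → ℕ → ℝ}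
    {α β a b₀ b₁ : ℝ} (hβ : 0 < β) (ha : 0 < a) {ϕ f : ℝ → ℝ}
    (hϕ : IsAdmissibleStepWeight ϕ b₀ b₁) (h : ErrorBound ψ r nd c α β a ϕ f) :
    ∃ C : ℝ, ∃ N : ℕ, 0 ≤ C ∧ ∀ n : ℕ, N ≤ n → ∀ u ∈ Ioc (0 : ℝ) (3 / 4),
      |f u - bernsteinStar ψ r nd c n f u| ≤ C * (localScale n u * u ^ (-b₀)) ^ a * u ^ (-α) := by
  obtain ⟨k, hk, hlow⟩ := hϕ.exists_lower_bound
  obtain ⟨C, N, hN⟩ := h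
  refine ⟨16 ^ β * (max C 0 * (k⁻¹) ^ a), max N 1, by positivity, fun n hn u hu => ?_⟩
  have hn1 : 1 ≤ n := (le_max_right _ _).trans hn
  have hu0 := hu.1
  have hu1 : u ∈ Ioo (0 : ℝ) 1 := ⟨hu.1, by linarith [hu.2]⟩
  have h1 := hN n ((le_max_left _ _).trans hn) u hu1
  rw [rpow_mul_delta_eq] at h1
  have hs := localScale_pos hn1 u
  have hϕu := hϕ.pos hu1
  have hub := Real.rpow_pos_of_pos hu0 (-b₀)
  have huα := Real.rpow_pos_of_pos hu0 α
  have h2 : (ϕ u)⁻¹ ≤ k⁻¹ * u ^ (-b₀) := by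
    rw [Real.rpow_neg hu0.le, ← mul_inv]
    have := Real.rpow_pos_of_pos hu0 b₀
    exact inv_anti₀ (by positivity) (hlow u ⟨hu0, by linarith [hu.2]⟩)
  have h3 : (localScale n u * (ϕ u)⁻¹) ^ a ≤
      k⁻¹ ^ a * (localScale n u * u ^ (-b₀)) ^ a := by
    rw [← Real.mul_rpow (by positivity) (by positivity)]
    refine Real.rpow_le_rpow (by positivity) ?_ ha.le
    calc _ ≤ localScale n u * (k⁻¹ * u ^ (-b₀)) := by gcongr
      _ = _ := by ring
  have h4 : weight α β u * |f u - bernsteinStar ψ r nd c n f u| ≤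
      max C 0 * (k⁻¹ ^ a * (localScale n u * u ^ (-b₀)) ^ a) := by
    refine h1.trans ?_
    have h5 : 0 ≤ (localScale n u * (ϕ u)⁻¹) ^ a := by positivity
    calc _ ≤ max C 0 * (localScale n u * (ϕ u)⁻¹) ^ a := by
          gcongr
          exact le_max_left _ _
      _ ≤ _ := by gcongr
  rw [Real.rpow_neg hu0.le α, ← div_eq_mul_inv, le_div_iff₀ huα]
  calc _ ≤ |f u - bernsteinStar ψ r nd c n f u| * (16 ^ β * weight α β u) := by
        gcongr
        exact rpow_le_weight hβ hu0 (by linarith [hu.2])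
    _ = 16 ^ β * (weight α β u * |f u - bernsteinStar ψ r nd c n f u|) := by ring
    _ ≤ 16 ^ β * (max C 0 * (k⁻¹ ^ a * (localScale n u * u ^ (-b₀)) ^ a)) := by gcongr
    _ = _ := by ring

/-- Pointwise form of the main part of the modulus being of order `t^a`. -/
def DifferenceBound (A : ℝ) (r : ℕ) (α β b₀ b₁ a : ℝ) (ϕ f : ℝ → ℝ) : Prop :=
  ∃ C t₀ : ℝ, 0 ≤ C ∧ 0 < t₀ ∧ ∀ x ∈ Ioo (0 : ℝ) 1, ∀ t ∈ Ioc (0 : ℝ) t₀, tStar A r b₀ t ≤ x →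
    tStar A r b₁ t ≤ 1 - x → weight α β x * |symmDifference r (t * ϕ x) f x| ≤ C * t ^ a

theorem DifferenceBound.reflect {A : ℝ} {r : ℕ} {α β b₀ b₁ a : ℝ} {ϕ f : ℝ → ℝ}
    (h : DifferenceBound A r α β b₀ b₁ a ϕ f) :
    DifferenceBound A r β α b₁ b₀ a (fun x => ϕ (1 - x)) fun x => f (1 - x) := by
  obtain ⟨C, t₀, hC, ht₀, h⟩ := h
  refine ⟨C, t₀, hC, ht₀, fun x hx t ht h1 h0 => ?_⟩
  have := h (1 - x) ⟨by linarith [hx.2], by linarith [hx.1]⟩ t ht h0 (by rwa [sub_sub_cancel])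
  rwa [weight_reflect, ← abs_symmDifference_reflect, sub_sub_cancel] at this

theorem le_weightedSup_iff {α β : ℝ} {g : ℝ → ℝ} {S : Set ℝ} {B : ℝ≥0∞} :
    weightedSup α β g S ≤ B ↔
      ∀ x ∈ S ∩ Ioo 0 1, ENNReal.ofReal (weight α β x * |g x|) ≤ B := by
  unfold weightedSup
  rw [iSup₂_le_iff]
  refine forall₂_congr fun x hx => ?_
  rw [abs_mul, abs_of_pos (weight_pos hx.2)]

/-- Only the interior part of the modulus, at h = t, is retained; it already implies local
approximability. -/
theorem differenceBound_of_dtModulus {A : ℝ} {r : ℕ} {α β b₀ b₁ a : ℝ} {ϕ f : ℝ → ℝ}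
    (h : ∃ C : ℝ, ∃ t₀ : ℝ, 0 < t₀ ∧ ∀ t ∈ Ioc (0 : ℝ) t₀,
      dtModulus A r α β b₀ b₁ ϕ f t ≤ ENNReal.ofReal (C * t ^ a)) :
    DifferenceBound A r α β b₀ b₁ a ϕ f := by
  obtain ⟨C, t₀, ht₀, h⟩ := h
  refine ⟨max C 0, t₀, le_max_right _ _, ht₀, fun x hx t ht h0 h1 => ?_⟩
  have hta := Real.rpow_nonneg ht.1.le a
  have h2 := h t ht
  unfold dtModulus at h2
  have h3 := (le_self_add.trans le_self_add).trans h2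
  rw [iSup₂_le_iff] at h3
  have h4 := le_weightedSup_iff.1 (h3 t ⟨ht.1, le_rfl⟩) x ⟨⟨h0, by linarith⟩, hx⟩
  have h5 : ENNReal.ofReal (C * t ^ a) ≤ ENNReal.ofReal (max C 0 * t ^ a) := by
    apply ENNReal.ofReal_le_ofReal
    gcongr
    exact le_max_left _ _
  exact (ENNReal.ofReal_le_ofReal_iff (mul_nonneg (le_max_right _ _) hta)).1 (h4.trans h5)

/-- For b < 1, raising to the power 1-b undoes the definition of t*; `le_rpow_of_tStar_le` is the
opposite direction. -/
theorem tStar_le {A : ℝ} {r : ℕ} {b t y : ℝ} (h0 : 0 ≤ A * r * t) (hy : 0 < y)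
    (h : b < 1 → A * r * t ≤ y ^ (1 - b)) : tStar A r b t ≤ y := by
  unfold tStar
  split_ifs with hb
  · have h1 : y = (y ^ (1 - b)) ^ (1 / (1 - b)) := by
      rw [← Real.rpow_mul hy.le, mul_one_div_cancel (by linarith), Real.rpow_one]
    rw [h1]
    exact Real.rpow_le_rpow h0 (h hb) (by apply div_nonneg <;> linarith)
  · exact hy.le

theorem le_rpow_of_tStar_le {A : ℝ} {r : ℕ} {b t y : ℝ} (h0 : 0 ≤ A * r * t) (hb : b < 1)
    (h : tStar A r b t ≤ y) : A * r * t ≤ y ^ (1 - b) := by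
  unfold tStar at h
  rw [if_pos hb] at h
  have h1 : A * r * t = ((A * r * t) ^ (1 / (1 - b))) ^ (1 - b) := by
    rw [← Real.rpow_mul h0, one_div_mul_cancel (by linarith), Real.rpow_one]
  rw [h1]
  exact Real.rpow_le_rpow (Real.rpow_nonneg h0 _) h (by linarith)

theorem le_rpow_one_sub {y b : ℝ} (hy : 0 < y) (hy1 : y ≤ 1) (hb : 0 ≤ b) : y ≤ y ^ (1 - b) := by
  nth_rewrite 1 [← Real.rpow_one y]
  exact Real.rpow_le_rpow_of_exponent_ge hy hy1 (by linarith)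

theorem DifferenceBound.exists_locallyApproximable {A : ℝ} (hA : 0 < A) {r : ℕ} (hr : 1 ≤ r)
    {α β b₀ b₁ a M₀ : ℝ} (hα : 0 < α) (hβ : 0 < β) (ha : 0 < a) (hM₀ : 0 ≤ M₀) {ϕ f : ℝ → ℝ}
    (hϕ : IsAdmissibleStepWeight ϕ b₀ b₁) (hcont : ContinuousOn f (Ioo 0 1))
    (hf : WeightedBound α β M₀ f) (h : DifferenceBound A r α β b₀ b₁ a ϕ f) :
    ∃ M : ℝ, 0 ≤ M ∧ LocallyApproximable r α b₀ a 0 M f := by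
  obtain ⟨k, hk, hlow⟩ := hϕ.exists_lower_bound
  obtain ⟨C, t₀, hC, ht₀, h⟩ := h
  have hr0 : (0 : ℝ) < r := by exact_mod_cast hr
  -- The first bound on κ ensures t ≤ t₀. The second gives A r t ≤ 1/16, which keeps y ≤ 15/16 clear
  -- of the right endpoint zone, and with h ≤ κy it also gives t* ≤ y at the left end.
  refine exists_locallyApproximable_of_symmDifference_le hr (κ := min (k * t₀) (k / (16 * (A * r))))
    (C := 16 ^ β * (C * k⁻¹ ^ a)) hα hβ hϕ.exponent_zero ha (by positivity) (by positivity) hM₀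
    hcont hf ?_
  intro y hy s hs0 hsy hsyb
  set κ := min (k * t₀) (k / (16 * (A * r))) with hκ
  have hκ1 : κ ≤ k * t₀ := min_le_left _ _
  have hκ2 : κ * (16 * (A * r)) ≤ k := by
    rw [← le_div_iff₀ (by positivity)]; exact min_le_right _ _
  have hκ0 : 0 < κ := by positivity
  have hy0 := hy.1
  have hy1 : y ∈ Ioo (0 : ℝ) 1 := ⟨hy.1, by linarith [hy.2]⟩
  have hyb := Real.rpow_pos_of_pos hy0 b₀
  have hynb := Real.rpow_pos_of_pos hy0 (-b₀)
  have hyα := Real.rpow_pos_of_pos hy0 α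
  have hϕy := hϕ.pos hy1
  have hl := hlow y hy
  set t := s / ϕ y with ht
  have ht0 : 0 < t := by positivity
  have htk : t ≤ s * y ^ (-b₀) / k := by
    rw [ht, Real.rpow_neg hy0.le, ← div_eq_mul_inv, div_div, mul_comm (y ^ b₀)]
    gcongr
  have hsκ : s * y ^ (-b₀) ≤ κ := by
    rw [Real.rpow_neg hy0.le, ← div_eq_mul_inv, div_le_iff₀ hyb]; exact hsyb
  have htt : t ≤ t₀ := by
    refine htk.trans ?_
    rw [div_le_iff₀ hk]; linarith
  have hAr : A * r * t ≤ 1 / 16 := by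
    have : A * r * (κ / k) ≤ 1 / 16 := by
      rw [← mul_div_assoc, div_le_iff₀ hk]; linarith
    refine le_trans ?_ this
    gcongr
    exact htk.trans (by gcongr)
  have hArt : 0 ≤ A * r * t := by positivity
  have hArκ : A * r * κ / k ≤ 1 := by rw [div_le_one hk]; nlinarith
  have h1 := h y hy1 t ⟨ht0, htt⟩
    (tStar_le hArt hy0 fun _ => by
      rw [sub_eq_add_neg, Real.rpow_add hy0, Real.rpow_one]
      calc A * r * t ≤ A * r * (s * y ^ (-b₀) / k) := by gcongr
        _ ≤ A * r * (κ * y * y ^ (-b₀) / k) := by gcongr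
        _ = (A * r * κ / k) * (y * y ^ (-b₀)) := by ring
        _ ≤ 1 * (y * y ^ (-b₀)) := by gcongr
        _ = _ := by ring)
    ((tStar_le hArt (by norm_num : (0 : ℝ) < 1 / 16) fun _ =>
      hAr.trans (le_rpow_one_sub (by norm_num) (by norm_num) hϕ.exponent_one)).trans
      (by linarith [hy.2]))
  rw [ht, div_mul_cancel₀ _ hϕy.ne', ← ht] at h1
  have h2 : t ^ a ≤ k⁻¹ ^ a * (s * y ^ (-b₀)) ^ a := by
    rw [← Real.mul_rpow (by positivity) (by positivity), inv_mul_eq_div]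
    exact Real.rpow_le_rpow ht0.le htk ha.le
  rw [Real.rpow_neg hy0.le α, mul_right_comm, ← div_eq_mul_inv, le_div_iff₀ hyα]
  calc _ ≤ |symmDifference r s f y| * (16 ^ β * weight α β y) := by
        gcongr
        exact rpow_le_weight hβ hy0 hy.2
    _ = 16 ^ β * (weight α β y * |symmDifference r s f y|) := by ring
    _ ≤ 16 ^ β * (C * (k⁻¹ ^ a * (s * y ^ (-b₀)) ^ a)) :=
        mul_le_mul_of_nonneg_left (h1.trans (mul_le_mul_of_nonneg_left h2 hC)) (by positivity)
    _ = _ := by ring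

/-- Local approximability controls the main part of the modulus on the left half. -/
theorem LocallyApproximable.weight_mul_symmDifference_le {A : ℝ} (hA : 0 < A) {r : ℕ} (hr : 1 ≤ r)
    {α β b a M : ℝ} (hβ : 0 < β) (ha : 0 < a) (hM : 0 ≤ M) {f : ℝ → ℝ}
    (hLA : LocallyApproximable r α b a 0 M f) {x t s : ℝ} (hx : x ∈ Ioc (0 : ℝ) (1 / 2))
    (ht0 : 0 < t) (ht1 : A * r * t ≤ 1) (hxt : tStar A r b t ≤ x) (hs0 : 0 < s)
    (hs : s ≤ t * (A * x ^ b)) :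
    weight α β x * |symmDifference r s f x| ≤ 2 ^ r * M * (r / 2 * A) ^ a * t ^ a := by
  have hr0 : (0 : ℝ) < r := by exact_mod_cast hr
  have hx0 := hx.1
  have hxb := Real.rpow_pos_of_pos hx0 b
  have hxnb := Real.rpow_pos_of_pos hx0 (-b)
  have hxα := Real.rpow_pos_of_pos hx0 α
  have hxbb : x ^ b * x ^ (-b) = 1 := by
    rw [← Real.rpow_add hx0, add_neg_cancel, Real.rpow_zero]
  -- The points of the difference must stay in [x/2, 3x/2]. For b < 1 this is the meaning of t* ≤ x;
  -- for b ≥ 1 it follows from x^b ≤ x and A r t ≤ 1.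
  have hrs : r * s ≤ x := by
    have h1 : r * s ≤ A * r * t * x ^ b := by
      calc r * s ≤ r * (t * (A * x ^ b)) := by gcongr
        _ = _ := by ring
    refine h1.trans ?_
    rcases lt_or_ge b 1 with hb | hb
    · have := le_rpow_of_tStar_le (by positivity) hb hxt
      calc A * r * t * x ^ b ≤ x ^ (1 - b) * x ^ b := by gcongr
        _ = x := by rw [← Real.rpow_add hx0, sub_add_cancel, Real.rpow_one]
    · have : x ^ b ≤ x := by
        nth_rewrite 2 [← Real.rpow_one x]
        exact Real.rpow_le_rpow_of_exponent_ge hx0 (by linarith [hx.2]) hb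
      calc A * r * t * x ^ b ≤ 1 * x := by gcongr
        _ = x := one_mul x
  have h2 := hLA.abs_symmDifference_le hr hx hs0 hrs
  have h3 : (r / 2 * s * x ^ (-b)) ^ a ≤ (r / 2 * A) ^ a * t ^ a := by
    rw [← Real.mul_rpow (by positivity) ht0.le]
    refine Real.rpow_le_rpow (by positivity) ?_ ha.le
    calc r / 2 * s * x ^ (-b) ≤ r / 2 * (t * (A * x ^ b)) * x ^ (-b) := by gcongr
      _ = r / 2 * A * t * (x ^ b * x ^ (-b)) := by ring
      _ = _ := by rw [hxbb, mul_one]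
  have hxαα : x ^ α * x ^ (-α) = 1 := by
    rw [← Real.rpow_add hx0, add_neg_cancel, Real.rpow_zero]
  have hxnα := Real.rpow_pos_of_pos hx0 (-α)
  calc _ ≤ x ^ α * (2 ^ r * (M * x ^ (-α) * ((r / 2 * A) ^ a * t ^ a))) := by
        gcongr
        · exact weight_le_rpow hβ ⟨hx0, by linarith [hx.2]⟩
        · exact h2.trans (by gcongr)
    _ = 2 ^ r * M * (r / 2 * A) ^ a * t ^ a * (x ^ α * x ^ (-α)) := by ring
    _ = _ := by rw [hxαα, mul_one]

/-- Local approximability controls the endpoint part of the modulus. -/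
theorem LocallyApproximable.exists_weight_mul_fwdDifference_le {A : ℝ} (hA : 0 < A) {r : ℕ}
    (hr : 1 ≤ r) {α β b a M M₀ : ℝ} (hα : 0 < α) (hβ : 0 < β) (hb0 : 0 ≤ b) (ha : 0 < a)
    (hM : 0 ≤ M) (hM₀ : 0 ≤ M₀) {f : ℝ → ℝ} (hf : WeightedBound α β M₀ f)
    (hLA : LocallyApproximable r α b a 0 M f) :
    ∃ C t₀ : ℝ, 0 ≤ C ∧ 0 < t₀ ∧ ∀ t ∈ Ioc 0 t₀, ∀ h ∈ Ioc 0 (tStar A r b t),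
      ∀ x ∈ Icc 0 (12 * tStar A r b t) ∩ Ioo 0 1,
        weight α β x * |fwdDifference r h f x| ≤ C * t ^ a := by
  have hr0 : (0 : ℝ) < r := by exact_mod_cast hr
  rcases lt_or_ge b 1 with hb | hb
  · obtain ⟨C, hC, hC'⟩ := hLA.exists_abs_fwdDifference_le hr hα hβ ha hM hM₀ hb hf
    -- With t* ≤ m the whole zone x + rh ≤ (12+r)t* = Y stays in (0, 1/2].
    set m : ℝ := 1 / (2 * (12 + r)) with hm
    have hm0 : 0 < m := by positivity
    have hm1 : m ≤ 1 := by
      rw [hm, div_le_one (by positivity)]; linarith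
    refine ⟨C * ((12 + r) ^ (a * (1 - b)) * (A * r) ^ a), m / (A * r), by positivity,
      by positivity, ?_⟩
    intro t ht h hh x hx
    have ht0 := ht.1
    have hAt : A * r * t ≤ m := by
      have := ht.2
      rw [le_div_iff₀ (by positivity)] at this
      linarith
    have hst : tStar A r b t ≤ m :=
      tStar_le (by positivity) hm0 fun _ => hAt.trans (le_rpow_one_sub hm0 hm1 hb0)
    have hst0 : 0 < tStar A r b t := hh.1.trans_le hh.2
    have hx0 := hx.2.1
    set Y := (12 + r) * tStar A r b t with hY
    have hY0 : 0 < Y := by positivity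
    have hY2 : Y ≤ 1 / 2 := by
      calc Y ≤ (12 + r) * m := by rw [hY]; gcongr
        _ = 1 / 2 := by rw [hm]; field_simp
    have h1 := hC' Y ⟨hY0, hY2⟩ x h hx0 hh.1 (by
      have : r * h ≤ r * tStar A r b t := by gcongr; exact hh.2
      rw [hY]; linarith [hx.1.2])
    -- The exponent in t* is tuned so that t*^{a(1-b)} = (A r t)^a.
    have h2 : Y ^ (a * (1 - b)) = (12 + r) ^ (a * (1 - b)) * (A * r) ^ a * t ^ a := by
      rw [hY, Real.mul_rpow (by positivity) hst0.le]
      unfold tStar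
      rw [if_pos hb, ← Real.rpow_mul (by positivity)]
      have : 1 / (1 - b) * (a * (1 - b)) = a := by
        have : 1 - b ≠ 0 := by linarith
        field_simp
      rw [this, Real.mul_rpow (by positivity) ht0.le]; ring
    have hxα := Real.rpow_pos_of_pos hx0 α
    have hxαα : x ^ α * x ^ (-α) = 1 := by
      rw [← Real.rpow_add hx0, add_neg_cancel, Real.rpow_zero]
    calc _ ≤ x ^ α * (C * x ^ (-α) * Y ^ (a * (1 - b))) := by
          gcongr
          exact weight_le_rpow hβ hx.2
      _ = C * Y ^ (a * (1 - b)) * (x ^ α * x ^ (-α)) := by ring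
      _ = _ := by rw [hxαα, h2]; ring
  -- For b ≥ 1 one has t* = 0, and the range of h is empty.
  · refine ⟨0, 1, le_rfl, one_pos, ?_⟩
    intro t _ h hh
    unfold tStar at hh
    rw [if_neg (by linarith)] at hh
    exact absurd (hh.1.trans_le hh.2) (lt_irrefl _)

theorem exists_dtModulus_le {A : ℝ} (hA : 0 < A) {r : ℕ} (hr : 1 ≤ r) {α β b₀ b₁ a M M' M₀ : ℝ}
    (hα : 0 < α) (hβ : 0 < β) (ha : 0 < a) (hM : 0 ≤ M) (hM' : 0 ≤ M') (hM₀ : 0 ≤ M₀)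
    {ϕ f : ℝ → ℝ} (hϕ : IsAdmissibleStepWeight ϕ b₀ b₁)
    (hϕA : ∀ x ∈ Ioo (0 : ℝ) 1, ϕ x ≤ A * x ^ b₀ ∧ ϕ x ≤ A * (1 - x) ^ b₁)
    (hf : WeightedBound α β M₀ f) (hL : LocallyApproximable r α b₀ a 0 M f)
    (hR : LocallyApproximable r β b₁ a 0 M' fun u => f (1 - u)) :
    ∃ C : ℝ, ∃ t₀ : ℝ, 0 < t₀ ∧ ∀ t ∈ Ioc (0 : ℝ) t₀,
      dtModulus A r α β b₀ b₁ ϕ f t ≤ ENNReal.ofReal (C * t ^ a) := by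
  have hr0 : (0 : ℝ) < r := by exact_mod_cast hr
  obtain ⟨C₁, t₁, hC₁, ht₁, h₁⟩ :=
    hL.exists_weight_mul_fwdDifference_le hA hr hα hβ hϕ.exponent_zero ha hM hM₀ hf
  obtain ⟨C₂, t₂, hC₂, ht₂, h₂⟩ :=
    hR.exists_weight_mul_fwdDifference_le hA hr hβ hα hϕ.exponent_one ha hM' hM₀ hf.reflect
  set C₀ := 2 ^ r * M * (r / 2 * A) ^ a + 2 ^ r * M' * (r / 2 * A) ^ a with hC₀
  have q1 : 0 ≤ 2 ^ r * M * (r / 2 * A) ^ a := by positivity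
  have q2 : 0 ≤ 2 ^ r * M' * (r / 2 * A) ^ a := by positivity
  refine ⟨C₀ + C₁ + C₂, min (1 / (A * r)) (min t₁ t₂), by positivity, fun t ht => ?_⟩
  have ht0 := ht.1
  have hta := Real.rpow_pos_of_pos ht0 a
  have htA : A * r * t ≤ 1 := by
    have := ht.2.trans (min_le_left _ _)
    rw [le_div_iff₀ (by positivity)] at this
    linarith
  have htt₁ : t ≤ t₁ := ht.2.trans ((min_le_right _ _).trans (min_le_left _ _))
  have htt₂ : t ≤ t₂ := ht.2.trans ((min_le_right _ _).trans (min_le_right _ _))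
  rw [add_mul, add_mul, ENNReal.ofReal_add (by positivity) (by positivity),
    ENNReal.ofReal_add (by positivity) (by positivity)]
  unfold dtModulus
  refine add_le_add (add_le_add ?_ ?_) ?_
  · refine iSup₂_le fun h hh => le_weightedSup_iff.2 fun x hx => ENNReal.ofReal_le_ofReal ?_
    have hϕx := hϕ.pos hx.2
    have hs0 : 0 < h * ϕ x := mul_pos hh.1 hϕx
    rcases le_or_gt x (1 / 2) with hx2 | hx2
    · have := hL.weight_mul_symmDifference_le hA hr hβ ha hM (s := h * ϕ x) ⟨hx.2.1, hx2⟩ ht0 htA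
        hx.1.1 hs0 (mul_le_mul hh.2 (hϕA x hx.2).1 hϕx.le ht0.le)
      refine this.trans ?_
      gcongr
      linarith
    · have := hR.weight_mul_symmDifference_le hA hr hα ha hM' (s := h * ϕ x) (x := 1 - x)
        ⟨by linarith [hx.2.2], by linarith⟩ ht0 htA (by linarith [hx.1.2]) hs0
        (mul_le_mul hh.2 (hϕA x hx.2).2 hϕx.le ht0.le)
      rw [abs_symmDifference_reflect, weight_reflect] at this
      refine this.trans ?_
      gcongr
      linarith
  · exact iSup₂_le fun h hh => le_weightedSup_iff.2 fun x hx =>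
      ENNReal.ofReal_le_ofReal (h₁ t ⟨ht0, htt₁⟩ h hh x hx)
  · refine iSup₂_le fun h hh => le_weightedSup_iff.2 fun x hx => ENNReal.ofReal_le_ofReal ?_
    have := h₂ t ⟨ht0, htt₂⟩ h hh (1 - x)
      ⟨⟨by linarith [hx.2.2], by linarith [hx.1.1]⟩, by linarith [hx.2.2], by linarith [hx.2.1]⟩
    rw [weight_reflect] at this
    rwa [abs_bwdDifference_eq]

theorem errorBound_of_locallyApproximable {ψ : ℝ → ℝ} (hψ : IsCutoff ψ) {r : ℕ} (hr : 2 ≤ r)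
    {nd : ℕ → ℕ → ℕ} {c : ℕ → ℕ → ℝ} (hc : IsCombination (r - 1) nd c) {A α β b₀ b₁ a M M' M₀ : ℝ}
    (hα : 0 < α) (hβ : 0 < β) (ha : 0 < a) (hA : 0 < A) (hM : 0 ≤ M) (hM' : 0 ≤ M') (hM₀ : 0 ≤ M₀)
    {ϕ f : ℝ → ℝ} (hϕ : IsAdmissibleStepWeight ϕ b₀ b₁)
    (hϕA : ∀ x ∈ Ioo (0 : ℝ) 1, ϕ x ≤ A * x ^ b₀ ∧ ϕ x ≤ A * (1 - x) ^ b₁)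
    (hf : WeightedBound α β M₀ f) (hL : LocallyApproximable r α b₀ a 0 M f)
    (hR : LocallyApproximable r β b₁ a 0 M' fun u => f (1 - u)) :
    ErrorBound ψ r nd c α β a ϕ f := by
  obtain ⟨C₁, hC₁, h₁⟩ :=
    exists_bernsteinStar_error_le hψ hr hc hα hβ hϕ.exponent_zero ha hM hM₀ hf hL
  obtain ⟨C₂, hC₂, h₂⟩ :=
    exists_bernsteinStar_error_le hψ hr hc hβ hα hϕ.exponent_one ha hM' hM₀ hf.reflect hR
  refine ⟨(C₁ + C₂) * A ^ a, max 16 (r + 1), fun n hn x hx => ?_⟩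
  have hn16 : 16 ≤ n := (le_max_left _ _).trans hn
  have hnr : r + 1 ≤ n := (le_max_right _ _).trans hn
  -- The exponents are kept generic to serve both endpoints: the weight cancels y^{-α'}, and p ≤ A
  -- y^b turns y^{-b} into A/p.
  have key : ∀ {α' β' b y p E C : ℝ}, 0 < β' → y ∈ Ioo (0 : ℝ) 1 → 0 ≤ C → 0 < p →
      p ≤ A * y ^ b → E ≤ C * (localScale n y * y ^ (-b)) ^ a * y ^ (-α') → 0 ≤ E →
      weight α' β' y * E ≤ C * A ^ a * (localScale n y * p⁻¹) ^ a := by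
    intro α' β' b y p E C hβ' hy hC hp hpA hE hE0
    have hy0 := hy.1
    have hs := localScale_pos (by omega : 1 ≤ n) y
    have hyb := Real.rpow_pos_of_pos hy0 b
    have hynb := Real.rpow_pos_of_pos hy0 (-b)
    have hyα := Real.rpow_pos_of_pos hy0 α'
    have h1 : y ^ (-b) ≤ A * p⁻¹ := by
      rw [Real.rpow_neg hy0.le, ← div_eq_mul_inv, le_div_iff₀ hp, inv_mul_le_iff₀ hyb]
      linarith
    have h2 : (localScale n y * y ^ (-b)) ^ a ≤ A ^ a * (localScale n y * p⁻¹) ^ a := by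
      rw [← Real.mul_rpow hA.le (by positivity)]
      refine Real.rpow_le_rpow (by positivity) ?_ ha.le
      calc _ ≤ localScale n y * (A * p⁻¹) := by gcongr
        _ = _ := by ring
    have hyαα : y ^ α' * y ^ (-α') = 1 := by
      rw [← Real.rpow_add hy0, add_neg_cancel, Real.rpow_zero]
    calc weight α' β' y * E ≤ y ^ α' * (C * (localScale n y * y ^ (-b)) ^ a * y ^ (-α')) := by
          gcongr
          exact weight_le_rpow hβ' hy
      _ = C * (localScale n y * y ^ (-b)) ^ a * (y ^ α' * y ^ (-α')) := by ring
      _ ≤ C * (A ^ a * (localScale n y * p⁻¹) ^ a) := by rw [hyαα, mul_one]; gcongr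
      _ = _ := by ring
  have hs := localScale_pos (by omega : 1 ≤ n) x
  have hϕx := hϕ.pos hx
  rw [rpow_mul_delta_eq]
  rcases le_or_gt x (1 / 2) with h | h
  · refine (key hβ hx hC₁ hϕx (hϕA x hx).1 (h₁ n hn16 hnr x ⟨hx.1, h⟩) (abs_nonneg _)).trans ?_
    gcongr
    linarith
  · have hx' : 1 - x ∈ Ioo (0 : ℝ) 1 := ⟨by linarith [hx.2], by linarith [hx.1]⟩
    have h3 := h₂ n hn16 hnr (1 - x) ⟨hx'.1, by linarith⟩
    rw [bernsteinStar_reflect hψ hc (by omega), sub_sub_cancel] at h3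
    have := key hα hx' hC₂ hϕx (hϕA x hx).2 h3 (abs_nonneg _)
    have e : localScale n (1 - x) = localScale n x := by
      unfold localScale; rw [sub_sub_cancel, mul_comm x]
    rw [weight_reflect, e] at this
    refine this.trans ?_
    gcongr
    linarith

end BernsteinComb

/-! ### The equivalence. -/

open BernsteinComb in
theorem theorem3 (r : ℕ) (hr : 2 ≤ r) (α β : ℝ) (hα : 0 < α) (hβ : 0 < β)
    (ϕ : ℝ → ℝ) (b₀ b₁ : ℝ) (hϕ : BernsteinComb.IsAdmissibleStepWeight ϕ b₀ b₁)
    (hb : 1 / 2 ≤ min b₀ b₁)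
    (A : ℝ) (hA : ∀ x ∈ Ioo (0 : ℝ) 1, ϕ x ≤ A * x ^ b₀ ∧ ϕ x ≤ A * (1 - x) ^ b₁)
    (ψ : ℝ → ℝ) (hψ : BernsteinComb.IsCutoff ψ)
    (nd : ℕ → ℕ → ℕ) (c : ℕ → ℕ → ℝ) (hc : BernsteinComb.IsCombination (r - 1) nd c)
    (f : ℝ → ℝ) (hf : BernsteinComb.MemCw α β f)
    (α₀ : ℝ) (hα₀ : α₀ ∈ Ioo (0 : ℝ) r) :
    (∃ C : ℝ, ∃ N : ℕ, ∀ n : ℕ, N ≤ n → ∀ x ∈ Ioo (0 : ℝ) 1,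
      BernsteinComb.weight α β x * |f x - BernsteinComb.bernsteinStar ψ r nd c n f x| ≤
        C * ((n : ℝ) ^ (-(1 / 2) : ℝ) * (ϕ x)⁻¹ * BernsteinComb.delta n x) ^ α₀) ↔
    (∃ C : ℝ, ∃ t₀ : ℝ, 0 < t₀ ∧ ∀ t ∈ Ioc (0 : ℝ) t₀,
      BernsteinComb.dtModulus A r α β b₀ b₁ ϕ f t ≤ ENNReal.ofReal (C * t ^ α₀)) := by
  obtain ⟨hα₀0, hα₀r⟩ := hα₀
  obtain ⟨M₀, hM₀, hwf⟩ := hf.exists_weightedBound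
  -- Positivity of A follows from 0 < ϕ(1/2) ≤ A (1/2)^{b₀}.
  have hA0 : 0 < A := by
    have h1 : (1 / 2 : ℝ) ∈ Ioo (0 : ℝ) 1 := by constructor <;> norm_num
    have h2 := (hϕ.pos h1).trans_le (hA _ h1).1
    exact pos_of_mul_pos_left h2 (by positivity)
  have hcont' : ContinuousOn (fun u => f (1 - u)) (Ioo 0 1) :=
    hf.continuousOn.comp (by fun_prop) fun x hx => ⟨by linarith [hx.2], by linarith [hx.1]⟩
  constructor
  · intro h
    have h : ErrorBound ψ r nd c α β α₀ ϕ f := h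
    obtain ⟨C₁, N₁, hC₁, h₁⟩ := h.exists_left hβ hα₀0 hϕ
    obtain ⟨C₂, N₂, hC₂, h₂⟩ := (h.reflect hψ hc).exists_left hα hα₀0 hϕ.reflect
    obtain ⟨M, hM, hL⟩ := exists_locallyApproximable_of_error_le hψ hr hc hα hβ
      (hb.trans (min_le_left _ _)) hα₀0 hα₀r hC₁ hM₀ hwf h₁
    obtain ⟨M', hM', hR⟩ := exists_locallyApproximable_of_error_le hψ hr hc hβ hα
      (hb.trans (min_le_right _ _)) hα₀0 hα₀r hC₂ hM₀ hwf.reflect h₂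
    exact exists_dtModulus_le hA0 (by omega) hα hβ hα₀0 hM hM' hM₀ hϕ hA hwf hL hR
  · intro h
    have hD := differenceBound_of_dtModulus h
    obtain ⟨M, hM, hL⟩ := hD.exists_locallyApproximable hA0 (by omega) hα hβ hα₀0 hM₀ hϕ
      hf.continuousOn hwf
    obtain ⟨M', hM', hR⟩ := hD.reflect.exists_locallyApproximable hA0 (by omega) hβ hα hα₀0 hM₀
      hϕ.reflect hcont' hwf.reflect
    exact errorBound_of_locallyApproximable hψ hr hc hα hβ hα₀0 hA0 hM hM' hM₀ hϕ hA hwf hL hR
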